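/- **Setting.** An input consists of a buffer size $k$ and items $1,\dots,n$, item $i$ arriving at time $i$ with colour $c(i)$. An RBM schedule is a bijection between the items and the output slots $k+1,\dots,k+n$ such that an item output in slot $j$ has arrived before $j$ (its index is $<j$) and items of the same colour are output in input order; its cost is the number of maximal intervals of equally coloured items in the output. A *batch* $(I,j)$ consists of a nonempty set $I$ of all the items of one colour between the first and the last item of $I$, and a slot $j$, such that some RBM schedule outputs $I$ consecutively starting at slot $j$. A *fractional solution* is a feasible solution of the linear program $\mathrm{LP}_k$: minimize $\sum_{(I,j)}x_{I,j}$ subject to $\sum_{(I,j):\,i\in I}x_{I,j}\ge 1$ for every item $i$, $\sum_{(I,j'):\,j'\le j<j'+|I|}x_{I,j'}\le 1$ for $j=k+1,\dots,k+n$, and $x\ge 0$. A batch $(I,j)$ schedules the $r$-th item of $I$ in slot $j+r-1$; accordingly $x$ removes fractional weights of items in every slot. **Rounding procedure** (parameter $\delta>0$). It works in phases. Let $t_0$ be the first vacant output slot. The buffer holds the items with index $<t_0$ that were not output yet; the *block* of a colour is the set of its items in the buffer. Evicting a block means outputting items of its colour in input order, including those that arrive along the way, until none is in the buffer. The decisions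 at $t_0$ depend only on the items with index $<t_0$, on the weights that $x$ schedules in slots $\le t_0$, and on the procedure's own past. The first case that applies is executed. 1. Some item in the buffer has had weight at least $\delta$ removed by $x$ before $t_0$: evict the block of such an item. 2. The items in the buffer that $x$ schedules at $t_0$ have total weight at least $2\delta$ there: choose one at random with probability proportional to this weight, and evict its block. 3. More than $\frac12$ of the weight scheduled by $x$ at $t_0$ belongs to the colour output in slot $t_0-1$: choose a set of blocks by the selection procedure below, and evict them all in any order. 4. Otherwise: choose a largest and a second largest block (only the first if the buffer has one colour), and also apply the selection procedure with the same largest block. Evict the largest, then the second largest, then the other chosen blocks in any order; but if after evicting the largest or the second largest block one of Cases 1–3 applies, end the phase without evicting the remaining chosen blocks and annul the locks created by the selection. *Selection procedure.* Volume scheduled by $x$ starts unlocked. For a colour $c$ in the buffer, let $w_c$ be the average, over the items of its block, of the unlocked volume of the item that $x$ scheduled before $t_0$. Partition the colours into classes according to the $s\ge 1$ with block size in $[2^{s-1},2^s)$. In each class, form disjoint subclasses by collecting colours until their total $w_c$ reaches $\delta$, as long as the remaining weight in the class is at least $\delta$. In each subclass choose one colour at random with probability proportional to $w_c$; its block locks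 all the unlocked volume, scheduled before $t_0$, of the buffer items with colours in the subclass, until the weight left in the fractional buffer (one minus the weight removed by $x$) of some item of the locking block drops below $1-\delta$. Finally, also choose a largest block. **Statement.** There is $\delta_0>0$ such that for every $\delta\in(0,\delta_0)$ randomized online algorithms following this procedure exist, and there is a constant $C=C(\delta)$ such that for every such algorithm (whatever the choices that the procedure leaves open, such as ties, orders, and the joint law of the random choices made in different subclasses of one selection), every input, and every feasible solution $x$ of $\mathrm{LP}_k$ (in particular, every feasible one that is generated online by a deterministic algorithm), the output is always an RBM schedule, and its expected cost is at most $C\cdot\sum_{(I,j)}x_{I,j}$. -/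

import Mathlib

noncomputable section

namespace RBM

open scoped Classical

/-- An input of reordering buffer management: the buffer size `k`, and a sequence of `n` items
`1, …, n`, where item `i` arrives at time `i` and has colour `color i`
(the values of `color` outside `1, …, n` play no role). -/
structure Input where
  k : ℕ
  n : ℕ
  color : ℕ → ℕ

/-- An RBM solution, listed in output order: the entry number `m` (counted from `0`) uses the output
slot `k + 1 + m`.  Every item is output exactly once in the slots `k + 1, …, k + n`, an item that is
output in slot `j` has arrived before `j`, and items of the same colour keep their input order. -/
def IsSchedule (inp : Input) (out : List ℕ) : Prop :=
  out.Perm (List.range' 1 inp.n) ∧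
  (∀ (m : ℕ) (hm : m < out.length), out[m] < inp.k + 1 + m) ∧
  out.Pairwise (fun a b => inp.color a = inp.color b → a < b)

/-- The cost of an output sequence: the number of maximal intervals of equally coloured items. -/
def cost (inp : Input) (out : List ℕ) : ℕ :=
  ((out.map inp.color).destutter (· ≠ ·)).length

/-- `(I, j)` is a batch: `I` consists of all the items of one colour between its first and its last
item, and some RBM solution outputs `I` (in input order) starting at slot `j`. -/
def IsBatch (inp : Input) (I : Finset ℕ) (j : ℕ) : Prop :=
  I.Nonempty ∧ I ⊆ Finset.Icc 1 inp.n ∧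
  (∀ a ∈ I, ∀ b ∈ I, inp.color a = inp.color b) ∧
  (∀ a ∈ I, ∀ b ∈ I, ∀ i, a ≤ i → i ≤ b → inp.color i = inp.color a → i ∈ I) ∧
  inp.k + 1 ≤ j ∧
  ∃ out, IsSchedule inp out ∧ I.sort (· ≤ ·) <+: out.drop (j - (inp.k + 1))

/-- The finite set of all batches, which indexes the variables of the linear program. -/
def batches (inp : Input) : Finset (Finset ℕ × ℕ) :=
  ((Finset.Icc 1 inp.n).powerset ×ˢ Finset.Icc (inp.k + 1) (inp.k + inp.n)).filter
    (fun b => IsBatch inp b.1 b.2)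

/-- `x` is a feasible solution of the linear programming relaxation: every item is covered by
batches of total weight at least `1`, and every output slot is used with total weight at most `1`. -/
def IsFeasible (inp : Input) (x : Finset ℕ × ℕ → ℝ) : Prop :=
  (∀ b ∈ batches inp, 0 ≤ x b) ∧
  (∀ i ∈ Finset.Icc 1 inp.n, 1 ≤ ∑ b ∈ (batches inp).filter (fun b => i ∈ b.1), x b) ∧
  (∀ j ∈ Finset.Icc (inp.k + 1) (inp.k + inp.n),
    ∑ b ∈ (batches inp).filter (fun b => b.2 ≤ j ∧ j < b.2 + b.1.card), x b ≤ 1)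

/-- The value of the fractional solution. -/
def value (inp : Input) (x : Finset ℕ × ℕ → ℝ) : ℝ :=
  ∑ b ∈ batches inp, x b

/-- The weight of item `i` that the fractional solution schedules in the output slot `s`: a batch
`(I, j)` outputs its item `i` in the slot `j + #{a ∈ I | a < i}`. -/
def rate (inp : Input) (x : Finset ℕ × ℕ → ℝ) (i s : ℕ) : ℝ :=
  ∑ b ∈ (batches inp).filter (fun b => i ∈ b.1 ∧ b.2 + (b.1.filter (· < i)).card = s), x b

/-- A lock: `amount i` is the volume of item `i` that is locked, and `block` is the evicted colour
block to which this volume is assigned. -/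
structure Lock where
  block : Finset ℕ
  amount : ℕ → ℝ

/-- What the online rounding algorithm knows when it has to fill the output slot `slot`: the items
that arrived before `slot` and their colours, the fractional schedule in the slots up to `slot`,
its own output so far, and the locks it has created. -/
structure View where
  slot : ℕ
  items : Finset ℕ
  color : ℕ → ℕ
  frac : ℕ → ℕ → ℝ
  out : List ℕ
  locks : List Lock

namespace View

/-- The content of the buffer. -/
def buffer (V : View) : Finset ℕ := V.items.filter (fun i => i ∉ V.out)

/-- The block of colour `c`: the items of this colour in the buffer. -/
def block (V : View) (c : ℕ) : Finset ℕ := V.buffer.filter (fun i => V.color i = c)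

/-- The colours in the buffer. -/
def colors (V : View) : Finset ℕ := V.buffer.image V.color

/-- The weight of item `i` that the fractional solution removed before the current slot. -/
def removed (V : View) (i : ℕ) : ℝ := ∑ s ∈ Finset.range V.slot, V.frac i s

/-- The volume of item `i` that is locked now.  A lock is in force as long as every item of its
block has weight at least `1 - δ` in the fractional buffer. -/
def locked (V : View) (δ : ℝ) (i : ℕ) : ℝ :=
  ((V.locks.filter (fun L => ∀ a ∈ L.block, 1 - δ ≤ 1 - V.removed a)).map
    (fun L => L.amount i)).sum

/-- The unlocked volume of item `i` that was fractionally scheduled before the current slot. -/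
def unlocked (V : View) (δ : ℝ) (i : ℕ) : ℝ := V.removed i - V.locked δ i

/-- `w_c`: the average of the unlocked volume over the items of colour `c` in the buffer. -/
def weight (V : View) (δ : ℝ) (c : ℕ) : ℝ :=
  (∑ i ∈ V.block c, V.unlocked δ i) / ((V.block c).card : ℝ)

/-- The sum of `w_c` over a set of colours. -/
def totalWeight (V : View) (δ : ℝ) (S : Finset ℕ) : ℝ := ∑ c ∈ S, V.weight δ c

/-- The class of the colours whose block has size in `[2 ^ s, 2 ^ (s + 1))`. -/
def sizeClass (V : View) (s : ℕ) : Finset ℕ :=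
  V.colors.filter (fun c => 2 ^ s ≤ (V.block c).card ∧ (V.block c).card < 2 ^ (s + 1))

/-- `c` is a colour in `T` with a largest block. -/
def IsLargest (V : View) (T : Finset ℕ) (c : ℕ) : Prop :=
  c ∈ T ∧ ∀ d ∈ T, (V.block d).card ≤ (V.block c).card

/-- Some item in the buffer was fractionally removed with weight at least `δ`. -/
def Case1 (V : View) (δ : ℝ) : Prop := ∃ i ∈ V.buffer, δ ≤ V.removed i

/-- The items of the buffer are scheduled in the current slot with total weight at least `2 δ`. -/
def Case2 (V : View) (δ : ℝ) : Prop := 2 * δ ≤ ∑ i ∈ V.buffer, V.frac i V.slot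

/-- More than half of the weight scheduled in the current slot belongs to the colour that was output
in the previous slot. -/
def Case3 (V : View) : Prop :=
  ∃ a, V.out.getLast? = some a ∧
    1 / 2 < ∑ i ∈ V.items.filter (fun i => V.color i = V.color a), V.frac i V.slot

/-- `subs` is a possible family of subclasses.  A subclass is obtained by collecting colours of one
class until the total weight reaches `δ` (so without the colour `c` collected last the weight is
still below `δ`).  The subclasses are disjoint, and subclasses are formed as long as the remaining
weight in a class is at least `δ`. -/
def IsSubclassFamily (V : View) (δ : ℝ) (subs : Finset (Finset ℕ)) : Prop :=
  (∀ S ∈ subs, (∃ s, S ⊆ V.sizeClass s) ∧ δ ≤ V.totalWeight δ S ∧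
    ∃ c ∈ S, V.totalWeight δ (S.erase c) < δ) ∧
  (∀ S ∈ subs, ∀ T ∈ subs, S ≠ T → Disjoint S T) ∧
  (∀ s, V.totalWeight δ (V.sizeClass s \ subs.biUnion id) < δ)

/-- `q` is the law of a random choice `f` of one colour `f S` in each subclass `S`, where a colour is
chosen with probability proportional to its weight.  No assumption is made on the joint law of the
choices in different subclasses. -/
def IsChoiceLaw (V : View) (δ : ℝ) (subs : Finset (Finset ℕ)) (q : PMF (Finset ℕ → ℕ)) : Prop :=
  ∀ S ∈ subs, ∀ c ∈ S,
    (q.map (fun f => f S)) c = ENNReal.ofReal (V.weight δ c / V.totalWeight δ S)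

/-- The locks created by the choice `f`: the block of the colour chosen in `S` locks all the unlocked
volume of the buffer items with colours in `S`. -/
def newLocks (V : View) (δ : ℝ) (subs : Finset (Finset ℕ)) (f : Finset ℕ → ℕ) : List Lock :=
  subs.toList.map (fun S =>
    { block := V.block (f S)
      amount := fun i => if i ∈ V.buffer ∧ V.color i ∈ S then V.unlocked δ i else 0 })

end View

/-- The decision taken at the beginning of a phase.  The blocks of the colours `lead` are evicted
first; after each of them the phase ends if one of the first three cases applies.  Then the blocks of
the colours `rest` are evicted and the locks `locks` are created. -/
structure Plan where
  lead : List ℕ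
  rest : List ℕ
  locks : List Lock

/-- `p` is the law of the plan that the rounding procedure draws at the beginning of a phase, for
some resolution of the choices that the procedure leaves open (the item in the first case, ties
between largest blocks, the order in which colours are collected into subclasses, and the order in
which the chosen blocks are evicted). -/
def IsPhaseLaw (δ : ℝ) (V : View) (p : PMF Plan) : Prop :=
  (V.Case1 δ →
    ∃ i ∈ V.buffer, δ ≤ V.removed i ∧
      p = PMF.pure { lead := [], rest := [V.color i], locks := [] }) ∧
  (¬ V.Case1 δ → V.Case2 δ →
    ∃ q : PMF ℕ,
      (∀ i ∈ V.buffer,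
        q i = ENNReal.ofReal (V.frac i V.slot / ∑ a ∈ V.buffer, V.frac a V.slot)) ∧
      p = q.map (fun i => { lead := [], rest := [V.color i], locks := [] })) ∧
  (¬ V.Case1 δ → ¬ V.Case2 δ → V.Case3 →
    ∃ subs : Finset (Finset ℕ), V.IsSubclassFamily δ subs ∧
    ∃ q : PMF (Finset ℕ → ℕ), V.IsChoiceLaw δ subs q ∧
    ∃ c₁, V.IsLargest V.colors c₁ ∧
    ∃ order : (Finset ℕ → ℕ) → List ℕ,
      (∀ f, (order f).Nodup ∧ (order f).toFinset = insert c₁ (subs.image f)) ∧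
      p = q.map (fun f => { lead := [], rest := order f, locks := V.newLocks δ subs f })) ∧
  (¬ V.Case1 δ → ¬ V.Case2 δ → ¬ V.Case3 →
    ∃ subs : Finset (Finset ℕ), V.IsSubclassFamily δ subs ∧
    ∃ q : PMF (Finset ℕ → ℕ), V.IsChoiceLaw δ subs q ∧
    ∃ c₁, V.IsLargest V.colors c₁ ∧
    ∃ second : List ℕ,
      ((V.colors = {c₁} ∧ second = []) ∨
        ∃ c₂, V.IsLargest (V.colors.erase c₁) c₂ ∧ second = [c₂]) ∧
    ∃ order : (Finset ℕ → ℕ) → List ℕ,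
      (∀ f, (order f).Nodup ∧ (order f).toFinset = subs.image f \ (c₁ :: second).toFinset) ∧
      p = q.map (fun f =>
        { lead := c₁ :: second, rest := order f, locks := V.newLocks δ subs f }))

/-- The views in which the procedure has to decide something meaningful: the buffer is not empty,
and the fractional weights and the unlocked volumes are not negative. -/
def IsProperView (δ : ℝ) (V : View) : Prop :=
  V.buffer.Nonempty ∧ (∀ i s, 0 ≤ V.frac i s) ∧ ∀ i ∈ V.buffer, 0 ≤ V.unlocked δ i

/-- `π` is an online rounding algorithm that follows the phase-based procedure with parameter `δ`:
the random decision at the beginning of each phase is a function of the information available at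
that time only. -/
def IsRounding (δ : ℝ) (π : View → PMF Plan) : Prop :=
  ∀ V, IsProperView δ V → IsPhaseLaw δ V (π V)

/-- The state of the rounding algorithm: its output so far and the locks created so far. -/
structure State where
  out : List ℕ
  locks : List Lock

/-- The information available in a state: only the items that arrived before the next vacant slot,
and the fractional schedule up to this slot. -/
def view (inp : Input) (x : Finset ℕ × ℕ → ℝ) (st : State) : View where
  slot := inp.k + 1 + st.out.length
  items := (Finset.Icc 1 inp.n).filter (fun i => i < inp.k + 1 + st.out.length)
  color := fun i => if 1 ≤ i ∧ i ≤ inp.n ∧ i < inp.k + 1 + st.out.length then inp.color i else 0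
  frac := fun i s => if s ≤ inp.k + 1 + st.out.length then rate inp x i s else 0
  out := st.out
  locks := st.locks

/-- The items of colour `c` in the buffer. -/
def available (inp : Input) (c : ℕ) (st : State) : Finset ℕ :=
  (Finset.Icc 1 inp.n).filter
    (fun i => i < inp.k + 1 + st.out.length ∧ i ∉ st.out ∧ inp.color i = c)

/-- Output the earliest item of colour `c` in the buffer, if there is one. -/
def evictStep (inp : Input) (c : ℕ) (st : State) : State :=
  if h : (available inp c st).Nonempty then
    { out := st.out ++ [(available inp c st).min' h], locks := st.locks }
  else st

/-- Evict the block of colour `c`: output items of colour `c`, including those that arrive along the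
way, until the buffer contains none (at most `n` items can be output). -/
def evict (inp : Input) (c : ℕ) (st : State) : State := (evictStep inp c)^[inp.n] st

/-- Evict the given blocks, but stop after a block if one of the first three cases applies then; the
Boolean tells whether this happened. -/
def runLead (δ : ℝ) (inp : Input) (x : Finset ℕ × ℕ → ℝ) : List ℕ → State → State × Bool
  | [], st => (st, false)
  | c :: cs, st =>
    if (view inp x (evict inp c st)).Case1 δ ∨ (view inp x (evict inp c st)).Case2 δ ∨
        (view inp x (evict inp c st)).Case3 then
      (evict inp c st, true)
    else runLead δ inp x cs (evict inp c st)

/-- Execute a phase with the given plan.  If the phase is ended early, the blocks in `rest` are not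
evicted and their locks are annulled. -/
def runPhase (δ : ℝ) (inp : Input) (x : Finset ℕ × ℕ → ℝ) (st : State) (P : Plan) : State :=
  if (runLead δ inp x P.lead st).2 = true then (runLead δ inp x P.lead st).1
  else
    { out := (P.rest.foldl (fun s c => evict inp c s) (runLead δ inp x P.lead st).1).out
      locks := st.locks ++ P.locks }

/-- One phase; nothing happens once all items have been output. -/
def step (δ : ℝ) (inp : Input) (x : Finset ℕ × ℕ → ℝ) (π : View → PMF Plan) (st : State) :
    PMF State :=
  if st.out.length = inp.n then PMF.pure st
  else (π (view inp x st)).map (runPhase δ inp x st)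

/-- The law of the state after a number of phases. -/
def run (δ : ℝ) (inp : Input) (x : Finset ℕ × ℕ → ℝ) (π : View → PMF Plan) : ℕ → PMF State
  | 0 => PMF.pure { out := [], locks := [] }
  | m + 1 => (run δ inp x π m).bind (step δ inp x π)

/-- The law of the output of the rounding algorithm.  (Every phase outputs at least one item, so that
there are at most `n` phases.) -/
def outputLaw (δ : ℝ) (inp : Input) (x : Finset ℕ × ℕ → ℝ) (π : View → PMF Plan) :
    PMF (List ℕ) :=
  (run δ inp x π inp.n).map State.out

/-- The expected cost of the output of the rounding algorithm. -/
def expectedCost (δ : ℝ) (inp : Input) (x : Finset ℕ × ℕ → ℝ) (π : View → PMF Plan) : ENNReal :=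
  ∑' out, outputLaw δ inp x π out * (cost inp out : ENNReal)

end RBM

end

/-! The proof is an amortised analysis. The potential `pot` may look into the future of `x`, since
`x` is fixed and only the algorithm has to be online. The expectation of `total`, the cost so far
plus the potential, never increases in a phase (`phaseOk_step`). It starts at a constant times
`value` and always dominates the cost.

Summing the constraints shows that all of them are tight. So at any time the volume D that `x` has
removed from items still in the buffer equals the volume that `x` still has to schedule of items
already output (`sum_buf_rem`).

Apart from the subclass blocks, a phase costs at most κ = `phaseConst δ`: two blocks, plus 2/δ for
the growth of `freePot` and `futureWeight`. A state in Case 1 or 2 has to provide 2κ more, and one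
in Case 3 κ more, because its `credit` has paid for earlier phases. In Case 1 all batches that
scheduled the chosen item before are entirely output by the eviction, so `unsentWeight` drops by δ.
In Case 2 the batches now scheduling an item of an evicted block end during the eviction
(`batch_end_le_now_evict`). On average the random eviction lasts at least as long as the evictions
of half of the candidate weight, so `openWeight` drops by δ in expectation. Either drop releases 3κ.
In Cases 3 and 4 locks and subclasses give D ≤ 9δE, where E is the total size of the blocks to be
evicted (`Selected.sum_rem_le`). If a batch schedules already output items both at the beginning and
at the end of the phase, and its colour holds at most half of E, then it still has to schedule more
than E/2 old items. Such batches have total weight at most 18δ (`sum_lagging_le`). Consequently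
either Case 2 applies next, or open weight 1/4 disappears (`progress_of_case3`,
`progress_of_case4`). The colour output last has no block at all. In Case 4 only the largest block
can exceed half of E, and its colour has weight at most 1/2 once it is evicted, since otherwise the
phase ends early and the next case pays.

Each subclass block costs 1, which `freePot` pays. Volume locked until its own block is due for Case
1 is lost for later selections. A choice proportional to the weights outlasts, on average, at least
half of the weight of its subclass (`sum_mul_sum_ite_ge`), so `freePot` loses at least δ/2 and is
scaled by 2/δ. It regains little: `freePot` plus `futureWeight` grows by at most 1 per phase
(`freePot_evicted_le`). -/

noncomputable section

namespace RBM

open scoped Classical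

/-! ### The linear program: slots of batches, double counting, tightness of the constraints. -/

section

/-- The output slot in which the batch `b` schedules the item `i`. -/
def slotOf (b : Finset ℕ × ℕ) (i : ℕ) : ℕ := b.2 + (b.1.filter (· < i)).card

/-- The weight of item `i` that the fractional solution schedules before slot `t`. -/
def rem (inp : Input) (x : Finset ℕ × ℕ → ℝ) (t i : ℕ) : ℝ :=
  ∑ s ∈ Finset.range t, rate inp x i s

variable {inp : Input} {x : Finset ℕ × ℕ → ℝ}

theorem IsSchedule.length_eq {out : List ℕ} (h : IsSchedule inp out) : out.length = inp.n := by
  simpa using h.1.length_eq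

theorem mem_batches_iff {b : Finset ℕ × ℕ} (hb : b ∈ batches inp) : IsBatch inp b.1 b.2 :=
  (Finset.mem_filter.1 hb).2

theorem mem_Icc_of_mem_batch {b : Finset ℕ × ℕ} (hb : b ∈ batches inp) {i : ℕ} (hi : i ∈ b.1) :
    1 ≤ i ∧ i ≤ inp.n :=
  Finset.mem_Icc.1 ((mem_batches_iff hb).2.1 hi)

theorem color_eq_of_mem_batch {b : Finset ℕ × ℕ} (hb : b ∈ batches inp) {i i' : ℕ} (hi : i ∈ b.1)
    (hi' : i' ∈ b.1) : inp.color i = inp.color i' :=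
  (mem_batches_iff hb).2.2.1 i hi i' hi'

theorem le_start_of_mem_batches {b : Finset ℕ × ℕ} (hb : b ∈ batches inp) : inp.k + 1 ≤ b.2 :=
  (mem_batches_iff hb).2.2.2.2.1

theorem batch_end_le {b : Finset ℕ × ℕ} (hb : b ∈ batches inp) :
    b.2 + b.1.card ≤ inp.k + inp.n + 1 := by
  obtain ⟨hne, -, -, -, hj, out, hout, hpre⟩ := mem_batches_iff hb
  have h1 := hpre.length_le
  have h2 := hout.length_eq
  rw [List.length_drop, Finset.length_sort] at h1
  have := hne.card_pos
  omega

/-- The schedule witnessing the batch outputs the item of rank `r` in slot `b.2 + r`, after its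
arrival, and `slotOf` counts at least the `r` smaller items. -/
theorem lt_slotOf {b : Finset ℕ × ℕ} (hb : b ∈ batches inp) {i : ℕ} (hi : i ∈ b.1) :
    i < slotOf b i := by
  obtain ⟨hne, -, -, -, hj, out, hout, hpre⟩ := mem_batches_iff hb
  obtain ⟨r, hr, hri⟩ := List.mem_iff_getElem.1 ((Finset.mem_sort (· ≤ ·)).2 hi)
  have hlen := hpre.length_le
  rw [List.length_drop] at hlen
  have h1 : (b.1.sort (· ≤ ·))[r] = out[b.2 - (inp.k + 1) + r]'(by omega) := by
    rw [hpre.getElem hr, List.getElem_drop]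
  have h2 := hout.2.1 (b.2 - (inp.k + 1) + r) (by omega)
  have h3 : r ≤ (b.1.filter (· < i)).card := by
    have hs : ((b.1.sort (· ≤ ·)).take r).toFinset ⊆ b.1.filter (· < i) := by
      intro a ha
      rw [List.mem_toFinset] at ha
      obtain ⟨m, hm, hma⟩ := List.mem_iff_getElem.1 ha
      rw [List.getElem_take] at hma
      rw [List.length_take] at hm
      have hab : a ∈ b.1 := (Finset.mem_sort (· ≤ ·)).1 (List.mem_of_mem_take ha)
      have : (b.1.sort (· ≤ ·))[m] < (b.1.sort (· ≤ ·))[r] :=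
        List.pairwise_iff_getElem.1 (Finset.sortedLT_sort b.1).pairwise _ _ _ _ (by omega)
      simp only [Finset.mem_filter]
      exact ⟨hab, by omega⟩
    have := Finset.card_le_card hs
    rwa [List.toFinset_card_of_nodup ((Finset.sort_nodup b.1 (· ≤ ·)).sublist (List.take_sublist _ _)),
      List.length_take, min_eq_left hr.le] at this
  unfold slotOf
  omega

theorem slotOf_lt_end {b : Finset ℕ × ℕ} {i : ℕ} (hi : i ∈ b.1) : slotOf b i < b.2 + b.1.card := by
  have : (b.1.filter (· < i)).card < b.1.card := by
    apply Finset.card_lt_card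
    rw [Finset.filter_ssubset]
    exact ⟨i, hi, by simp⟩
  unfold slotOf
  omega

theorem slotOf_lt_slotOf {b : Finset ℕ × ℕ} {i i' : ℕ} (hi : i ∈ b.1) (h : i < i') :
    slotOf b i < slotOf b i' := by
  have : (b.1.filter (· < i)).card < (b.1.filter (· < i')).card := by
    apply Finset.card_lt_card
    rw [Finset.ssubset_iff_of_subset]
    · exact ⟨i, by simp [hi, h], by simp⟩
    · intro a ha
      simp only [Finset.mem_filter] at ha ⊢
      exact ⟨ha.1, by omega⟩
  unfold slotOf
  omega

theorem slotOf_injOn (b : Finset ℕ × ℕ) : Set.InjOn (slotOf b) b.1 := by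
  intro i hi i' hi' h
  rcases lt_trichotomy i i' with h1 | h1 | h1
  · have := slotOf_lt_slotOf (b := b) hi h1; omega
  · exact h1
  · have := slotOf_lt_slotOf (b := b) hi' h1; omega

theorem image_slotOf (b : Finset ℕ × ℕ) : b.1.image (slotOf b) = Finset.Ico b.2 (b.2 + b.1.card) := by
  apply Finset.eq_of_subset_of_card_le
  · intro s hs
    obtain ⟨i, hi, rfl⟩ := Finset.mem_image.1 hs
    exact Finset.mem_Ico.2 ⟨by unfold slotOf; omega, slotOf_lt_end hi⟩
  · rw [Finset.card_image_of_injOn (slotOf_injOn b)]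
    simp

theorem exists_slotOf_eq {b : Finset ℕ × ℕ} {s : ℕ} (h1 : b.2 ≤ s) (h2 : s < b.2 + b.1.card) :
    ∃ i ∈ b.1, slotOf b i = s := by
  have : s ∈ b.1.image (slotOf b) := by rw [image_slotOf]; exact Finset.mem_Ico.2 ⟨h1, h2⟩
  simpa using this

theorem start_le_slotOf (b : Finset ℕ × ℕ) (i : ℕ) : b.2 ≤ slotOf b i := by
  unfold slotOf; omega

/-- A batch fills each slot of its window exactly once. This turns a stretch of time inside a batch
into a number of items. -/
theorem card_slots_Ico {b : Finset ℕ × ℕ} {s t : ℕ} (h1 : b.2 ≤ s) (h2 : t ≤ b.2 + b.1.card) :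
    (b.1.filter (fun i => s ≤ slotOf b i ∧ slotOf b i < t)).card = t - s := by
  rw [← Finset.card_image_of_injOn ((slotOf_injOn b).mono (by intro i; simp; tauto)), ← Nat.card_Ico]
  congr 1
  ext u
  simp only [Finset.mem_image, Finset.mem_filter, Finset.mem_Ico]
  constructor
  · rintro ⟨i, ⟨-, h⟩, rfl⟩; exact h
  · rintro ⟨h3, h4⟩
    obtain ⟨i, hi, rfl⟩ := exists_slotOf_eq (b := b) (s := u) (by omega) (by omega)
    exact ⟨i, ⟨hi, h3, h4⟩, rfl⟩

theorem rate_eq (i s : ℕ) :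
    rate inp x i s = ∑ b ∈ batches inp, if i ∈ b.1 ∧ slotOf b i = s then x b else 0 := by
  rw [rate, Finset.sum_filter]
  rfl

theorem rate_nonneg (hx : IsFeasible inp x) (i s : ℕ) : 0 ≤ rate inp x i s :=
  Finset.sum_nonneg fun b hb => hx.1 b (Finset.mem_of_mem_filter b hb)

/-- Double counting: volume summed over items and slots is regrouped by batches. All later
comparisons are made batch by batch in this form. -/
theorem sum_rate_sum (F S : Finset ℕ) :
    ∑ i ∈ F, ∑ s ∈ S, rate inp x i s =
      ∑ b ∈ batches inp, x b * ((b.1.filter (fun i => i ∈ F ∧ slotOf b i ∈ S)).card : ℝ) := by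
  simp_rw [rate_eq]
  have h1 : ∀ i, ∑ s ∈ S, ∑ b ∈ batches inp, (if i ∈ b.1 ∧ slotOf b i = s then x b else 0) =
      ∑ b ∈ batches inp, if i ∈ b.1 ∧ slotOf b i ∈ S then x b else 0 := by
    intro i
    rw [Finset.sum_comm]
    refine Finset.sum_congr rfl fun b _ => ?_
    by_cases hi : i ∈ b.1
    · simp [hi]
    · simp [hi]
  simp_rw [h1]
  rw [Finset.sum_comm]
  refine Finset.sum_congr rfl fun b _ => ?_
  rw [← Finset.sum_filter, Finset.sum_const, nsmul_eq_mul, mul_comm]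
  congr 3
  ext i
  simp only [Finset.mem_filter]
  tauto

/-- Within one slot a batch schedules at most one item, by injectivity of `slotOf`, so its count is
0 or 1. -/
theorem sum_rate (F : Finset ℕ) (s : ℕ) :
    ∑ i ∈ F, rate inp x i s =
      ∑ b ∈ batches inp, if ∃ i ∈ F, i ∈ b.1 ∧ slotOf b i = s then x b else 0 := by
  have h := sum_rate_sum (inp := inp) (x := x) F {s}
  simp only [Finset.sum_singleton, Finset.mem_singleton] at h
  rw [h]
  refine Finset.sum_congr rfl fun b _ => ?_
  split_ifs with hex
  · obtain ⟨i, hF, hi, his⟩ := hex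
    have : b.1.filter (fun i => i ∈ F ∧ slotOf b i = s) = {i} := by
      ext a
      simp only [Finset.mem_filter, Finset.mem_singleton]
      constructor
      · rintro ⟨h1, -, h2⟩
        exact slotOf_injOn b h1 hi (h2.trans his.symm)
      · rintro rfl; exact ⟨hi, hF, his⟩
    rw [this]; simp
  · have : b.1.filter (fun i => i ∈ F ∧ slotOf b i = s) = ∅ := by
      ext a
      simp only [Finset.mem_filter, Finset.notMem_empty, iff_false]
      rintro ⟨h1, h2, h3⟩
      exact hex ⟨a, h2, h1, h3⟩
    rw [this]; simp

theorem rem_eq (t i : ℕ) :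
    rem inp x t i = ∑ b ∈ batches inp, if i ∈ b.1 ∧ slotOf b i < t then x b else 0 := by
  have h := sum_rate_sum (inp := inp) (x := x) {i} (Finset.range t)
  rw [Finset.sum_singleton] at h
  rw [rem, h]
  refine Finset.sum_congr rfl fun b _ => ?_
  simp only [Finset.mem_singleton, Finset.mem_range]
  split_ifs with hi
  · have : b.1.filter (fun a => a = i ∧ slotOf b a < t) = {i} := by
      ext a
      simp only [Finset.mem_filter, Finset.mem_singleton]
      constructor
      · rintro ⟨-, h1, -⟩; exact h1
      · rintro rfl; exact ⟨hi.1, rfl, hi.2⟩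
    rw [this]; simp
  · have : b.1.filter (fun a => a = i ∧ slotOf b a < t) = ∅ := by
      ext a
      simp only [Finset.mem_filter, Finset.notMem_empty, iff_false]
      rintro ⟨h1, rfl, h3⟩
      exact hi ⟨h1, h3⟩
    rw [this]; simp

theorem rem_mono (hx : IsFeasible inp x) {s t : ℕ} (h : s ≤ t) (i : ℕ) :
    rem inp x s i ≤ rem inp x t i :=
  Finset.sum_le_sum_of_subset_of_nonneg (Finset.range_mono h) fun _ _ _ => rate_nonneg hx _ _

theorem rem_nonneg (hx : IsFeasible inp x) (t i : ℕ) : 0 ≤ rem inp x t i :=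
  Finset.sum_nonneg fun _ _ => rate_nonneg hx _ _

theorem rate_eq_zero {i s : ℕ} (h : s ≤ i ∨ i < 1 ∨ inp.n < i) : rate inp x i s = 0 := by
  rw [rate_eq]
  refine Finset.sum_eq_zero fun b hb => if_neg ?_
  rintro ⟨h1, rfl⟩
  have h2 := lt_slotOf hb h1
  have h3 := mem_Icc_of_mem_batch hb h1
  omega

theorem rem_eq_zero {i t : ℕ} (h : t ≤ i + 1 ∨ i < 1 ∨ inp.n < i) : rem inp x t i = 0 := by
  refine Finset.sum_eq_zero fun s hs => rate_eq_zero ?_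
  have := Finset.mem_range.1 hs
  omega

/-- The weight with which the output slot `s` is used. -/
def usage (inp : Input) (x : Finset ℕ × ℕ → ℝ) (s : ℕ) : ℝ :=
  ∑ b ∈ (batches inp).filter (fun b => b.2 ≤ s ∧ s < b.2 + b.1.card), x b

/-- The weight with which the item `i` is covered. -/
def cover (inp : Input) (x : Finset ℕ × ℕ → ℝ) (i : ℕ) : ℝ :=
  ∑ b ∈ (batches inp).filter (fun b => i ∈ b.1), x b

theorem usage_eq (s : ℕ) : usage inp x s = ∑ i ∈ Finset.Icc 1 inp.n, rate inp x i s := by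
  rw [sum_rate, usage, Finset.sum_filter]
  refine Finset.sum_congr rfl fun b hb => if_congr ?_ rfl rfl
  constructor
  · rintro ⟨h1, h2⟩
    obtain ⟨i, hi, rfl⟩ := exists_slotOf_eq h1 h2
    exact ⟨i, Finset.mem_Icc.2 (mem_Icc_of_mem_batch hb hi), hi, rfl⟩
  · rintro ⟨i, -, hi, rfl⟩
    exact ⟨start_le_slotOf b i, slotOf_lt_end hi⟩

theorem usage_eq_zero {s : ℕ} (h : s ≤ inp.k ∨ inp.k + inp.n < s) : usage inp x s = 0 := by
  rw [usage, Finset.filter_eq_empty_iff.2, Finset.sum_empty]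
  intro b hb h2
  have := le_start_of_mem_batches hb
  have := batch_end_le hb
  omega

theorem cover_eq (i : ℕ) : cover inp x i = rem inp x (inp.k + inp.n + 1) i := by
  rw [rem_eq, cover, Finset.sum_filter]
  refine Finset.sum_congr rfl fun b hb => if_congr ?_ rfl rfl
  refine ⟨fun h => ⟨h, ?_⟩, fun h => h.1⟩
  have := slotOf_lt_end h
  have := batch_end_le hb
  omega

theorem sum_cover_eq_sum_usage :
    ∑ i ∈ Finset.Icc 1 inp.n, cover inp x i =
      ∑ s ∈ Finset.Icc (inp.k + 1) (inp.k + inp.n), usage inp x s := by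
  simp_rw [cover_eq, usage_eq, rem]
  rw [Finset.sum_comm]
  symm
  apply Finset.sum_subset
  · intro s hs
    simp only [Finset.mem_Icc, Finset.mem_range] at hs ⊢
    omega
  · intro s hs hs'
    rw [← usage_eq]
    apply usage_eq_zero
    simp only [Finset.mem_Icc, Finset.mem_range] at hs hs'
    omega

/-- The covers sum to at least `inp.n`, the usages to at most `inp.n`, and the two sums are equal.
Hence every single inequality is tight. -/
theorem cover_eq_one (hx : IsFeasible inp x) {i : ℕ} (h1 : 1 ≤ i) (h2 : i ≤ inp.n) :
    cover inp x i = 1 := by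
  have hc : ∀ i ∈ Finset.Icc 1 inp.n, 1 ≤ cover inp x i := hx.2.1
  have hu : ∀ s ∈ Finset.Icc (inp.k + 1) (inp.k + inp.n), usage inp x s ≤ 1 := hx.2.2
  have hs := sum_cover_eq_sum_usage (inp := inp) (x := x)
  have h3 : ∑ s ∈ Finset.Icc (inp.k + 1) (inp.k + inp.n), usage inp x s ≤ inp.n := by
    refine (Finset.sum_le_sum hu).trans ?_
    simp
  have h4 : ∑ i ∈ Finset.Icc 1 inp.n, (1 : ℝ) = inp.n := by simp
  have h5 := (Finset.sum_eq_sum_iff_of_le hc).1 (le_antisymm (Finset.sum_le_sum hc) (by linarith))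
  exact (h5 i (Finset.mem_Icc.2 ⟨h1, h2⟩)).symm

theorem usage_eq_one (hx : IsFeasible inp x) {s : ℕ} (h1 : inp.k + 1 ≤ s) (h2 : s ≤ inp.k + inp.n) :
    usage inp x s = 1 := by
  have hc : ∀ i ∈ Finset.Icc 1 inp.n, 1 ≤ cover inp x i := hx.2.1
  have hu : ∀ s ∈ Finset.Icc (inp.k + 1) (inp.k + inp.n), usage inp x s ≤ 1 := hx.2.2
  have hs := sum_cover_eq_sum_usage (inp := inp) (x := x)
  have h3 : ∑ s ∈ Finset.Icc (inp.k + 1) (inp.k + inp.n), (1 : ℝ) = inp.n := by simp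
  have h4 : (inp.n : ℝ) ≤ ∑ i ∈ Finset.Icc 1 inp.n, cover inp x i := by
    refine le_trans ?_ (Finset.sum_le_sum hc)
    simp
  have h5 := (Finset.sum_eq_sum_iff_of_le hu).1 (le_antisymm (Finset.sum_le_sum hu) (by linarith))
  exact h5 s (Finset.mem_Icc.2 ⟨h1, h2⟩)

theorem usage_le_one (hx : IsFeasible inp x) (s : ℕ) : usage inp x s ≤ 1 := by
  by_cases h : s ≤ inp.k ∨ inp.k + inp.n < s
  · rw [usage_eq_zero h]; exact zero_le_one
  · exact (usage_eq_one hx (by omega) (by omega)).le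

theorem rem_le_one (hx : IsFeasible inp x) (t i : ℕ) : rem inp x t i ≤ 1 := by
  by_cases h : 1 ≤ i ∧ i ≤ inp.n
  · rw [← cover_eq_one hx h.1 h.2, cover_eq, rem_eq, rem_eq]
    refine Finset.sum_le_sum fun b hb => ?_
    have := hx.1 b hb
    have h3 : i ∈ b.1 → slotOf b i < inp.k + inp.n + 1 := fun hi =>
      (slotOf_lt_end hi).trans_le (batch_end_le hb)
    split_ifs <;> first | linarith | tauto
  · rw [rem_eq_zero (by omega)]; exact zero_le_one

/-- All slots are fully used, so `x` has removed exactly as much volume as the algorithm has output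
items. -/
theorem sum_rem (hx : IsFeasible inp x) {m : ℕ} (hm : m ≤ inp.n) :
    ∑ i ∈ Finset.Icc 1 inp.n, rem inp x (inp.k + 1 + m) i = m := by
  simp_rw [rem]
  rw [Finset.sum_comm]
  simp_rw [← usage_eq]
  rw [← Finset.sum_subset (s₁ := Finset.Ico (inp.k + 1) (inp.k + 1 + m))]
  · rw [Finset.sum_congr rfl (g := fun _ => (1 : ℝ))]
    · simp
    · intro s hs
      rw [Finset.mem_Ico] at hs
      exact usage_eq_one hx (by omega) (by omega)
  · intro s hs
    simp only [Finset.mem_Ico, Finset.mem_range] at hs ⊢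
    omega
  · intro s hs hs'
    apply usage_eq_zero
    simp only [Finset.mem_Ico, Finset.mem_range] at hs hs'
    omega

/-- With `k = 0` the first slot would need an item of index below 1, so there would be no schedule
and hence no batch to cover item 1. -/
theorem k_pos (hx : IsFeasible inp x) (hn : 0 < inp.n) : 0 < inp.k := by
  by_contra hk
  have h1 := cover_eq_one hx le_rfl hn
  have hb : ∃ b ∈ batches inp, 1 ∈ b.1 := by
    by_contra hne
    push Not at hne
    rw [cover, Finset.filter_eq_empty_iff.2 hne, Finset.sum_empty] at h1
    exact zero_ne_one h1
  obtain ⟨b, hb, -⟩ := hb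
  obtain ⟨-, -, -, -, -, out, hout, -⟩ := mem_batches_iff hb
  have h2 := hout.length_eq
  have h3 := hout.2.1 0 (by omega)
  have h4 : out[0]'(by omega) ∈ List.range' 1 inp.n := hout.1.subset (List.getElem_mem _)
  rw [List.mem_range'_1] at h4
  omega

theorem one_le_value (hx : IsFeasible inp x) (hn : 0 < inp.n) : 1 ≤ value inp x := by
  rw [← cover_eq_one hx le_rfl hn]
  exact Finset.sum_le_sum_of_subset_of_nonneg (Finset.filter_subset _ _) fun b hb _ => hx.1 b hb

end

/-! ### Evictions: validity of the output, cost, and batches that end during an eviction. -/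

section

variable {inp : Input} {x : Finset ℕ × ℕ → ℝ}

theorem card_Icc_one {n : ℕ} : (Finset.Icc 1 n).card = n := by simp

/-- The first vacant output slot. -/
def now (inp : Input) (st : State) : ℕ := inp.k + 1 + st.out.length

/-- The items in the buffer. -/
def buf (inp : Input) (st : State) : Finset ℕ :=
  (Finset.Icc 1 inp.n).filter (fun i => i < now inp st ∧ i ∉ st.out)

/-- The output so far is an initial part of an RBM schedule, and no item overtook an earlier item of
its colour. -/
structure Good (inp : Input) (st : State) : Prop where
  nodup : st.out.Nodup
  mem : ∀ a ∈ st.out, 1 ≤ a ∧ a ≤ inp.n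
  arrived : ∀ (m : ℕ) (hm : m < st.out.length), st.out[m] < inp.k + 1 + m
  order : st.out.Pairwise (fun a b => inp.color a = inp.color b → a < b)
  closed : ∀ a ∈ st.out, ∀ i, i ∉ st.out → 1 ≤ i → i ≤ inp.n → inp.color i = inp.color a → a < i

theorem mem_buf {st : State} {i : ℕ} :
    i ∈ buf inp st ↔ (1 ≤ i ∧ i ≤ inp.n) ∧ i < now inp st ∧ i ∉ st.out := by
  simp [buf]

theorem mem_available {st : State} {i c : ℕ} :
    i ∈ available inp c st ↔ i ∈ buf inp st ∧ inp.color i = c := by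
  rw [mem_buf]
  simp only [available, Finset.mem_filter, Finset.mem_Icc, now]
  tauto

theorem Good.lt_now {st : State} (h : Good inp st) {a : ℕ} (ha : a ∈ st.out) : a < now inp st := by
  obtain ⟨m, hm, rfl⟩ := List.mem_iff_getElem.1 ha
  have := h.arrived m hm
  unfold now
  omega

theorem Good.length_le {st : State} (h : Good inp st) : st.out.length ≤ inp.n := by
  rw [← List.toFinset_card_of_nodup h.nodup, ← card_Icc_one (n := inp.n)]
  refine Finset.card_le_card fun a ha => Finset.mem_Icc.2 (h.mem a (List.mem_toFinset.1 ha))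

theorem Good.mem_of_length_eq {st : State} (h : Good inp st) (hn : inp.n ≤ st.out.length) {i : ℕ}
    (h1 : 1 ≤ i) (h2 : i ≤ inp.n) : i ∈ st.out := by
  have : st.out.toFinset = Finset.Icc 1 inp.n := by
    apply Finset.eq_of_subset_of_card_le
    · exact fun a ha => Finset.mem_Icc.2 (h.mem a (List.mem_toFinset.1 ha))
    · rw [List.toFinset_card_of_nodup h.nodup, card_Icc_one]
      exact hn
  rw [← List.mem_toFinset, this]
  exact Finset.mem_Icc.2 ⟨h1, h2⟩

theorem Good.isSchedule {st : State} (h : Good inp st) (hn : st.out.length = inp.n) :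
    IsSchedule inp st.out := by
  refine ⟨?_, h.arrived, h.order⟩
  rw [List.perm_ext_iff_of_nodup h.nodup (List.nodup_range' (h := by omega))]
  intro a
  rw [List.mem_range'_1]
  constructor
  · intro ha
    have := h.mem a ha
    omega
  · intro ha
    exact h.mem_of_length_eq hn.ge (by omega) (by omega)

theorem evictStep_of_empty {c : ℕ} {st : State} (h : available inp c st = ∅) :
    evictStep inp c st = st := by
  rw [evictStep, dif_neg]
  simp [h]

theorem evictStep_spec {c : ℕ} {st : State} (hst : Good inp st) (h : (available inp c st).Nonempty) :
    ∃ a, inp.color a = c ∧ (evictStep inp c st).out = st.out ++ [a] ∧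
      (evictStep inp c st).locks = st.locks ∧ Good inp (evictStep inp c st) := by
  set a := (available inp c st).min' h with ha_def
  have ha : a ∈ available inp c st := Finset.min'_mem _ h
  obtain ⟨hab, hac⟩ := mem_available.1 ha
  obtain ⟨⟨ha1, ha2⟩, ha3, ha4⟩ := mem_buf.1 hab
  have he : evictStep inp c st = { out := st.out ++ [a], locks := st.locks } := by
    rw [evictStep, dif_pos h]
  refine ⟨a, hac, by rw [he], by rw [he], ?_⟩
  rw [he]
  refine ⟨?_, ?_, ?_, ?_, ?_⟩
  · simp only [List.nodup_append, List.nodup_singleton, List.mem_singleton]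
    refine ⟨hst.nodup, trivial, ?_⟩
    rintro b hb _ rfl rfl
    exact ha4 hb
  · intro b hb
    rcases List.mem_append.1 hb with hb | hb
    · exact hst.mem b hb
    · rw [List.mem_singleton.1 hb]; exact ⟨ha1, ha2⟩
  · intro m hm
    simp only [List.length_append, List.length_singleton] at hm
    rw [List.getElem_append]
    split_ifs with h1
    · exact hst.arrived m h1
    · simp only [List.getElem_singleton]
      unfold now at ha3
      omega
  · rw [List.pairwise_append]
    refine ⟨hst.order, List.pairwise_singleton _ _, ?_⟩
    intro b hb a' ha' hc
    rw [List.mem_singleton] at ha'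
    subst ha'
    exact hst.closed b hb a ha4 ha1 ha2 hc.symm
  · intro b hb i hi h1 h2 hc
    simp only [List.mem_append, List.mem_singleton, not_or] at hi hb
    rcases hb with hb | rfl
    · exact hst.closed b hb i hi.1 h1 h2 hc
    -- A waiting item of the colour is either in the buffer, hence not before the minimum, or has
    -- not arrived, hence later than every arrived item.
    · by_cases hin : i < now inp st
      · have : a ≤ i := Finset.min'_le _ _
          (mem_available.2 ⟨mem_buf.2 ⟨⟨h1, h2⟩, hin, hi.1⟩, hc.trans hac⟩)
        omega
      · omega

theorem iterate_evictStep_spec {c : ℕ} {st : State} (hst : Good inp st) (m : ℕ) :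
    ∃ l, ((evictStep inp c)^[m] st).out = st.out ++ l ∧ (∀ a ∈ l, inp.color a = c) ∧
      ((evictStep inp c)^[m] st).locks = st.locks ∧ Good inp ((evictStep inp c)^[m] st) ∧
      (available inp c ((evictStep inp c)^[m] st) = ∅ ∨ l.length = m) := by
  induction m with
  | zero => exact ⟨[], by simp [hst]⟩
  | succ m ih =>
    obtain ⟨l, h1, h2, h3, h4, h5⟩ := ih
    rw [Function.iterate_succ_apply']
    rcases Finset.eq_empty_or_nonempty (available inp c ((evictStep inp c)^[m] st)) with he | hne
    · rw [evictStep_of_empty he]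
      exact ⟨l, h1, h2, h3, h4, Or.inl he⟩
    · obtain ⟨a, ha, ho, hl, hg⟩ := evictStep_spec h4 hne
      refine ⟨l ++ [a], ?_, ?_, ?_, hg, Or.inr ?_⟩
      · rw [ho, h1, List.append_assoc]
      · intro b hb
        rcases List.mem_append.1 hb with hb | hb
        · exact h2 b hb
        · rw [List.mem_singleton.1 hb, ha]
      · rw [hl, h3]
      · rcases h5 with h5 | h5
        · exact absurd h5 hne.ne_empty
        · simp [h5]

/-- If none of the `inp.n` steps finds the block empty, then `inp.n` items have been output and
nothing is left. -/
theorem evict_spec (c : ℕ) {st : State} (hst : Good inp st) :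
    ∃ l, (evict inp c st).out = st.out ++ l ∧ (∀ a ∈ l, inp.color a = c) ∧
      (evict inp c st).locks = st.locks ∧ Good inp (evict inp c st) ∧
      available inp c (evict inp c st) = ∅ := by
  obtain ⟨l, h1, h2, h3, h4, h5⟩ := iterate_evictStep_spec (c := c) hst inp.n
  refine ⟨l, h1, h2, h3, h4, ?_⟩
  rcases h5 with h5 | h5
  · exact h5
  · rw [Finset.eq_empty_iff_forall_notMem]
    intro i hi
    obtain ⟨⟨hi1, hi2⟩, -, hi3⟩ := mem_buf.1 (mem_available.1 hi).1
    refine hi3 (h4.mem_of_length_eq ?_ hi1 hi2)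
    rw [h1, List.length_append]
    omega

/-- A monochromatic tail creates at most one new maximal interval. -/
theorem length_destutter'_append_le (l m : List ℕ) (c a : ℕ) (hm : ∀ b ∈ m, b = c) :
    ((l ++ m).destutter' (· ≠ ·) a).length ≤ (l.destutter' (· ≠ ·) a).length + 1 := by
  induction l generalizing a with
  | nil =>
    simp only [List.nil_append, List.destutter'_nil, List.length_singleton]
    have hconst : ∀ m : List ℕ, (∀ b ∈ m, b = c) → (m.destutter' (· ≠ ·) c).length ≤ 1 := by
      intro m
      induction m with
      | nil => simp
      | cons b m ih =>
        intro hb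
        have : b = c := hb b (by simp)
        subst this
        rw [List.destutter'_cons_neg _ (by simp)]
        exact ih fun d hd => hb d (by simp [hd])
    cases m with
    | nil => simp
    | cons b m =>
      have : b = c := hm b (by simp)
      subst this
      have h1 := hconst m fun d hd => hm d (by simp [hd])
      by_cases hab : a = b
      · subst hab
        rw [List.destutter'_cons_neg _ (by simp)]
        omega
      · rw [List.destutter'_cons_pos _ hab, List.length_cons]
        omega
  | cons b l ih =>
    rw [List.cons_append]
    by_cases hab : a = b
    · rw [List.destutter'_cons_neg _ (by simp [hab]), List.destutter'_cons_neg _ (by simp [hab])]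
      exact ih a
    · rw [List.destutter'_cons_pos _ hab, List.destutter'_cons_pos _ hab, List.length_cons,
        List.length_cons]
      have := ih b
      omega

theorem cost_append_le (out l : List ℕ) (c : ℕ) (hl : ∀ a ∈ l, inp.color a = c) :
    cost inp (out ++ l) ≤ cost inp out + 1 := by
  have hm : ∀ b ∈ l.map inp.color, b = c := by
    intro b hb
    obtain ⟨a, ha, rfl⟩ := List.mem_map.1 hb
    exact hl a ha
  unfold cost
  rw [List.map_append]
  cases hout : out.map inp.color with
  | nil =>
    cases hm' : l.map inp.color with
    | nil => simp
    | cons b m =>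
      rw [hm'] at hm
      have h1 := length_destutter'_append_le [] m c b fun d hd => hm d (by simp [hd])
      have hb := hm b (by simp)
      rw [List.nil_append, List.destutter_cons', List.destutter_nil, List.length_nil]
      have h2 := length_destutter'_append_le [] (b :: m) c b hm
      have h3 : ∀ m : List ℕ, (∀ d ∈ m, d = b) → (m.destutter' (· ≠ ·) b).length ≤ 1 := by
        intro m
        induction m with
        | nil => simp
        | cons d m ih =>
          intro hd
          rw [List.destutter'_cons_neg _ (by simp [hd d (by simp)])]
          exact ih fun e he => hd e (by simp [he])
      have := h3 m fun d hd => (hm d (by simp [hd])).trans hb.symm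
      omega
  | cons b out' =>
    rw [List.cons_append, List.destutter_cons', List.destutter_cons']
    exact length_destutter'_append_le _ _ c b hm

/-- The colour output last is not in the buffer. -/
def LastGone (inp : Input) (st : State) : Prop :=
  ∀ a, st.out.getLast? = some a → available inp (inp.color a) st = ∅

/-- `st'` results from `st` by evicting the blocks of the colours in `cs`. -/
structure Evicted (inp : Input) (cs : List ℕ) (st st' : State) : Prop where
  good : Good inp st'
  out : ∃ l, st'.out = st.out ++ l ∧ ∀ a ∈ l, inp.color a ∈ cs
  gone : ∀ i, 1 ≤ i → i ≤ inp.n → i < now inp st → inp.color i ∈ cs → i ∈ st'.out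
  locks : st'.locks = st.locks
  cost_le : cost inp st'.out ≤ cost inp st.out + cs.length
  last : LastGone inp st'

theorem available_congr {st st' : State} (h : st.out = st'.out) (c : ℕ) :
    available inp c st = available inp c st' := by
  simp [available, h]

theorem Evicted.refl {st : State} (hst : Good inp st) (hl : LastGone inp st) :
    Evicted inp [] st st :=
  ⟨hst, ⟨[], by simp⟩, by simp, rfl, by simp, hl⟩

theorem Evicted.sub {cs : List ℕ} {st st' : State} (h : Evicted inp cs st st') {a : ℕ}
    (ha : a ∈ st.out) : a ∈ st'.out := by
  obtain ⟨l, hl, -⟩ := h.out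
  rw [hl]
  exact List.mem_append_left _ ha

theorem Evicted.now_le {cs : List ℕ} {st st' : State} (h : Evicted inp cs st st') :
    now inp st ≤ now inp st' := by
  obtain ⟨l, hl, -⟩ := h.out
  simp [now, hl]

theorem Evicted.trans {cs ds : List ℕ} {st st' st'' : State} (h : Evicted inp cs st st')
    (h' : Evicted inp ds st' st'') : Evicted inp (cs ++ ds) st st'' := by
  refine ⟨h'.good, ?_, ?_, h'.locks.trans h.locks, ?_, h'.last⟩
  · obtain ⟨l, h1, h2⟩ := h.out
    obtain ⟨l', h1', h2'⟩ := h'.out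
    refine ⟨l ++ l', by rw [h1', h1, List.append_assoc], ?_⟩
    intro a ha
    rcases List.mem_append.1 ha with ha | ha
    · exact List.mem_append_left _ (h2 a ha)
    · exact List.mem_append_right _ (h2' a ha)
  · intro i h1 h2 h3 h4
    rcases List.mem_append.1 h4 with h4 | h4
    · exact h'.sub (h.gone i h1 h2 h3 h4)
    · exact h'.gone i h1 h2 (h3.trans_le h.now_le) h4
  · have := h.cost_le
    have := h'.cost_le
    rw [List.length_append]
    omega

theorem evicted_evict (c : ℕ) {st : State} (hst : Good inp st) (hl : LastGone inp st) :
    Evicted inp [c] st (evict inp c st) := by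
  obtain ⟨l, h1, h2, h3, h4, h5⟩ := evict_spec c hst
  refine ⟨h4, ⟨l, h1, fun a ha => by simp [h2 a ha]⟩, ?_, h3, ?_, ?_⟩
  · intro i hi1 hi2 hi3 hi4
    rw [List.mem_singleton] at hi4
    by_contra hi5
    have : i ∈ available inp c (evict inp c st) := by
      refine mem_available.2 ⟨mem_buf.2 ⟨⟨hi1, hi2⟩, ?_, hi5⟩, hi4⟩
      unfold now at hi3 ⊢
      rw [h1, List.length_append]
      omega
    simp [h5] at this
  · rw [h1]
    exact cost_append_le _ _ c h2
  · intro a ha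
    rcases List.eq_nil_or_concat l with rfl | ⟨l', b, rfl⟩
    · rw [List.append_nil] at h1
      rw [available_congr h1]
      exact hl a (by rw [← h1, ha])
    · rw [h1, List.concat_eq_append, ← List.append_assoc, List.getLast?_concat] at ha
      cases ha
      rw [h2 _ (by simp), h5]

theorem evicted_foldl (cs : List ℕ) {st : State} (hst : Good inp st) (hl : LastGone inp st) :
    Evicted inp cs st (cs.foldl (fun s c => evict inp c s) st) := by
  induction cs generalizing st with
  | nil => exact Evicted.refl hst hl
  | cons c cs ih =>
    have h := evicted_evict c hst hl
    exact h.trans (ih h.good h.last)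

/-- All items of a colour that has just been evicted are output. -/
theorem mem_evict_out (c : ℕ) {st : State} (hst : Good inp st) {i : ℕ} (h1 : 1 ≤ i)
    (h2 : i ≤ inp.n) (h3 : i < now inp (evict inp c st)) (h4 : inp.color i = c) :
    i ∈ (evict inp c st).out := by
  obtain ⟨l, -, -, -, -, h5⟩ := evict_spec c hst
  by_contra hi
  have : i ∈ available inp c (evict inp c st) :=
    mem_available.2 ⟨mem_buf.2 ⟨⟨h1, h2⟩, h3, hi⟩, h4⟩
  simp [h5] at this

/-- If the colour `c` is evicted at a time when a batch has already scheduled an item of `c` in the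
buffer, then the batch ends during the eviction. -/
theorem batch_end_le_now_evict {b : Finset ℕ × ℕ} (hb : b ∈ batches inp) {st : State}
    (hst : Good inp st) {i : ℕ} (hi : i ∈ b.1) (hbuf : i ∈ buf inp st)
    (hs : slotOf b i ≤ now inp st) :
    b.2 + b.1.card ≤ now inp (evict inp (inp.color i) st) := by
  obtain ⟨l, h1, h2, h3, h4, h5⟩ := evict_spec (inp.color i) hst
  set st' := evict inp (inp.color i) st with hst'
  have hnow : now inp st' = now inp st + l.length := by
    simp [now, h1]; omega
  by_contra hlt
  push Not at hlt
  -- The window includes the slot `now inp st'` itself, so it has at least one slot more than the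
  -- eviction has items. All batch items in it have arrived and belong to `l`, because an item
  -- output earlier would precede `i`.
  have hcard := card_slots_Ico (b := b) (s := slotOf b i) (t := now inp st' + 1)
    (start_le_slotOf b i) (by omega)
  have hsub : (b.1.filter fun a => slotOf b i ≤ slotOf b a ∧ slotOf b a < now inp st' + 1) ⊆
      l.toFinset := by
    intro a ha
    simp only [Finset.mem_filter] at ha
    obtain ⟨ha1, ha2, ha3⟩ := ha
    have hca := color_eq_of_mem_batch hb ha1 hi
    obtain ⟨ha4, ha5⟩ := mem_Icc_of_mem_batch hb ha1
    have ha6 := lt_slotOf hb ha1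
    have ha7 : a ∈ st'.out := mem_evict_out _ hst ha4 ha5 (by rw [← hst']; omega) hca
    have hia : i ≤ a := by
      by_contra hai
      have := slotOf_lt_slotOf (b := b) ha1 (show a < i by omega)
      omega
    rw [h1, List.mem_append] at ha7
    rcases ha7 with ha7 | ha7
    · obtain ⟨hi1, -, hi2⟩ := mem_buf.1 hbuf
      have := hst.closed a ha7 i hi2 hi1.1 hi1.2 hca.symm
      omega
    · exact List.mem_toFinset.2 ha7
  have h6 := Finset.card_le_card hsub
  have h7 := l.toFinset_card_le
  omega

end

/-! ### Views, locks, and the bound on the volume removed from the buffer. -/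

section

variable {inp : Input} {x : Finset ℕ × ℕ → ℝ} {δ : ℝ}

theorem view_buffer (st : State) : (view inp x st).buffer = buf inp st := by
  ext i
  have h : i ∈ (view inp x st).items ↔ (1 ≤ i ∧ i ≤ inp.n) ∧ i < now inp st := by
    simp [view, now]
  rw [mem_buf, View.buffer, Finset.mem_filter, h, and_assoc]
  rfl

theorem view_color {st : State} {i : ℕ} (h1 : 1 ≤ i) (h2 : i ≤ inp.n) (h3 : i < now inp st) :
    (view inp x st).color i = inp.color i :=
  if_pos ⟨h1, h2, h3⟩

theorem view_color_of_mem_buf {st : State} {i : ℕ} (h : i ∈ buf inp st) :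
    (view inp x st).color i = inp.color i := by
  obtain ⟨h1, h2, -⟩ := mem_buf.1 h
  exact view_color h1.1 h1.2 h2

theorem view_block (st : State) (c : ℕ) : (view inp x st).block c = available inp c st := by
  ext i
  rw [View.block, view_buffer, Finset.mem_filter, mem_available]
  refine and_congr_right fun h => ?_
  rw [view_color_of_mem_buf h]

theorem mem_view_colors {st : State} {c : ℕ} :
    c ∈ (view inp x st).colors ↔ (available inp c st).Nonempty := by
  rw [View.colors, view_buffer, Finset.mem_image]
  constructor
  · rintro ⟨i, hi, rfl⟩
    exact ⟨i, mem_available.2 ⟨hi, (view_color_of_mem_buf hi).symm⟩⟩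
  · rintro ⟨i, hi⟩
    obtain ⟨h1, h2⟩ := mem_available.1 hi
    exact ⟨i, h1, (view_color_of_mem_buf h1).trans h2⟩

theorem view_frac {st : State} {i s : ℕ} (h : s ≤ now inp st) :
    (view inp x st).frac i s = rate inp x i s :=
  if_pos h

theorem view_removed (st : State) (i : ℕ) :
    (view inp x st).removed i = rem inp x (now inp st) i := by
  refine Finset.sum_congr rfl fun s hs => view_frac ?_
  exact (Finset.mem_range.1 hs).le

/-- A lock by the block `B` is in force at the slot `t`. -/
def InForce (inp : Input) (x : Finset ℕ × ℕ → ℝ) (δ : ℝ) (t : ℕ) (B : Finset ℕ) : Prop :=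
  ∀ a ∈ B, rem inp x t a ≤ δ

theorem InForce.anti (hx : IsFeasible inp x) {s t : ℕ} (hst : s ≤ t) {B : Finset ℕ}
    (h : InForce inp x δ t B) : InForce inp x δ s B :=
  fun a ha => (rem_mono hx hst a).trans (h a ha)

/-- The volume of item `i` that is locked by `locks` at the slot `t`. -/
def lockedAt (inp : Input) (x : Finset ℕ × ℕ → ℝ) (δ : ℝ) (locks : List Lock) (t i : ℕ) : ℝ :=
  (locks.map (fun L => if InForce inp x δ t L.block then L.amount i else 0)).sum

theorem sum_map_filter {α : Type*} (l : List α) (p : α → Prop) (f : α → ℝ) :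
    ((l.filter (fun a => decide (p a))).map f).sum = (l.map (fun a => if p a then f a else 0)).sum := by
  induction l with
  | nil => simp
  | cons a l ih =>
    by_cases h : p a
    · simp [h, ih]
    · simp [h, ih]

theorem view_locked (st : State) (i : ℕ) :
    (view inp x st).locked δ i = lockedAt inp x δ st.locks (now inp st) i := by
  rw [lockedAt, ← sum_map_filter, View.locked]
  have : ∀ L : Lock, (∀ a ∈ L.block, 1 - δ ≤ 1 - (view inp x st).removed a) ↔
      InForce inp x δ (now inp st) L.block := by
    intro L
    refine forall₂_congr fun a _ => ?_
    rw [view_removed]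
    constructor <;> intro h <;> linarith
  congr 2
  apply List.filter_congr
  intro L _
  simpa using this L

theorem view_unlocked (st : State) (i : ℕ) : (view inp x st).unlocked δ i =
    rem inp x (now inp st) i - lockedAt inp x δ st.locks (now inp st) i := by
  rw [View.unlocked, view_removed, view_locked]

theorem case1_iff {st : State} :
    (view inp x st).Case1 δ ↔ ∃ i ∈ buf inp st, δ ≤ rem inp x (now inp st) i := by
  simp_rw [View.Case1, view_buffer, view_removed]

theorem case2_iff {st : State} :
    (view inp x st).Case2 δ ↔ 2 * δ ≤ ∑ i ∈ buf inp st, rate inp x i (now inp st) := by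
  rw [View.Case2, view_buffer]
  have : (view inp x st).slot = now inp st := rfl
  rw [this, Finset.sum_congr rfl fun i _ => view_frac le_rfl]

/-- The items of colour `c` that have arrived. -/
def arrivedOf (inp : Input) (c : ℕ) (st : State) : Finset ℕ :=
  (Finset.Icc 1 inp.n).filter (fun i => i < now inp st ∧ inp.color i = c)

theorem mem_arrivedOf {st : State} {c i : ℕ} :
    i ∈ arrivedOf inp c st ↔ (1 ≤ i ∧ i ≤ inp.n) ∧ i < now inp st ∧ inp.color i = c := by
  simp [arrivedOf]

theorem case3_iff {st : State} (hst : Good inp st) :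
    (view inp x st).Case3 ↔ ∃ a, st.out.getLast? = some a ∧
      1 / 2 < ∑ i ∈ arrivedOf inp (inp.color a) st, rate inp x i (now inp st) := by
  refine exists_congr fun a => and_congr_right fun ha => ?_
  have ha' : a ∈ st.out := List.mem_of_getLast? ha
  have hca : (view inp x st).color a = inp.color a :=
    view_color (hst.mem a ha').1 (hst.mem a ha').2 (hst.lt_now ha')
  have hF : (view inp x st).items.filter (fun i => (view inp x st).color i =
      (view inp x st).color a) = arrivedOf inp (inp.color a) st := by
    ext i
    rw [Finset.mem_filter, mem_arrivedOf, hca]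
    have : i ∈ (view inp x st).items ↔ (1 ≤ i ∧ i ≤ inp.n) ∧ i < now inp st := by
      simp [view, now]
    rw [this, and_assoc]
    refine and_congr_right fun h1 => and_congr_right fun h2 => ?_
    rw [view_color h1.1 h1.2 h2]
  have : (view inp x st).slot = now inp st := rfl
  rw [hF, this, Finset.sum_congr rfl fun i _ => view_frac le_rfl]

/-- The invariants of the rounding procedure between two phases. -/
structure Inv (inp : Input) (x : Finset ℕ × ℕ → ℝ) (δ : ℝ) (st : State) : Prop where
  good : Good inp st
  last : LastGone inp st
  amount_nonneg : ∀ L ∈ st.locks, ∀ i, 0 ≤ L.amount i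
  block_sub : ∀ L ∈ st.locks, ∀ a ∈ L.block, a ∈ st.out
  disj : st.locks.Pairwise (fun L M => Disjoint L.block M.block)
  amount_le : ∀ L ∈ st.locks, ∑ i ∈ Finset.Icc 1 inp.n, L.amount i ≤ 4 * δ * (L.block.card : ℝ)
  locked_le : ∀ i, lockedAt inp x δ st.locks (now inp st) i ≤ rem inp x (now inp st) i

/-- Removed volume only grows, so locks can only expire. -/
theorem lockedAt_anti (hx : IsFeasible inp x) {locks : List Lock}
    (hl : ∀ L ∈ locks, ∀ i, 0 ≤ L.amount i) {s t : ℕ} (h : s ≤ t) (i : ℕ) :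
    lockedAt inp x δ locks t i ≤ lockedAt inp x δ locks s i := by
  refine List.sum_le_sum fun L hL => ?_
  have := hl L hL i
  have h2 : InForce inp x δ t L.block → InForce inp x δ s L.block := InForce.anti hx h
  split_ifs <;> first | linarith | tauto

theorem Inv.evicted (hx : IsFeasible inp x) {st st' : State} {cs : List ℕ} (h : Inv inp x δ st)
    (he : Evicted inp cs st st') : Inv inp x δ st' := by
  refine ⟨he.good, he.last, ?_, ?_, ?_, ?_, ?_⟩
  · rw [he.locks]; exact h.amount_nonneg
  · rw [he.locks]; exact fun L hL a ha => he.sub (h.block_sub L hL a ha)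
  · rw [he.locks]; exact h.disj
  · rw [he.locks]; exact h.amount_le
  · intro i
    rw [he.locks]
    exact (lockedAt_anti hx h.amount_nonneg he.now_le i).trans
      ((h.locked_le i).trans (rem_mono hx he.now_le i))

theorem Inv.unlocked_nonneg {st : State} (h : Inv inp x δ st) (i : ℕ) :
    0 ≤ (view inp x st).unlocked δ i := by
  rw [view_unlocked]
  linarith [h.locked_le i]

theorem lockedAt_nonneg {locks : List Lock} (hl : ∀ L ∈ locks, ∀ i, 0 ≤ L.amount i) (t i : ℕ) :
    0 ≤ lockedAt inp x δ locks t i := by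
  refine List.sum_nonneg fun y hy => ?_
  obtain ⟨L, hL, rfl⟩ := List.mem_map.1 hy
  have := hl L hL i
  split_ifs <;> linarith

theorem Inv.weight_nonneg {st : State} (h : Inv inp x δ st) (c : ℕ) :
    0 ≤ (view inp x st).weight δ c :=
  div_nonneg (Finset.sum_nonneg fun i _ => h.unlocked_nonneg i) (Nat.cast_nonneg _)

/-- Outside Case 1 every item of the block has lost less than `δ`, and locks only subtract from
this. -/
theorem Inv.weight_lt {st : State} (h : Inv inp x δ st) (hδ : 0 < δ)
    (h1 : ¬ (view inp x st).Case1 δ) (c : ℕ) : (view inp x st).weight δ c < δ := by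
  rw [View.weight, view_block]
  rcases Finset.eq_empty_or_nonempty (available inp c st) with he | hne
  · simp [he, hδ]
  · rw [div_lt_iff₀ (by exact_mod_cast hne.card_pos), mul_comm, ← nsmul_eq_mul]
    rw [← Finset.sum_const]
    refine Finset.sum_lt_sum_of_nonempty hne fun i hi => ?_
    rw [view_unlocked]
    have h2 := lockedAt_nonneg (inp := inp) (x := x) (δ := δ) h.amount_nonneg (now inp st) i
    rw [case1_iff] at h1
    push Not at h1
    have := h1 i (mem_available.1 hi).1
    linarith

theorem weight_mul_card (st : State) (c : ℕ) :
    (view inp x st).weight δ c * ((available inp c st).card : ℝ) =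
      ∑ i ∈ available inp c st, (view inp x st).unlocked δ i := by
  rw [View.weight, view_block]
  rcases Finset.eq_empty_or_nonempty (available inp c st) with he | hne
  · simp [he]
  · rw [div_mul_cancel₀]
    exact_mod_cast hne.card_pos.ne'

theorem sum_buf_eq (st : State) (g : ℕ → ℝ) :
    ∑ i ∈ buf inp st, g i = ∑ c ∈ (view inp x st).colors, ∑ i ∈ available inp c st, g i := by
  rw [← Finset.sum_fiberwise_of_maps_to (g := inp.color) (t := (view inp x st).colors)]
  · refine Finset.sum_congr rfl fun c _ => Finset.sum_congr ?_ fun _ _ => rfl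
    ext i
    rw [Finset.mem_filter, mem_available]
  · intro i hi
    exact mem_view_colors.2 ⟨i, mem_available.2 ⟨hi, rfl⟩⟩

/-- A choice `f` of one colour in each of the subclasses `subs`, in a state in which the selection
procedure is applied. -/
structure Selected (inp : Input) (x : Finset ℕ × ℕ → ℝ) (δ : ℝ) (st : State)
    (subs : Finset (Finset ℕ)) (f : Finset ℕ → ℕ) : Prop where
  not_case1 : ¬ (view inp x st).Case1 δ
  family : (view inp x st).IsSubclassFamily δ subs
  mem : ∀ S ∈ subs, f S ∈ S

namespace Selected

variable {st : State} {subs : Finset (Finset ℕ)} {f : Finset ℕ → ℕ}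

/-- The weight is below `δ` without the last colour, and that colour adds less than `δ`. -/
theorem totalWeight_lt (h : Selected inp x δ st subs f) (hI : Inv inp x δ st) (hδ : 0 < δ)
    {S : Finset ℕ} (hS : S ∈ subs) : (view inp x st).totalWeight δ S < 2 * δ := by
  obtain ⟨-, -, c, hc, hlt⟩ := h.family.1 S hS
  have h1 := hI.weight_lt hδ h.not_case1 c
  have h2 : (view inp x st).totalWeight δ S =
      (view inp x st).weight δ c + (view inp x st).totalWeight δ (S.erase c) :=
    (Finset.add_sum_erase S _ hc).symm
  linarith

theorem subset_colors (h : Selected inp x δ st subs f) {S : Finset ℕ} (hS : S ∈ subs) :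
    S ⊆ (view inp x st).colors := by
  obtain ⟨⟨s, hs⟩, -⟩ := h.family.1 S hS
  exact hs.trans (Finset.filter_subset _ _)

theorem injOn (h : Selected inp x δ st subs f) : Set.InjOn f subs := by
  intro S hS T hT hST
  by_contra hne
  have h1 := h.mem S hS
  have h2 := h.mem T hT
  rw [← hST] at h2
  exact Finset.disjoint_left.1 (h.family.2.1 S hS T hT hne) h1 h2

/-- Blocks of one class differ in size by less than a factor 2. A total weight below `2 * δ` thus
means volume at most `2 * δ * 2 ^ (s + 1)`, and the chosen block has size at least `2 ^ s`. -/
theorem sum_unlocked_le (h : Selected inp x δ st subs f) (hI : Inv inp x δ st) (hδ : 0 < δ)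
    {S : Finset ℕ} (hS : S ∈ subs) :
    ∑ c ∈ S, ∑ i ∈ available inp c st, (view inp x st).unlocked δ i ≤
      4 * δ * ((available inp (f S) st).card : ℝ) := by
  obtain ⟨⟨s, hs⟩, -⟩ := h.family.1 S hS
  have hW := h.totalWeight_lt hI hδ hS
  have hcard : ∀ c ∈ S, 2 ^ s ≤ (available inp c st).card ∧
      (available inp c st).card < 2 ^ (s + 1) := by
    intro c hc
    have := (Finset.mem_filter.1 (hs hc)).2
    rwa [view_block] at this
  have h1 : ∑ c ∈ S, ∑ i ∈ available inp c st, (view inp x st).unlocked δ i ≤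
      ∑ c ∈ S, (view inp x st).weight δ c * (2 : ℝ) ^ (s + 1) := by
    refine Finset.sum_le_sum fun c hc => ?_
    rw [← weight_mul_card]
    refine mul_le_mul_of_nonneg_left ?_ (hI.weight_nonneg c)
    exact_mod_cast (hcard c hc).2.le
  rw [← Finset.sum_mul] at h1
  have h2 : ∑ c ∈ S, (view inp x st).weight δ c = (view inp x st).totalWeight δ S := rfl
  have h3 : (2 : ℝ) ^ s ≤ ((available inp (f S) st).card : ℝ) := by
    exact_mod_cast (hcard _ (h.mem S hS)).1
  rw [h2, pow_succ] at h1
  have h4 : (0 : ℝ) < 2 ^ s := by positivity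
  nlinarith

/-- Each class leaves weight less than `δ`, hence volume at most `δ * 2 ^ (s + 1)`. The geometric
sum over the classes is dominated by the largest block, which is why that block is always evicted as
well. -/
theorem sum_unselected_le (h : Selected inp x δ st subs f) (hI : Inv inp x δ st) (hδ : 0 < δ)
    {c₁ : ℕ} (hc₁ : (view inp x st).IsLargest (view inp x st).colors c₁) :
    ∑ c ∈ (view inp x st).colors \ subs.biUnion id,
      ∑ i ∈ available inp c st, (view inp x st).unlocked δ i ≤
      4 * δ * ((available inp c₁ st).card : ℝ) := by
  set V := view inp x st with hV
  set B := (available inp c₁ st).card with hB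
  have hB0 : B ≠ 0 := by
    rw [hB]; exact (mem_view_colors.1 hc₁.1).card_pos.ne'
  have hle : ∀ c ∈ V.colors, (available inp c st).card ≤ B := by
    intro c hc
    have := hc₁.2 c hc
    rwa [hV, view_block, view_block] at this
  rw [← Finset.sum_fiberwise_of_maps_to (g := fun c => Nat.log 2 (available inp c st).card)
    (t := Finset.range (Nat.log 2 B + 1))]
  · have h1 : ∀ s ∈ Finset.range (Nat.log 2 B + 1),
        ∑ c ∈ (V.colors \ subs.biUnion id).filter
          (fun c => Nat.log 2 (available inp c st).card = s),
          ∑ i ∈ available inp c st, V.unlocked δ i ≤ δ * 2 ^ (s + 1) := by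
      intro s _
      have hsub : (V.colors \ subs.biUnion id).filter
          (fun c => Nat.log 2 (available inp c st).card = s) ⊆
          V.sizeClass s \ subs.biUnion id := by
        intro c hc
        rw [Finset.mem_filter, Finset.mem_sdiff] at hc
        rw [Finset.mem_sdiff, View.sizeClass, Finset.mem_filter, hV, view_block]
        obtain ⟨⟨hc1, hc2⟩, hc3⟩ := hc
        have hc4 : (available inp c st).card ≠ 0 := (mem_view_colors.1 hc1).card_pos.ne'
        refine ⟨⟨hc1, ?_, ?_⟩, hc2⟩
        · rw [← hc3]; exact Nat.pow_log_le_self 2 hc4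
        · rw [← hc3]; exact Nat.lt_pow_succ_log_self (by norm_num) _
      have h2 := h.family.2.2 s
      calc _ ≤ ∑ c ∈ (V.colors \ subs.biUnion id).filter
            (fun c => Nat.log 2 (available inp c st).card = s), V.weight δ c * (2 : ℝ) ^ (s + 1) := by
            refine Finset.sum_le_sum fun c hc => ?_
            have hc' := (Finset.mem_sdiff.1 (hsub hc)).1
            rw [View.sizeClass, Finset.mem_filter, hV, view_block] at hc'
            rw [hV, ← weight_mul_card]
            refine mul_le_mul_of_nonneg_left ?_ (hI.weight_nonneg c)
            exact_mod_cast hc'.2.2.le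
        _ ≤ ∑ c ∈ V.sizeClass s \ subs.biUnion id, V.weight δ c * (2 : ℝ) ^ (s + 1) :=
            Finset.sum_le_sum_of_subset_of_nonneg hsub fun c _ _ =>
              mul_nonneg (hI.weight_nonneg c) (by positivity)
        _ = V.totalWeight δ (V.sizeClass s \ subs.biUnion id) * 2 ^ (s + 1) := by
            rw [← Finset.sum_mul]; rfl
        _ ≤ δ * 2 ^ (s + 1) := mul_le_mul_of_nonneg_right h2.le (by positivity)
    refine (Finset.sum_le_sum h1).trans ?_
    rw [← Finset.mul_sum, mul_comm 4 δ, mul_assoc]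
    refine mul_le_mul_of_nonneg_left ?_ hδ.le
    have h3 : ∀ m : ℕ, ∑ s ∈ Finset.range m, (2 : ℝ) ^ (s + 1) = 2 * 2 ^ m - 2 := by
      intro m
      induction m with
      | zero => norm_num
      | succ m ih => rw [Finset.sum_range_succ, ih]; ring
    rw [h3, pow_succ]
    have h4 : (2 : ℝ) ^ Nat.log 2 B ≤ B := by exact_mod_cast Nat.pow_log_le_self 2 hB0
    linarith
  · intro c hc
    rw [Finset.mem_range, Nat.lt_succ_iff]
    exact Nat.log_mono_right (hle c (Finset.mem_sdiff.1 hc).1)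

end Selected

theorem sum_list_map_sum {α : Type*} (F : Finset ℕ) (l : List α) (g : α → ℕ → ℝ) :
    ∑ i ∈ F, (l.map (fun a => g a i)).sum = (l.map (fun a => ∑ i ∈ F, g a i)).sum := by
  induction l with
  | nil => simp
  | cons a l ih => simp [Finset.sum_add_distrib, ih]

theorem sum_blocks_le (l : List Lock) (F : Finset ℕ) (g : ℕ → ℝ) (hg : ∀ a ∈ F, 0 ≤ g a)
    (hd : l.Pairwise (fun L M => Disjoint L.block M.block)) (hs : ∀ L ∈ l, L.block ⊆ F) :
    (l.map (fun L => ∑ a ∈ L.block, g a)).sum ≤ ∑ a ∈ F, g a := by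
  induction l generalizing F with
  | nil => simpa using Finset.sum_nonneg hg
  | cons L l ih =>
    rw [List.pairwise_cons] at hd
    rw [List.map_cons, List.sum_cons, ← Finset.sum_sdiff (hs L (by simp)), add_comm]
    gcongr
    refine ih (F \ L.block) (fun a ha => hg a (Finset.mem_sdiff.1 ha).1) hd.2 fun M hM a ha => ?_
    rw [Finset.mem_sdiff]
    exact ⟨hs M (by simp [hM]) ha, fun h => Finset.disjoint_left.1 (hd.1 M hM) h ha⟩

/-- By `sum_rem` the removed volume equals the number of output items, and items that have not
arrived contribute nothing. -/
theorem sum_buf_rem (hx : IsFeasible inp x) {st : State} (hst : Good inp st) :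
    ∑ i ∈ buf inp st, rem inp x (now inp st) i =
      ∑ i ∈ st.out.toFinset, (1 - rem inp x (now inp st) i) := by
  have h1 : ∑ i ∈ Finset.Icc 1 inp.n, rem inp x (now inp st) i = st.out.length :=
    sum_rem hx hst.length_le
  have h2 : ∑ i ∈ Finset.Icc 1 inp.n, rem inp x (now inp st) i =
      ∑ i ∈ buf inp st, rem inp x (now inp st) i +
        ∑ i ∈ st.out.toFinset, rem inp x (now inp st) i := by
    rw [← Finset.sum_union]
    · symm
      apply Finset.sum_subset
      · intro i hi
        rw [Finset.mem_union, mem_buf, List.mem_toFinset] at hi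
        rw [Finset.mem_Icc]
        rcases hi with hi | hi
        · exact hi.1
        · exact hst.mem i hi
      · intro i hi hi'
        rw [Finset.mem_union, mem_buf, List.mem_toFinset] at hi'
        rw [Finset.mem_Icc] at hi
        push Not at hi'
        apply rem_eq_zero
        by_contra h3
        push Not at h3
        exact hi'.2 (hi'.1 hi (by omega))
    · rw [Finset.disjoint_left]
      intro i hi hi'
      exact (mem_buf.1 hi).2.2 (List.mem_toFinset.1 hi')
  rw [Finset.sum_sub_distrib, Finset.sum_const, List.toFinset_card_of_nodup hst.nodup]
  simp only [nsmul_eq_mul, mul_one]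
  linarith

/-- A lock in force belongs to an output block whose items are fractionally almost complete. These
disjoint blocks are part of the volume that `x` still has to schedule, and each locks only a `4 * δ`
fraction of its size. -/
theorem sum_buf_lockedAt_le (hx : IsFeasible inp x) (hδ' : δ < 1 / 100)
    {st : State} (hI : Inv inp x δ st) :
    ∑ i ∈ buf inp st, lockedAt inp x δ st.locks (now inp st) i ≤
      (1 / 20) * ∑ i ∈ buf inp st, rem inp x (now inp st) i := by
  set Y := (st.locks.map (fun L => if InForce inp x δ (now inp st) L.block
    then (L.block.card : ℝ) else 0)).sum with hY
  have hY0 : 0 ≤ Y := by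
    refine List.sum_nonneg fun y hy => ?_
    obtain ⟨L, -, rfl⟩ := List.mem_map.1 hy
    split_ifs <;> positivity
  have h1 : ∑ i ∈ buf inp st, lockedAt inp x δ st.locks (now inp st) i ≤ 4 * δ * Y := by
    simp only [lockedAt]
    rw [sum_list_map_sum, hY, ← List.sum_map_mul_left]
    refine List.sum_le_sum fun L hL => ?_
    split_ifs with h
    · refine le_trans ?_ (hI.amount_le L hL)
      refine Finset.sum_le_sum_of_subset_of_nonneg (Finset.filter_subset _ _) fun i _ _ => ?_
      exact hI.amount_nonneg L hL i
    · simp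
  have h2 : (1 - δ) * Y ≤ ∑ i ∈ st.out.toFinset, (1 - rem inp x (now inp st) i) := by
    refine le_trans ?_ (sum_blocks_le st.locks _ _ (fun a _ => ?_) hI.disj fun L hL a ha => ?_)
    · rw [hY, ← List.sum_map_mul_left]
      refine List.sum_le_sum fun L hL => ?_
      split_ifs with h
      · rw [mul_comm, ← nsmul_eq_mul]
        refine Finset.card_nsmul_le_sum _ _ _ fun a ha => ?_
        linarith [h a ha]
      · rw [mul_zero]
        exact Finset.sum_nonneg fun a _ => by linarith [rem_le_one hx (now inp st) a]
    · linarith [rem_le_one hx (now inp st) a]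
    · exact List.mem_toFinset.2 (hI.block_sub L hL a ha)
  rw [← sum_buf_rem hx hI.good] at h2
  -- For `δ < 1 / 100` the ratio `4 * δ / (1 - δ)` is below `1 / 20`.
  nlinarith

/-- When the selection procedure is applied, the volume of the items in the buffer that was already
removed fractionally is small compared to the blocks that are evicted. -/
theorem Selected.sum_rem_le (hx : IsFeasible inp x) (hδ : 0 < δ) (hδ' : δ < 1 / 100)
    {st : State} (hI : Inv inp x δ st) {subs : Finset (Finset ℕ)} {f : Finset ℕ → ℕ}
    (h : Selected inp x δ st subs f) {c₁ : ℕ}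
    (hc₁ : (view inp x st).IsLargest (view inp x st).colors c₁) {Ev : Finset ℕ}
    (hEv : insert c₁ (subs.image f) ⊆ Ev) :
    ∑ i ∈ buf inp st, rem inp x (now inp st) i ≤
      9 * δ * ∑ c ∈ Ev, ((available inp c st).card : ℝ) := by
  set D := ∑ i ∈ buf inp st, rem inp x (now inp st) i with hD
  set E := ∑ c ∈ Ev, ((available inp c st).card : ℝ) with hE
  have h1 := sum_buf_lockedAt_le hx hδ' hI
  have h2 : D = ∑ i ∈ buf inp st, lockedAt inp x δ st.locks (now inp st) i +
      ∑ i ∈ buf inp st, (view inp x st).unlocked δ i := by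
    rw [← Finset.sum_add_distrib]
    refine Finset.sum_congr rfl fun i _ => ?_
    rw [view_unlocked]; ring
  have hsubU : subs.biUnion id ⊆ (view inp x st).colors := by
    intro c hc
    obtain ⟨S, hS, hcS⟩ := Finset.mem_biUnion.1 hc
    exact h.subset_colors hS hcS
  have h3 : ∑ i ∈ buf inp st, (view inp x st).unlocked δ i ≤ 8 * δ * E := by
    rw [sum_buf_eq (x := x), ← Finset.sum_sdiff hsubU, Finset.sum_biUnion]
    · have h4 := h.sum_unselected_le hI hδ hc₁
      have h5 : ∑ S ∈ subs, ∑ c ∈ id S, ∑ i ∈ available inp c st, (view inp x st).unlocked δ i ≤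
          4 * δ * ∑ c ∈ subs.image f, ((available inp c st).card : ℝ) := by
        rw [Finset.sum_image h.injOn, Finset.mul_sum]
        exact Finset.sum_le_sum fun S hS => h.sum_unlocked_le hI hδ hS
      have h6 : ∑ c ∈ subs.image f, ((available inp c st).card : ℝ) ≤ E :=
        Finset.sum_le_sum_of_subset_of_nonneg
          ((Finset.subset_insert _ _).trans hEv) fun _ _ _ => Nat.cast_nonneg _
      have h7 : ((available inp c₁ st).card : ℝ) ≤ E :=
        Finset.single_le_sum (f := fun c => ((available inp c st).card : ℝ))
          (fun _ _ => Nat.cast_nonneg _) (hEv (Finset.mem_insert_self _ _))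
      nlinarith
    · intro S hS T hT hne
      exact h.family.2.1 S hS T hT hne
  have hE0 : 0 ≤ E := Finset.sum_nonneg fun _ _ => Nat.cast_nonneg _
  -- From `D ≤ D / 20 + 8 * δ * E` follows `D ≤ (160 / 19) * δ * E`.
  nlinarith

/-- Batches that will still schedule at least `M` items that are already output have small total
weight. -/
theorem mul_sum_le_sum_rem (hx : IsFeasible inp x) {st : State} (hst : Good inp st)
    (Q : Finset (Finset ℕ × ℕ)) (hQ : Q ⊆ batches inp) (M : ℝ)
    (hM : ∀ b ∈ Q, M ≤ ((b.1.filter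
      (fun i => i ∈ st.out ∧ now inp st ≤ slotOf b i)).card : ℝ)) :
    M * ∑ b ∈ Q, x b ≤ ∑ i ∈ buf inp st, rem inp x (now inp st) i := by
  rw [sum_buf_rem hx hst]
  have hle : now inp st ≤ inp.k + inp.n + 1 := by
    have := hst.length_le
    unfold now; omega
  -- Items are covered exactly once, so what has not been removed yet is scheduled from now on.
  have h1 : ∀ i ∈ st.out.toFinset, 1 - rem inp x (now inp st) i =
      ∑ s ∈ Finset.Ico (now inp st) (inp.k + inp.n + 1), rate inp x i s := by
    intro i hi
    have hi' := hst.mem i (List.mem_toFinset.1 hi)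
    have h2 := cover_eq_one hx hi'.1 hi'.2
    rw [cover_eq] at h2
    rw [Finset.sum_Ico_eq_sub _ hle, ← rem, ← rem, h2]
  rw [Finset.sum_congr rfl h1, sum_rate_sum, Finset.mul_sum]
  refine le_trans ?_ (Finset.sum_le_sum_of_subset_of_nonneg hQ fun b hb _ =>
    mul_nonneg (hx.1 b hb) (Nat.cast_nonneg _))
  refine Finset.sum_le_sum fun b hb => ?_
  rw [mul_comm]
  refine mul_le_mul_of_nonneg_left ?_ (hx.1 b (hQ hb))
  refine (hM b hb).trans ?_
  norm_cast
  refine Finset.card_le_card fun i hi => ?_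
  simp only [Finset.mem_filter, List.mem_toFinset, Finset.mem_Ico] at hi ⊢
  have := slotOf_lt_end hi.1
  have := batch_end_le (hQ hb)
  exact ⟨hi.1, hi.2.1, hi.2.2, by omega⟩

end

/-! ### Progress in phases with a selection. -/

section

variable {inp : Input} {x : Finset ℕ × ℕ → ℝ} {δ : ℝ}

/-- The total weight of the batches that end in the slot `t` or later. -/
def openWeight (inp : Input) (x : Finset ℕ × ℕ → ℝ) (t : ℕ) : ℝ :=
  ∑ b ∈ batches inp, if t < b.2 + b.1.card then x b else 0

/-- The total size of the blocks of the colours `cs`. -/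
def blocksSize (inp : Input) (cs : Finset ℕ) (st : State) : ℕ :=
  ∑ c ∈ cs, (available inp c st).card

/-- The items that are output in `st'` but not in `st` and do not have colour `c`. -/
def newOthers (inp : Input) (c : ℕ) (st st' : State) : Finset ℕ :=
  (st'.out.toFinset \ st.out.toFinset).filter (fun i => inp.color i ≠ c)

theorem blocksSize_erase_le {cs : List ℕ} {st st' : State} (he : Evicted inp cs st st') (c : ℕ) :
    blocksSize inp (cs.toFinset.erase c) st ≤ (newOthers inp c st st').card := by
  rw [blocksSize, ← Finset.card_biUnion]
  · refine Finset.card_le_card fun i hi => ?_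
    obtain ⟨d, hd, hid⟩ := Finset.mem_biUnion.1 hi
    obtain ⟨hd1, hd2⟩ := Finset.mem_erase.1 hd
    obtain ⟨hi1, rfl⟩ := mem_available.1 hid
    obtain ⟨hi2, hi3, hi4⟩ := mem_buf.1 hi1
    rw [newOthers, Finset.mem_filter, Finset.mem_sdiff, List.mem_toFinset, List.mem_toFinset]
    exact ⟨⟨he.gone i hi2.1 hi2.2 hi3 (List.mem_toFinset.1 hd2), hi4⟩, hd1⟩
  · intro d _ d' _ hne
    refine Finset.disjoint_left.2 fun i hi hi' => ?_
    exact hne ((mem_available.1 hi).2.symm.trans (mem_available.1 hi').2)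

theorem Evicted.card_new {cs : List ℕ} {st st' : State} (he : Evicted inp cs st st') :
    (st'.out.toFinset \ st.out.toFinset).card + now inp st = now inp st' := by
  obtain ⟨l, hl, -⟩ := he.out
  have h1 : st'.out.toFinset \ st.out.toFinset = l.toFinset := by
    have hn := he.good.nodup
    rw [hl, List.nodup_append] at hn
    ext i
    rw [Finset.mem_sdiff, List.mem_toFinset, List.mem_toFinset, List.mem_toFinset, hl,
      List.mem_append]
    constructor
    · tauto
    · exact fun hi => ⟨Or.inr hi, fun hi' => hn.2.2 i hi' i hi rfl⟩
  rw [h1, List.toFinset_card_of_nodup]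
  · simp [now, hl]; omega
  · have hn := he.good.nodup
    rw [hl, List.nodup_append] at hn
    exact hn.2.1

/-- If a batch schedules an item that is already output both at the beginning and at the end of a
series of evictions, then it schedules many items that were output before. -/
theorem card_newOthers_lt {cs : List ℕ} {st st' : State} (he : Evicted inp cs st st')
    {b : Finset ℕ × ℕ} (hb : b ∈ batches inp) {a a' : ℕ} (ha : a ∈ b.1)
    (hs : slotOf b a = now inp st) (ha' : a' ∈ b.1) (hs' : slotOf b a' = now inp st')
    (hout' : a' ∈ st'.out) :
    (newOthers inp (inp.color a) st st').card <
      (b.1.filter (fun i => i ∈ st.out ∧ now inp st ≤ slotOf b i)).card := by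
  -- Both end slots are counted, one more than the number of newly output items. This makes the
  -- inequality strict.
  have h1 := card_slots_Ico (b := b) (s := now inp st) (t := now inp st' + 1)
    (hs ▸ start_le_slotOf b a) (by have := slotOf_lt_end ha'; omega)
  have h2 := he.card_new
  set N := st'.out.toFinset \ st.out.toFinset with hN
  have h3 : (N.filter (fun i => inp.color i = inp.color a)).card +
      (newOthers inp (inp.color a) st st').card = N.card :=
    Finset.card_filter_add_card_filter_not _
  have hsub : b.1.filter (fun i => now inp st ≤ slotOf b i ∧ slotOf b i < now inp st' + 1) ⊆
      (b.1.filter (fun i => i ∈ st.out ∧ now inp st ≤ slotOf b i)) ∪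
        N.filter (fun i => inp.color i = inp.color a) := by
    intro i hi
    rw [Finset.mem_filter] at hi
    obtain ⟨hi1, hi2, hi3⟩ := hi
    have hiI := mem_Icc_of_mem_batch hb hi1
    -- The batch items up to `a'` precede the output item `a'` of the same colour, so they are
    -- output as well.
    have hi4 : i ∈ st'.out := by
      by_contra hi5
      have h4 := he.good.closed a' hout' i hi5 hiI.1 hiI.2 (color_eq_of_mem_batch hb hi1 ha')
      have := slotOf_lt_slotOf (b := b) ha' h4
      omega
    rw [Finset.mem_union, Finset.mem_filter, Finset.mem_filter, hN, Finset.mem_sdiff,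
      List.mem_toFinset, List.mem_toFinset]
    by_cases hi6 : i ∈ st.out
    · exact Or.inl ⟨hi1, hi6, hi2⟩
    · exact Or.inr ⟨⟨hi4, hi6⟩, color_eq_of_mem_batch hb hi1 ha⟩
  have h4 := (Finset.card_le_card hsub).trans (Finset.card_union_le _ _)
  omega

/-- The batches that schedule an item that is already output both at the beginning and at the end
of a series of evictions, and whose colour contributes at most half to the evicted blocks. -/
def lagging (inp : Input) (cs : Finset ℕ) (st st' : State) : Finset (Finset ℕ × ℕ) :=
  (batches inp).filter (fun b => ∃ a ∈ b.1, slotOf b a = now inp st ∧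
    blocksSize inp cs st ≤ 2 * blocksSize inp (cs.erase (inp.color a)) st ∧
    ∃ a' ∈ b.1, slotOf b a' = now inp st' ∧ a' ∈ st'.out)

/-- A lagging batch still schedules at least `E / 2` old items, as many as the evicted blocks of
other colours contribute. Since the available volume is `9 * δ * E`, the weight is at most `18 * δ`.
-/
theorem sum_lagging_le (hx : IsFeasible inp x) {cs : List ℕ} {st st' : State} (hst : Good inp st)
    (he : Evicted inp cs st st') (hpos : 0 < blocksSize inp cs.toFinset st)
    (hD : ∑ i ∈ buf inp st, rem inp x (now inp st) i ≤
      9 * δ * (blocksSize inp cs.toFinset st : ℝ)) :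
    ∑ b ∈ lagging inp cs.toFinset st st', x b ≤ 18 * δ := by
  set E : ℝ := (blocksSize inp cs.toFinset st : ℝ) with hE
  have hE0 : 0 < E := by rw [hE]; exact_mod_cast hpos
  have h1 := mul_sum_le_sum_rem hx hst (lagging inp cs.toFinset st st')
    (Finset.filter_subset _ _) (E / 2) (by
      intro b hb
      obtain ⟨hb1, a, ha, hs, hle, a', ha', hs', hout'⟩ := Finset.mem_filter.1 hb
      have h2 := card_newOthers_lt he hb1 ha hs ha' hs' hout'
      have h3 := blocksSize_erase_le he (inp.color a)
      have h4 : E ≤ 2 * ((b.1.filter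
          (fun i => i ∈ st.out ∧ now inp st ≤ slotOf b i)).card : ℝ) := by
        rw [hE]; norm_cast; omega
      linarith)
  have h5 : E * (∑ b ∈ lagging inp cs.toFinset st st', x b) ≤ E * (18 * δ) := by linarith
  exact le_of_mul_le_mul_left h5 hE0

theorem exists_buf_or_out {st : State} {b : Finset ℕ × ℕ} (hb : b ∈ batches inp)
    (h1 : b.2 ≤ now inp st) (h2 : now inp st < b.2 + b.1.card) :
    ∃ a ∈ b.1, slotOf b a = now inp st ∧ (a ∈ buf inp st ∨ a ∈ st.out) := by
  obtain ⟨a, ha, hs⟩ := exists_slotOf_eq h1 h2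
  refine ⟨a, ha, hs, ?_⟩
  have h3 := lt_slotOf hb ha
  by_cases h4 : a ∈ st.out
  · exact Or.inr h4
  · exact Or.inl (mem_buf.2 ⟨mem_Icc_of_mem_batch hb ha, by omega, h4⟩)

theorem sum_lagging_eq (cs : Finset ℕ) (st st' : State) :
    ∑ b ∈ lagging inp cs st st', x b =
      ∑ b ∈ batches inp, if b ∈ lagging inp cs st st' then x b else 0 := by
  rw [← Finset.sum_filter]
  refine Finset.sum_congr ?_ fun _ _ => rfl
  ext b
  rw [Finset.mem_filter]
  exact ⟨fun h => ⟨(Finset.mem_filter.1 h).1, h⟩, fun h => h.2⟩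

/-- If the third case applies, then either the first or second case applies after the phase, or
batches of large weight end during the phase. -/
theorem progress_of_case3 (hx : IsFeasible inp x) (hδ' : δ < 1 / 100)
    {cs : List ℕ} {st st' : State}
    (hst : Good inp st) (hl : LastGone inp st)
    (he : Evicted inp cs st st') (hpos : 0 < blocksSize inp cs.toFinset st)
    (hD : ∑ i ∈ buf inp st, rem inp x (now inp st) i ≤
      9 * δ * (blocksSize inp cs.toFinset st : ℝ))
    (h3 : (view inp x st).Case3) (h2' : ¬ (view inp x st').Case2 δ) :
    1 / 4 ≤ openWeight inp x (now inp st) - openWeight inp x (now inp st') := by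
  obtain ⟨a₀, ha₀, hw⟩ := (case3_iff hst).1 h3
  rw [case2_iff, not_le] at h2'
  have hlag := sum_lagging_le hx hst he hpos hD
  rw [sum_lagging_eq] at hlag
  rw [sum_rate] at hw h2'
  -- A batch of the last colour that is now in use ends during the phase, or schedules a buffer item
  -- at its end, or lags.
  have key : ∀ b ∈ batches inp,
      (if ∃ i ∈ arrivedOf inp (inp.color a₀) st, i ∈ b.1 ∧ slotOf b i = now inp st
        then x b else 0) ≤
      (if now inp st < b.2 + b.1.card then x b else 0) -
      (if now inp st' < b.2 + b.1.card then x b else 0) +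
      (if ∃ i ∈ buf inp st', i ∈ b.1 ∧ slotOf b i = now inp st' then x b else 0) +
      (if b ∈ lagging inp cs.toFinset st st' then x b else 0) := by
    intro b hb
    have hxb := hx.1 b hb
    have hnow := he.now_le
    have hmono : now inp st' < b.2 + b.1.card → now inp st < b.2 + b.1.card := by omega
    by_cases hP : ∃ i ∈ arrivedOf inp (inp.color a₀) st, i ∈ b.1 ∧ slotOf b i = now inp st
    · rw [if_pos hP]
      obtain ⟨i, hi, hib, his⟩ := hP
      have hend := slotOf_lt_end hib
      rw [if_pos (show now inp st < b.2 + b.1.card by omega)]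
      by_cases hend' : now inp st' < b.2 + b.1.card
      · have hstart := start_le_slotOf b i
        obtain ⟨a', ha', hs', hor⟩ := exists_buf_or_out (st := st') hb (by omega) hend'
        rw [if_pos hend']
        rcases hor with hor | hor
        · rw [if_pos ⟨a', hor, ha', hs'⟩]
          split_ifs <;> linarith
        · have : b ∈ lagging inp cs.toFinset st st' := by
            refine Finset.mem_filter.2 ⟨hb, i, hib, his, ?_, a', ha', hs', hor⟩
            have hic := (mem_arrivedOf.1 hi).2.2
            -- The colour output last is not in the buffer, so it contributes nothing to the evicted
            -- blocks.
            have h0 := hl a₀ ha₀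
            have : blocksSize inp cs.toFinset st =
                blocksSize inp (cs.toFinset.erase (inp.color i)) st := by
              unfold blocksSize
              rw [Finset.sum_erase]
              rw [hic, h0, Finset.card_empty]
            omega
          rw [if_pos this]
          split_ifs <;> linarith
      · rw [if_neg hend']
        split_ifs <;> linarith
    · rw [if_neg hP]
      split_ifs <;> linarith
  have hsum := Finset.sum_le_sum key
  rw [Finset.sum_add_distrib, Finset.sum_add_distrib, Finset.sum_sub_distrib] at hsum
  unfold openWeight
  -- `1 / 2 - 2 * δ - 18 * δ` exceeds `1 / 4`.
  linarith

theorem getLast?_evict {c : ℕ} {st : State} (hst : Good inp st)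
    (h : (available inp c st).Nonempty) :
    ∃ a, (evict inp c st).out.getLast? = some a ∧ inp.color a = c := by
  obtain ⟨l, h1, h2, -, -, h5⟩ := evict_spec c hst
  rcases List.eq_nil_or_concat l with rfl | ⟨l', b, rfl⟩
  · rw [List.append_nil] at h1
    rw [available_congr h1] at h5
    exact absurd h5 h.ne_empty
  · refine ⟨b, ?_, h2 b (by simp)⟩
    rw [h1, List.concat_eq_append, ← List.append_assoc, List.getLast?_concat]

/-- If none of the first three cases applies, neither at the beginning nor after the eviction of the
largest block, then either the second case applies after the phase, or batches of large weight end
during the phase. -/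
theorem progress_of_case4 (hx : IsFeasible inp x) (hδ' : δ < 1 / 100)
    {cs : List ℕ} {st st' : State} {c₁ : ℕ}
    (hst : Good inp st) (hlen : st.out.length < inp.n)
    (he : Evicted inp (c₁ :: cs) st st') (he' : Evicted inp cs (evict inp c₁ st) st')
    (hc₁ : (available inp c₁ st).Nonempty)
    (hlarge : ∀ c, (available inp c st).card ≤ (available inp c₁ st).card)
    (hD : ∑ i ∈ buf inp st, rem inp x (now inp st) i ≤
      9 * δ * (blocksSize inp (c₁ :: cs).toFinset st : ℝ))
    (h2 : ¬ (view inp x st).Case2 δ) (h3 : ¬ (view inp x (evict inp c₁ st)).Case3)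
    (h2' : ¬ (view inp x st').Case2 δ) :
    1 / 4 ≤ openWeight inp x (now inp st) - openWeight inp x (now inp st') := by
  set st₁ := evict inp c₁ st with hst₁
  obtain ⟨l, -, -, -, hst₁g, -⟩ := evict_spec c₁ hst
  obtain ⟨a₁, ha₁, hca₁⟩ := getLast?_evict hst hc₁
  rw [case3_iff hst₁g] at h3
  have hw : ∑ i ∈ arrivedOf inp c₁ st₁, rate inp x i (now inp st₁) ≤ 1 / 2 := by
    by_contra hlt
    push Not at hlt
    exact h3 ⟨a₁, ha₁, by rw [hca₁]; exact hlt⟩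
  have hpos : 0 < blocksSize inp (c₁ :: cs).toFinset st :=
    Finset.sum_pos' (fun _ _ => Nat.zero_le _) ⟨c₁, by simp, hc₁.card_pos⟩
  have hlag := sum_lagging_le hx hst he hpos hD
  have huse : usage inp x (now inp st) = 1 :=
    usage_eq_one hx (by unfold now; omega) (by unfold now; omega)
  rw [usage, Finset.sum_filter] at huse
  rw [case2_iff, not_le] at h2' h2
  rw [sum_lagging_eq] at hlag
  rw [sum_rate] at hw h2' h2
  have hnow₁ : now inp st₁ ≤ now inp st' := he'.now_le
  have hnow : now inp st ≤ now inp st₁ := by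
    obtain ⟨l, hl, -⟩ := evict_spec c₁ hst
    rw [hst₁]
    simp [now, hl]
  -- A batch in use now either schedules a buffer item at the beginning or end of the phase, or ends
  -- during it, or lags. The exception is colour `c₁`: such a batch, if still open, was also in use
  -- right after the eviction of `c₁`, with an arrived item.
  have key : ∀ b ∈ batches inp,
      (if b.2 ≤ now inp st ∧ now inp st < b.2 + b.1.card then x b else 0) ≤
      (if ∃ i ∈ buf inp st, i ∈ b.1 ∧ slotOf b i = now inp st then x b else 0) +
      (if ∃ i ∈ arrivedOf inp c₁ st₁, i ∈ b.1 ∧ slotOf b i = now inp st₁ then x b else 0) +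
      ((if now inp st < b.2 + b.1.card then x b else 0) -
      (if now inp st' < b.2 + b.1.card then x b else 0)) +
      (if ∃ i ∈ buf inp st', i ∈ b.1 ∧ slotOf b i = now inp st' then x b else 0) +
      (if b ∈ lagging inp (c₁ :: cs).toFinset st st' then x b else 0) := by
    intro b hb
    have hxb := hx.1 b hb
    have hmono : now inp st' < b.2 + b.1.card → now inp st < b.2 + b.1.card := by omega
    by_cases hP : b.2 ≤ now inp st ∧ now inp st < b.2 + b.1.card
    · rw [if_pos hP, if_pos hP.2]
      by_cases hend' : now inp st' < b.2 + b.1.card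
      · rw [if_pos hend']
        obtain ⟨a, ha, hs, hor⟩ := exists_buf_or_out (st := st) hb hP.1 hP.2
        rcases hor with hor | hor
        · rw [if_pos ⟨a, hor, ha, hs⟩]
          split_ifs <;> linarith
        · obtain ⟨a', ha', hs', hor'⟩ := exists_buf_or_out (st := st') hb (by omega) hend'
          rcases hor' with hor' | hor'
          · rw [if_pos (show ∃ i ∈ buf inp st', i ∈ b.1 ∧ slotOf b i = now inp st' from
              ⟨a', hor', ha', hs'⟩)]
            split_ifs <;> linarith
          · by_cases hac : inp.color a = c₁
            · obtain ⟨a'', ha'', hs''⟩ := exists_slotOf_eq (b := b) (s := now inp st₁)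
                (by omega) (by omega)
              have h5 := lt_slotOf hb ha''
              rw [if_pos (show ∃ i ∈ arrivedOf inp c₁ st₁, i ∈ b.1 ∧ slotOf b i = now inp st₁ from
                ⟨a'', mem_arrivedOf.2 ⟨mem_Icc_of_mem_batch hb ha'', by omega,
                  (color_eq_of_mem_batch hb ha'' ha).trans hac⟩, ha'', hs''⟩)]
              split_ifs <;> linarith
            · have : b ∈ lagging inp (c₁ :: cs).toFinset st st' := by
                refine Finset.mem_filter.2 ⟨hb, a, ha, hs, ?_, a', ha', hs', hor'⟩
                -- Any other colour has a block no larger than that of `c₁`, which remains in the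
                -- sum, so it holds at most half.
                have h6 : (available inp c₁ st).card ≤
                    blocksSize inp ((c₁ :: cs).toFinset.erase (inp.color a)) st :=
                  Finset.single_le_sum (f := fun c => (available inp c st).card)
                    (fun _ _ => Nat.zero_le _)
                    (Finset.mem_erase.2 ⟨fun h => hac h.symm, by simp⟩)
                have h7 := hlarge (inp.color a)
                have h8 : blocksSize inp (c₁ :: cs).toFinset st ≤
                    (available inp (inp.color a) st).card +
                      blocksSize inp ((c₁ :: cs).toFinset.erase (inp.color a)) st := by
                  unfold blocksSize
                  by_cases hm : inp.color a ∈ (c₁ :: cs).toFinset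
                  · rw [Finset.add_sum_erase _ (fun c => (available inp c st).card) hm]
                  · rw [Finset.erase_eq_of_notMem hm]
                    omega
                omega
              rw [if_pos this]
              split_ifs <;> linarith
      · rw [if_neg hend']
        split_ifs <;> linarith
    · rw [if_neg hP]
      split_ifs <;> linarith
  have hsum := Finset.sum_le_sum key
  rw [Finset.sum_add_distrib, Finset.sum_add_distrib, Finset.sum_add_distrib,
    Finset.sum_add_distrib, Finset.sum_sub_distrib] at hsum
  unfold openWeight
  -- `1 - 2 * δ - 1 / 2 - 2 * δ - 18 * δ` exceeds `1 / 4`; this is the strictest demand on `δ`.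
  linarith

end

/-! ### Release times and the potential `freePot`. -/

section

variable {inp : Input} {x : Finset ℕ × ℕ → ℝ} {δ : ℝ}

/-- The time until which a lock by the block `B` is in force. -/
def releaseTime (inp : Input) (x : Finset ℕ × ℕ → ℝ) (δ : ℝ) (B : Finset ℕ) : ℕ :=
  ((Finset.range (inp.k + inp.n + 2)).filter (fun t => InForce inp x δ t B)).card

/-- The times at which a lock is in force form an initial segment, so their number is the first time
at which it fails. -/
theorem inForce_of_lt_releaseTime (hx : IsFeasible inp x) {t : ℕ} {B : Finset ℕ}
    (h : t < releaseTime inp x δ B) : InForce inp x δ t B := by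
  by_contra hn
  have : (Finset.range (inp.k + inp.n + 2)).filter (fun t => InForce inp x δ t B) ⊆
      Finset.range t := by
    intro s hs
    rw [Finset.mem_range]
    by_contra hst
    exact hn ((Finset.mem_filter.1 hs).2.anti hx (not_lt.1 hst))
  have := Finset.card_le_card this
  rw [Finset.card_range] at this
  unfold releaseTime at h
  omega

/-- The counted range reaches `inp.k + inp.n + 1`, the largest possible value of `now`. -/
theorem lt_releaseTime (hx : IsFeasible inp x) {t : ℕ} {B : Finset ℕ}
    (h : InForce inp x δ t B) (ht : t ≤ inp.k + inp.n + 1) : t < releaseTime inp x δ B := by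
  have : Finset.range (t + 1) ⊆
      (Finset.range (inp.k + inp.n + 2)).filter (fun t => InForce inp x δ t B) := by
    intro s hs
    rw [Finset.mem_range] at hs
    exact Finset.mem_filter.2 ⟨Finset.mem_range.2 (by omega), h.anti hx (by omega)⟩
  have := Finset.card_le_card this
  rw [Finset.card_range] at this
  exact this

/-- Arrivals can only advance the release time of a block. Hence volume lost to a lock stays lost
when the block grows. -/
theorem releaseTime_anti {B B' : Finset ℕ} (h : B ⊆ B') :
    releaseTime inp x δ B' ≤ releaseTime inp x δ B := by
  refine Finset.card_le_card fun t ht => ?_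
  rw [Finset.mem_filter] at ht ⊢
  exact ⟨ht.1, fun a ha => ht.2 a (h ha)⟩

/-- The removed volume of item `i` that is unlocked, or will be unlocked before the block of its
colour has to be evicted. -/
def freeVol (inp : Input) (x : Finset ℕ × ℕ → ℝ) (δ : ℝ) (st : State) (i : ℕ) : ℝ :=
  rem inp x (now inp st) i - (st.locks.map (fun L =>
    if releaseTime inp x δ (available inp (inp.color i) st) ≤ releaseTime inp x δ L.block
    then L.amount i else 0)).sum

/-- The average of `freeVol` over the block of colour `c`, as long as no item of this block was
fractionally removed by more than `δ`. -/
def avgFree (inp : Input) (x : Finset ℕ × ℕ → ℝ) (δ : ℝ) (st : State) (c : ℕ) : ℝ :=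
  if now inp st < releaseTime inp x δ (available inp c st) then
    (∑ i ∈ available inp c st, freeVol inp x δ st i) / ((available inp c st).card : ℝ)
  else 0

/-- The potential that pays for the blocks chosen by the selection procedure. -/
def freePot (inp : Input) (x : Finset ℕ × ℕ → ℝ) (δ : ℝ) (st : State) : ℝ :=
  ∑ c ∈ (Finset.Icc 1 inp.n).image inp.color, avgFree inp x δ st c

/-- The total weight of the batches that start in the slot `t` or later. -/
def futureWeight (inp : Input) (x : Finset ℕ × ℕ → ℝ) (t : ℕ) : ℝ :=
  ∑ b ∈ batches inp, if t ≤ b.2 then x b else 0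

/-- The locks are nonnegative and do not lock more than the removed volume. -/
structure LocksOk (inp : Input) (x : Finset ℕ × ℕ → ℝ) (δ : ℝ) (st : State) : Prop where
  amount_nonneg : ∀ L ∈ st.locks, ∀ i, 0 ≤ L.amount i
  locked_le : ∀ i, lockedAt inp x δ st.locks (now inp st) i ≤ rem inp x (now inp st) i

theorem Inv.locksOk {st : State} (h : Inv inp x δ st) : LocksOk inp x δ st :=
  ⟨h.amount_nonneg, h.locked_le⟩

/-- A lock that outlasts a block still below its release time is in force now, so `freeVol`
subtracts only some of the locks that `unlocked` subtracts. -/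
theorem LocksOk.unlocked_le_freeVol (hx : IsFeasible inp x) {st : State} (h : LocksOk inp x δ st)
    {i : ℕ} (hi : now inp st < releaseTime inp x δ (available inp (inp.color i) st)) :
    (view inp x st).unlocked δ i ≤ freeVol inp x δ st i := by
  rw [view_unlocked, freeVol]
  refine sub_le_sub_left (List.sum_le_sum fun L hL => ?_) _
  have h1 := h.amount_nonneg L hL i
  split_ifs with h2 h3
  · exact le_rfl
  · exact absurd (inForce_of_lt_releaseTime hx (hi.trans_le h2)) h3
  · exact h1
  · exact le_rfl

theorem LocksOk.unlocked_nonneg {st : State} (h : LocksOk inp x δ st) (i : ℕ) :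
    0 ≤ (view inp x st).unlocked δ i := by
  rw [view_unlocked]
  linarith [h.locked_le i]

theorem LocksOk.avgFree_nonneg (hx : IsFeasible inp x) {st : State} (h : LocksOk inp x δ st)
    (c : ℕ) : 0 ≤ avgFree inp x δ st c := by
  unfold avgFree
  split_ifs with h1
  · refine div_nonneg (Finset.sum_nonneg fun i hi => ?_) (Nat.cast_nonneg _)
    have h2 := (mem_available.1 hi).2
    rw [← h2] at h1
    exact (h.unlocked_nonneg i).trans (h.unlocked_le_freeVol hx h1)
  · exact le_rfl

theorem freePot_nonneg (hx : IsFeasible inp x) {st : State} (h : LocksOk inp x δ st) :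
    0 ≤ freePot inp x δ st :=
  Finset.sum_nonneg fun c _ => h.avgFree_nonneg hx c

theorem freeVol_le_rem {st : State} (h : ∀ L ∈ st.locks, ∀ i, 0 ≤ L.amount i) (i : ℕ) :
    freeVol inp x δ st i ≤ rem inp x (now inp st) i := by
  rw [freeVol, sub_le_self_iff]
  refine List.sum_nonneg fun y hy => ?_
  obtain ⟨L, hL, rfl⟩ := List.mem_map.1 hy
  have := h L hL i
  split_ifs <;> linarith

/-- The average fractional progress on the block of `c` between two states. -/
def progress (inp : Input) (x : Finset ℕ × ℕ → ℝ) (st st' : State) (c : ℕ) : ℝ :=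
  (∑ i ∈ available inp c st', (rem inp x (now inp st') i - rem inp x (now inp st) i)) /
    ((available inp c st').card : ℝ)

/-- Locks that count keep counting, and new arrivals dilute the average; only fractional progress
during the phase can increase it. -/
theorem avgFree_le (hx : IsFeasible inp x) {cs : List ℕ} {st st' : State}
    (h : LocksOk inp x δ st) (he : Evicted inp cs st st') (c : ℕ) :
    avgFree inp x δ st' c ≤ avgFree inp x δ st c + progress inp x st st' c := by
  have h0 := h.avgFree_nonneg hx c
  have hd : ∀ i, 0 ≤ rem inp x (now inp st') i - rem inp x (now inp st) i := fun i =>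
    sub_nonneg.2 (rem_mono hx he.now_le i)
  have hp : 0 ≤ progress inp x st st' c :=
    div_nonneg (Finset.sum_nonneg fun i _ => hd i) (Nat.cast_nonneg _)
  have hloc' : ∀ L ∈ st'.locks, ∀ i, 0 ≤ L.amount i := by rw [he.locks]; exact h.amount_nonneg
  by_cases hal : now inp st' < releaseTime inp x δ (available inp c st')
  swap
  · rw [avgFree, if_neg hal]; positivity
  -- Such an item arrived after the start of the phase, so all its removed volume is progress of
  -- this phase.
  have hnew : ∀ i ∈ available inp c st', i ∉ available inp c st →
      freeVol inp x δ st' i ≤ rem inp x (now inp st') i - rem inp x (now inp st) i := by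
    intro i hi hi'
    obtain ⟨h1, h2⟩ := mem_available.1 hi
    obtain ⟨h3, h4, h5⟩ := mem_buf.1 h1
    have h6 : rem inp x (now inp st) i = 0 := by
      apply rem_eq_zero
      by_contra h7
      push Not at h7
      exact hi' (mem_available.2 ⟨mem_buf.2 ⟨h3, by omega, fun h8 => h5 (he.sub h8)⟩, h2⟩)
    rw [h6, sub_zero]
    exact freeVol_le_rem hloc' i
  rw [avgFree, if_pos hal]
  -- An evicted block consists of new arrivals only; a block that is not evicted can only grow.
  by_cases hc : c ∈ cs
  · refine le_trans ?_ (le_add_of_nonneg_left h0)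
    unfold progress
    gcongr with i hi
    refine hnew i hi fun hi' => ?_
    obtain ⟨h1, h2⟩ := mem_available.1 hi'
    obtain ⟨h3, h4, -⟩ := mem_buf.1 h1
    exact (mem_buf.1 (mem_available.1 hi).1).2.2 (he.gone i h3.1 h3.2 h4 (h2 ▸ hc))
  · have hsub : available inp c st ⊆ available inp c st' := by
      intro i hi
      obtain ⟨h1, h2⟩ := mem_available.1 hi
      obtain ⟨h3, h4, h5⟩ := mem_buf.1 h1
      refine mem_available.2 ⟨mem_buf.2 ⟨h3, h4.trans_le he.now_le, fun h6 => ?_⟩, h2⟩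
      obtain ⟨l, hl, hl'⟩ := he.out
      rw [hl, List.mem_append] at h6
      rcases h6 with h6 | h6
      · exact h5 h6
      · exact hc (h2 ▸ hl' i h6)
    have hτ := releaseTime_anti (inp := inp) (x := x) (δ := δ) hsub
    have hal0 : now inp st < releaseTime inp x δ (available inp c st) :=
      he.now_le.trans_lt (hal.trans_le hτ)
    have hold : ∀ i ∈ available inp c st, freeVol inp x δ st' i ≤ freeVol inp x δ st i +
        (rem inp x (now inp st') i - rem inp x (now inp st) i) := by
      intro i hi
      have h2 := (mem_available.1 hi).2
      have h3 : (st.locks.map (fun L =>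
          if releaseTime inp x δ (available inp (inp.color i) st) ≤ releaseTime inp x δ L.block
          then L.amount i else 0)).sum ≤ (st'.locks.map (fun L =>
          if releaseTime inp x δ (available inp (inp.color i) st') ≤ releaseTime inp x δ L.block
          then L.amount i else 0)).sum := by
        rw [he.locks, h2]
        refine List.sum_le_sum fun L hL => ?_
        have := h.amount_nonneg L hL i
        split_ifs <;> linarith
      unfold freeVol
      linarith
    have hsum : ∑ i ∈ available inp c st', freeVol inp x δ st' i ≤
        ∑ i ∈ available inp c st, freeVol inp x δ st i +
          ∑ i ∈ available inp c st', (rem inp x (now inp st') i - rem inp x (now inp st) i) := by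
      rw [← Finset.sum_sdiff hsub, ← Finset.sum_sdiff hsub
        (f := fun i => rem inp x (now inp st') i - rem inp x (now inp st) i)]
      have h1 := Finset.sum_le_sum hold
      rw [Finset.sum_add_distrib] at h1
      have h2 := Finset.sum_le_sum (s := available inp c st' \ available inp c st)
        fun i hi => hnew i (Finset.mem_sdiff.1 hi).1 (Finset.mem_sdiff.1 hi).2
      linarith
    have hnn : 0 ≤ ∑ i ∈ available inp c st, freeVol inp x δ st i := by
      refine Finset.sum_nonneg fun i hi => ?_
      have h2 := (mem_available.1 hi).2
      rw [← h2] at hal0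
      exact (h.unlocked_nonneg i).trans (h.unlocked_le_freeVol hx hal0)
    have h5 : (∑ i ∈ available inp c st, freeVol inp x δ st i) /
        ((available inp c st').card : ℝ) ≤ avgFree inp x δ st c := by
      rw [avgFree, if_pos hal0]
      rcases Finset.eq_empty_or_nonempty (available inp c st) with hemp | hne
      · simp [hemp]
      · exact div_le_div_of_nonneg_left hnn (by exact_mod_cast hne.card_pos)
          (by exact_mod_cast Finset.card_le_card hsub)
    have h6 := div_le_div_of_nonneg_right hsum (Nat.cast_nonneg (α := ℝ) (available inp c st').card)
    rw [add_div] at h6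
    unfold progress
    linarith

/-- A batch has one colour and contributes to its average at most the fraction of the block that it
covers, hence at most `x b`, however long the phase is. -/
theorem sum_progress_le (hx : IsFeasible inp x) {st st' : State} (hle : now inp st ≤ now inp st') :
    ∑ c ∈ (Finset.Icc 1 inp.n).image inp.color, progress inp x st st' c ≤
      1 + (futureWeight inp x (now inp st) - futureWeight inp x (now inp st')) := by
  have h1 : ∀ c, progress inp x st st' c = ∑ b ∈ batches inp, x b *
      (((b.1.filter (fun i => i ∈ available inp c st' ∧
        slotOf b i ∈ Finset.Ico (now inp st) (now inp st'))).card : ℝ) /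
        ((available inp c st').card : ℝ)) := by
    intro c
    have h2 : ∀ i ∈ available inp c st', rem inp x (now inp st') i - rem inp x (now inp st) i =
        ∑ s ∈ Finset.Ico (now inp st) (now inp st'), rate inp x i s := by
      intro i _
      rw [Finset.sum_Ico_eq_sub _ hle, rem, rem]
    rw [progress, Finset.sum_congr rfl h2, sum_rate_sum, Finset.sum_div]
    exact Finset.sum_congr rfl fun b _ => mul_div_assoc _ _ _
  simp_rw [h1]
  rw [Finset.sum_comm]
  have hu := usage_le_one hx (now inp st)
  rw [usage, Finset.sum_filter] at hu
  have h2 : ∀ b ∈ batches inp, ∑ c ∈ (Finset.Icc 1 inp.n).image inp.color, x b *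
      (((b.1.filter (fun i => i ∈ available inp c st' ∧
        slotOf b i ∈ Finset.Ico (now inp st) (now inp st'))).card : ℝ) /
        ((available inp c st').card : ℝ)) ≤
      (if b.2 ≤ now inp st ∧ now inp st < b.2 + b.1.card then x b else 0) +
      ((if now inp st ≤ b.2 then x b else 0) - (if now inp st' ≤ b.2 then x b else 0)) := by
    intro b hb
    have hxb := hx.1 b hb
    obtain ⟨a, ha⟩ := (mem_batches_iff hb).1
    have hrhs : (if now inp st' ≤ b.2 then x b else 0) ≤ (if now inp st ≤ b.2 then x b else 0) := by
      split_ifs <;> linarith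
    by_cases hex : ∃ i ∈ b.1, slotOf b i ∈ Finset.Ico (now inp st) (now inp st')
    · rw [Finset.sum_eq_single (inp.color a)]
      · have h3 : x b * (((b.1.filter (fun i => i ∈ available inp (inp.color a) st' ∧
            slotOf b i ∈ Finset.Ico (now inp st) (now inp st'))).card : ℝ) /
            ((available inp (inp.color a) st').card : ℝ)) ≤ x b * 1 := by
          refine mul_le_mul_of_nonneg_left (div_le_one_of_le₀ ?_ (Nat.cast_nonneg _)) hxb
          have hsub : b.1.filter (fun i => i ∈ available inp (inp.color a) st' ∧
              slotOf b i ∈ Finset.Ico (now inp st) (now inp st')) ⊆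
              available inp (inp.color a) st' := fun i hi => (Finset.mem_filter.1 hi).2.1
          exact_mod_cast Finset.card_le_card hsub
        refine h3.trans ?_
        -- A batch active in the phase is in use at its first slot, where the total weight is at
        -- most 1, or starts during it and is charged to `futureWeight`.
        obtain ⟨i, hi, his⟩ := hex
        rw [Finset.mem_Ico] at his
        have h4 := start_le_slotOf b i
        have h5 := slotOf_lt_end hi
        split_ifs <;> first | linarith | omega
      · intro c _ hc
        rw [Finset.filter_eq_empty_iff.2]
        · simp
        · rintro i hi ⟨h3, -⟩
          exact hc ((mem_available.1 h3).2.symm.trans (color_eq_of_mem_batch hb hi ha))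
      · intro hna
        exact absurd (Finset.mem_image_of_mem _ (Finset.mem_Icc.2 (mem_Icc_of_mem_batch hb ha))) hna
    · rw [Finset.sum_eq_zero]
      · have : 0 ≤ (if b.2 ≤ now inp st ∧ now inp st < b.2 + b.1.card then x b else 0) := by
          split_ifs <;> linarith
        linarith
      · intro c _
        rw [Finset.filter_eq_empty_iff.2]
        · simp
        · rintro i hi ⟨-, h3⟩
          exact hex ⟨i, hi, h3⟩
  have h3 := Finset.sum_le_sum h2
  rw [Finset.sum_add_distrib, Finset.sum_sub_distrib] at h3
  unfold futureWeight
  linarith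

theorem freePot_evicted_le (hx : IsFeasible inp x) {cs : List ℕ} {st st' : State}
    (h : LocksOk inp x δ st) (he : Evicted inp cs st st') :
    freePot inp x δ st' + futureWeight inp x (now inp st') ≤
      freePot inp x δ st + futureWeight inp x (now inp st) + 1 := by
  have h1 := Finset.sum_le_sum (s := (Finset.Icc 1 inp.n).image inp.color)
    fun c _ => avgFree_le hx h he c
  rw [Finset.sum_add_distrib] at h1
  have h2 := sum_progress_le hx he.now_le
  unfold freePot
  linarith

/-- Evictions ignore locks, so the new locks may be regarded as created before the evictions of the
phase. -/
theorem Evicted.with_locks {cs : List ℕ} {st st' : State} (h : Evicted inp cs st st')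
    (locks : List Lock) :
    Evicted inp cs { out := st.out, locks := locks } { out := st'.out, locks := locks } :=
  ⟨⟨h.good.nodup, h.good.mem, h.good.arrived, h.good.order, h.good.closed⟩, h.out, h.gone, rfl,
    h.cost_le, h.last⟩

end

/-! ### Creation of locks and the effect of a proportional random choice. -/

section

variable {inp : Input} {x : Finset ℕ × ℕ → ℝ} {δ : ℝ}

theorem sum_map_newLocks (V : View) (subs : Finset (Finset ℕ)) (f : Finset ℕ → ℕ)
    (g : Lock → ℝ) : ((V.newLocks δ subs f).map g).sum = ∑ S ∈ subs, g
      { block := V.block (f S)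
        amount := fun i => if i ∈ V.buffer ∧ V.color i ∈ S then V.unlocked δ i else 0 } := by
  rw [View.newLocks, List.map_map]
  exact Finset.sum_map_toList _ _

theorem mem_newLocks {V : View} {subs : Finset (Finset ℕ)} {f : Finset ℕ → ℕ} {L : Lock} :
    L ∈ V.newLocks δ subs f ↔ ∃ S ∈ subs,
      { block := V.block (f S)
        amount := fun i => if i ∈ V.buffer ∧ V.color i ∈ S then V.unlocked δ i else 0 } = L := by
  simp [View.newLocks]

/-- The state `st` together with the locks created by the selection `f`. -/
def withNew (inp : Input) (x : Finset ℕ × ℕ → ℝ) (δ : ℝ) (st : State) (subs : Finset (Finset ℕ))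
    (f : Finset ℕ → ℕ) : State :=
  { out := st.out, locks := st.locks ++ (view inp x st).newLocks δ subs f }

variable {st : State} {subs : Finset (Finset ℕ)} {f : Finset ℕ → ℕ}

theorem newLocks_amount_nonneg (hI : Inv inp x δ st) :
    ∀ L ∈ (view inp x st).newLocks δ subs f, ∀ i, 0 ≤ L.amount i := by
  intro L hL i
  obtain ⟨S, -, rfl⟩ := mem_newLocks.1 hL
  dsimp only
  split_ifs
  · exact hI.unlocked_nonneg i
  · exact le_rfl

theorem Selected.sum_ite_le (h : Selected inp x δ st subs f) (c : ℕ) {y : ℝ} (hy : 0 ≤ y) :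
    ∑ S ∈ subs, (if c ∈ S then y else 0) ≤ y := by
  by_cases hex : ∃ S ∈ subs, c ∈ S
  · obtain ⟨S, hS, hc⟩ := hex
    rw [Finset.sum_eq_single_of_mem S hS]
    · simp [hc]
    · intro T hT hne
      exact if_neg fun hcT => Finset.disjoint_left.1 (h.family.2.1 T hT S hS hne) hcT hc
  · rw [Finset.sum_eq_zero]
    · exact hy
    · intro S hS
      exact if_neg fun hc => hex ⟨S, hS, hc⟩

/-- Disjoint subclasses lock each item at most once, and only its unlocked volume. The full `Inv`
has to wait for the evictions, since the locking blocks are still in the buffer. -/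
theorem Selected.locksOk (h : Selected inp x δ st subs f) (hI : Inv inp x δ st) :
    LocksOk inp x δ (withNew inp x δ st subs f) := by
  refine ⟨?_, fun i => ?_⟩
  · intro L hL
    rcases List.mem_append.1 hL with hL | hL
    · exact hI.amount_nonneg L hL
    · exact newLocks_amount_nonneg hI L hL
  · have h1 : lockedAt inp x δ ((view inp x st).newLocks δ subs f) (now inp st) i ≤
        (view inp x st).unlocked δ i := by
      rw [lockedAt, sum_map_newLocks]
      refine le_trans (Finset.sum_le_sum fun S _ => ?_)
        (h.sum_ite_le ((view inp x st).color i) (hI.unlocked_nonneg i))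
      have := hI.unlocked_nonneg i
      dsimp only
      split_ifs <;> first | linarith | tauto
    rw [view_unlocked] at h1
    have h2 : lockedAt inp x δ (withNew inp x δ st subs f).locks (now inp st) i =
        lockedAt inp x δ st.locks (now inp st) i +
        lockedAt inp x δ ((view inp x st).newLocks δ subs f) (now inp st) i := by
      simp [lockedAt, withNew]
    have h3 : now inp (withNew inp x δ st subs f) = now inp st := rfl
    rw [h3, h2]
    linarith

theorem Selected.inv (hx : IsFeasible inp x) (hδ : 0 < δ) (h : Selected inp x δ st subs f)
    (hI : Inv inp x δ st) {cs : List ℕ} {st' : State}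
    (he : Evicted inp cs (withNew inp x δ st subs f) st') (hcs : ∀ S ∈ subs, f S ∈ cs) :
    Inv inp x δ st' := by
  have hok := h.locksOk hI
  refine ⟨he.good, he.last, ?_, ?_, ?_, ?_, ?_⟩
  · rw [he.locks]; exact hok.amount_nonneg
  · rw [he.locks]
    intro L hL a ha
    rcases List.mem_append.1 hL with hL | hL
    · exact he.sub (hI.block_sub L hL a ha)
    · obtain ⟨S, hS, rfl⟩ := mem_newLocks.1 hL
      dsimp only at ha
      rw [view_block] at ha
      obtain ⟨h1, h2⟩ := mem_available.1 ha
      obtain ⟨h3, h4, -⟩ := mem_buf.1 h1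
      exact he.gone a h3.1 h3.2 h4 (h2 ▸ hcs S hS)
  · rw [he.locks]
    refine List.pairwise_append.2 ⟨hI.disj, ?_, ?_⟩
    · rw [View.newLocks, List.pairwise_map]
      refine subs.nodup_toList.pairwise_of_forall_ne fun S hS T hT hne => ?_
      rw [Finset.mem_toList] at hS hT
      dsimp only
      rw [view_block, view_block, Finset.disjoint_left]
      intro a ha ha'
      exact hne (h.injOn hS hT ((mem_available.1 ha).2.symm.trans (mem_available.1 ha').2))
    -- Blocks of old locks are output, those of new locks are still in the buffer.
    · intro L hL M hM
      obtain ⟨S, hS, rfl⟩ := mem_newLocks.1 hM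
      dsimp only
      rw [view_block, Finset.disjoint_left]
      intro a ha ha'
      exact (mem_buf.1 (mem_available.1 ha').1).2.2 (hI.block_sub L hL a ha)
  · rw [he.locks]
    intro L hL
    rcases List.mem_append.1 hL with hL | hL
    · exact hI.amount_le L hL
    · obtain ⟨S, hS, rfl⟩ := mem_newLocks.1 hL
      dsimp only
      rw [view_block]
      refine le_trans (le_of_eq ?_) (h.sum_unlocked_le hI hδ hS)
      rw [← Finset.sum_biUnion]
      · rw [← Finset.sum_filter]
        refine Finset.sum_congr ?_ fun _ _ => rfl
        ext i
        rw [Finset.mem_filter, Finset.mem_biUnion, view_buffer, Finset.mem_Icc]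
        constructor
        · rintro ⟨-, h1, h2⟩
          rw [view_color_of_mem_buf h1] at h2
          exact ⟨_, h2, mem_available.2 ⟨h1, rfl⟩⟩
        · rintro ⟨c, hc, h1⟩
          obtain ⟨h2, rfl⟩ := mem_available.1 h1
          exact ⟨(mem_buf.1 h2).1, h2, by rwa [view_color_of_mem_buf h2]⟩
      · intro c _ d _ hne
        refine Finset.disjoint_left.2 fun i hi hi' => ?_
        exact hne ((mem_available.1 hi).2.symm.trans (mem_available.1 hi').2)
  · intro i
    rw [he.locks]
    exact (lockedAt_anti hx hok.amount_nonneg he.now_le i).trans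
      ((hok.locked_le i).trans (rem_mono hx he.now_le i))

/-- The weight in the subclass `S` that never becomes available again if its volume is locked by the
block of colour `d`. -/
def doomed (inp : Input) (x : Finset ℕ × ℕ → ℝ) (δ : ℝ) (st : State) (S : Finset ℕ) (d : ℕ) : ℝ :=
  ∑ c ∈ S, if releaseTime inp x δ (available inp c st) ≤ releaseTime inp x δ (available inp d st)
    then (view inp x st).weight δ c else 0

theorem colors_subset : (view inp x st).colors ⊆ (Finset.Icc 1 inp.n).image inp.color := by
  intro c hc
  obtain ⟨i, hi⟩ := mem_view_colors.1 hc
  obtain ⟨h1, rfl⟩ := mem_available.1 hi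
  exact Finset.mem_image_of_mem _ (Finset.mem_Icc.2 (mem_buf.1 h1).1)

theorem Good.now_le (h : Good inp st) : now inp st ≤ inp.k + inp.n + 1 := by
  have := h.length_le
  unfold now
  omega

theorem lt_releaseTime_of_not_case1 (hx : IsFeasible inp x) (hst : Good inp st)
    (h1 : ¬ (view inp x st).Case1 δ) (c : ℕ) :
    now inp st < releaseTime inp x δ (available inp c st) := by
  refine lt_releaseTime hx (fun a ha => ?_) hst.now_le
  rw [case1_iff] at h1
  push Not at h1
  exact (h1 a (mem_available.1 ha).1).le

theorem weight_le_avgFree (hx : IsFeasible inp x) (hI : Inv inp x δ st)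
    (h1 : ¬ (view inp x st).Case1 δ) (c : ℕ) :
    (view inp x st).weight δ c ≤ avgFree inp x δ st c := by
  have hal := lt_releaseTime_of_not_case1 hx hI.good h1 c
  rw [avgFree, if_pos hal, View.weight, view_block]
  gcongr with i hi
  refine hI.locksOk.unlocked_le_freeVol hx ?_
  rw [(mem_available.1 hi).2]
  exact hal

/-- This keeps the potential nonnegative even if the choices doom the whole weight of all
subclasses, as `tsum_mul_ofReal_le` requires. -/
theorem Selected.sum_totalWeight_le (hx : IsFeasible inp x) (h : Selected inp x δ st subs f)
    (hI : Inv inp x δ st) :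
    ∑ S ∈ subs, (view inp x st).totalWeight δ S ≤ freePot inp x δ st := by
  have h1 : ∑ S ∈ subs, (view inp x st).totalWeight δ S =
      ∑ c ∈ subs.biUnion id, (view inp x st).weight δ c := by
    rw [Finset.sum_biUnion]
    · rfl
    · exact fun S hS T hT hne => h.family.2.1 S hS T hT hne
  rw [h1]
  refine (Finset.sum_le_sum fun c _ => weight_le_avgFree hx hI h.not_case1 c).trans ?_
  refine Finset.sum_le_sum_of_subset_of_nonneg ?_ fun c _ _ => hI.locksOk.avgFree_nonneg hx c
  intro c hc
  obtain ⟨S, hS, hcS⟩ := Finset.mem_biUnion.1 hc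
  exact colors_subset (h.subset_colors hS hcS)

/-- A new lock changes the free volume of exactly those colours of its subclass that it outlasts,
and it takes their whole unlocked volume, whose average is `weight`. -/
theorem Selected.freePot_withNew (hx : IsFeasible inp x) (h : Selected inp x δ st subs f)
    (hI : Inv inp x δ st) :
    freePot inp x δ (withNew inp x δ st subs f) =
      freePot inp x δ st - ∑ S ∈ subs, doomed inp x δ st S (f S) := by
  set V := view inp x st with hV
  have hav : ∀ c, available inp c (withNew inp x δ st subs f) = available inp c st := fun c =>
    available_congr rfl c
  have hnow : now inp (withNew inp x δ st subs f) = now inp st := rfl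
  have hkey : ∀ c, avgFree inp x δ (withNew inp x δ st subs f) c = avgFree inp x δ st c -
      ∑ S ∈ subs, if c ∈ S ∧ releaseTime inp x δ (available inp c st) ≤
        releaseTime inp x δ (available inp (f S) st) then V.weight δ c else 0 := by
    intro c
    have hal := lt_releaseTime_of_not_case1 hx hI.good h.not_case1 c
    have hfree : ∀ i ∈ available inp c st, freeVol inp x δ (withNew inp x δ st subs f) i =
        freeVol inp x δ st i - ∑ S ∈ subs, if c ∈ S ∧ releaseTime inp x δ (available inp c st) ≤
        releaseTime inp x δ (available inp (f S) st) then V.unlocked δ i else 0 := by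
      intro i hi
      obtain ⟨hib, hic⟩ := mem_available.1 hi
      rw [freeVol, freeVol, hnow, hic, hav]
      have hl : (withNew inp x δ st subs f).locks = st.locks ++ V.newLocks δ subs f := rfl
      rw [hl, List.map_append, List.sum_append, sum_map_newLocks, sub_sub]
      congr 2
      refine Finset.sum_congr rfl fun S _ => ?_
      dsimp only
      rw [hV, view_block, view_buffer, view_color_of_mem_buf hib, hic]
      by_cases h1 : c ∈ S <;> simp [h1, hib]
    rw [avgFree, hav, hnow, if_pos hal, avgFree, if_pos hal, Finset.sum_congr rfl hfree,
      Finset.sum_sub_distrib, sub_div]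
    congr 1
    rw [Finset.sum_comm, Finset.sum_div]
    refine Finset.sum_congr rfl fun S _ => ?_
    split_ifs with h1
    · rw [View.weight, hV, view_block]
    · simp
  unfold freePot
  simp only [hkey, Finset.sum_sub_distrib]
  rw [Finset.sum_comm]
  congr 1
  refine Finset.sum_congr rfl fun S hS => ?_
  unfold doomed
  rw [← Finset.sum_filter, ← Finset.sum_filter]
  refine Finset.sum_congr ?_ fun _ _ => rfl
  ext c
  rw [Finset.mem_filter, Finset.mem_filter]
  constructor
  · exact fun h1 => h1.2
  · exact fun h1 => ⟨colors_subset (h.subset_colors hS h1.1), h1⟩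

/-- A choice with probability proportional to the weights `w`. -/
def Proportional (S : Finset ℕ) (w : ℕ → ℝ) (q : PMF ℕ) : Prop :=
  ∀ c ∈ S, q c = ENNReal.ofReal (w c / ∑ d ∈ S, w d)

/-- The prescribed probabilities on `S` already sum to 1. -/
theorem Proportional.mem_of_ne_zero {S : Finset ℕ} {w : ℕ → ℝ} {q : PMF ℕ}
    (hq : Proportional S w q) (hw : ∀ c ∈ S, 0 ≤ w c) (hpos : 0 < ∑ c ∈ S, w c) {c : ℕ}
    (hc : q c ≠ 0) : c ∈ S := by
  have h1 : ∑ d ∈ S, q d = 1 := by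
    rw [Finset.sum_congr rfl hq, ← ENNReal.ofReal_sum_of_nonneg fun d hd =>
      div_nonneg (hw d hd) hpos.le, ← Finset.sum_div, div_self hpos.ne', ENNReal.ofReal_one]
  by_contra hcS
  have h2 : q c + ∑ d ∈ S, q d ≤ 1 := by
    rw [← Finset.sum_insert hcS, ← q.tsum_coe]
    exact ENNReal.sum_le_tsum _
  rw [h1] at h2
  have h3 : q c + 1 ≤ 0 + 1 := by simpa using h2
  exact hc (by simpa using ENNReal.le_of_add_le_add_right ENNReal.one_ne_top h3)

/-- Of `τ c ≤ τ d` and `τ d ≤ τ c` at least one holds, so the sum and its transpose together cover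
all products in the square. -/
theorem sum_mul_sum_ite_ge (S : Finset ℕ) (w : ℕ → ℝ) (hw : ∀ c ∈ S, 0 ≤ w c) (τ : ℕ → ℕ) :
    (∑ c ∈ S, w c) ^ 2 / 2 ≤ ∑ d ∈ S, w d * ∑ c ∈ S, if τ c ≤ τ d then w c else 0 := by
  have h1 : ∑ d ∈ S, w d * ∑ c ∈ S, (if τ c ≤ τ d then w c else 0) =
      ∑ d ∈ S, ∑ c ∈ S, if τ c ≤ τ d then w d * w c else 0 := by
    refine Finset.sum_congr rfl fun d _ => ?_
    rw [Finset.mul_sum]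
    exact Finset.sum_congr rfl fun c _ => by split_ifs <;> simp
  have h2 : ∑ d ∈ S, ∑ c ∈ S, (if τ c ≤ τ d then w d * w c else 0) =
      ∑ d ∈ S, ∑ c ∈ S, if τ d ≤ τ c then w d * w c else 0 := by
    rw [Finset.sum_comm]
    exact Finset.sum_congr rfl fun c _ => Finset.sum_congr rfl fun d _ => by
      rw [mul_comm]
  have h3 : (∑ c ∈ S, w c) ^ 2 ≤ ∑ d ∈ S, ∑ c ∈ S, (if τ c ≤ τ d then w d * w c else 0) +
      ∑ d ∈ S, ∑ c ∈ S, if τ d ≤ τ c then w d * w c else 0 := by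
    rw [sq, Finset.sum_mul_sum, ← Finset.sum_add_distrib]
    refine Finset.sum_le_sum fun d hd => ?_
    rw [← Finset.sum_add_distrib]
    refine Finset.sum_le_sum fun c hc => ?_
    have := mul_nonneg (hw d hd) (hw c hc)
    split_ifs <;> linarith
  rw [h1]
  linarith

/-- If in each of several families a member is chosen with probability proportional to its weight,
then in expectation at least half of the weight precedes the choice. -/
theorem tsum_mul_ofReal_le {Ω σ : Type*} (q : PMF Ω) (subs : Finset σ) (S : σ → Finset ℕ)
    (e : σ → Ω → ℕ) (w : ℕ → ℝ) (τ : ℕ → ℕ) (hw : ∀ s ∈ subs, ∀ c ∈ S s, 0 ≤ w c)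
    (hpos : ∀ s ∈ subs, 0 < ∑ c ∈ S s, w c)
    (hq : ∀ s ∈ subs, Proportional (S s) w (q.map (e s))) {K β : ℝ} (hβ : 0 ≤ β)
    (hK : β * ∑ s ∈ subs, ∑ c ∈ S s, w c ≤ K) :
    ∑' ω, q ω * ENNReal.ofReal
      (K - β * ∑ s ∈ subs, ∑ c ∈ S s, if τ c ≤ τ (e s ω) then w c else 0) ≤
      ENNReal.ofReal (K - β * ∑ s ∈ subs, (∑ c ∈ S s, w c) / 2) := by
  set Z : σ → ℕ → ℝ := fun s d => ∑ c ∈ S s, if τ c ≤ τ d then w c else 0 with hZ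
  set W : σ → ℝ := fun s => ∑ c ∈ S s, w c with hW
  have hZW : ∀ s ∈ subs, ∀ d, 0 ≤ W s - Z s d := by
    intro s hs d
    refine sub_nonneg.2 (Finset.sum_le_sum fun c hc => ?_)
    have := hw s hs c hc
    split_ifs <;> linarith
  -- `hK` makes every summand nonnegative, so `ENNReal.ofReal` is additive here. The expression then
  -- splits over the families, so only the marginal laws matter.
  have h1 : ∀ ω, ENNReal.ofReal (K - β * ∑ s ∈ subs, Z s (e s ω)) =
      ENNReal.ofReal (K - β * ∑ s ∈ subs, W s) +
        ∑ s ∈ subs, ENNReal.ofReal (β * (W s - Z s (e s ω))) := by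
    intro ω
    rw [← ENNReal.ofReal_sum_of_nonneg fun s hs => mul_nonneg hβ (hZW s hs _),
      ← ENNReal.ofReal_add (sub_nonneg.2 hK)
        (Finset.sum_nonneg fun s hs => mul_nonneg hβ (hZW s hs _))]
    congr 1
    rw [← Finset.mul_sum, Finset.sum_sub_distrib]
    ring
  have h2 : ∀ s ∈ subs, ∑' ω, q ω * ENNReal.ofReal (β * (W s - Z s (e s ω))) ≤
      ENNReal.ofReal (β * (W s / 2)) := by
    intro s hs
    have hWs := hpos s hs
    have h3 : ∑' ω, q ω * ENNReal.ofReal (β * (W s - Z s (e s ω))) =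
        ∑' d, (q.map (e s)) d * ENNReal.ofReal (β * (W s - Z s d)) := by
      simp_rw [PMF.map_apply, ← ENNReal.tsum_mul_right]
      rw [ENNReal.tsum_comm]
      refine tsum_congr fun ω => ?_
      rw [tsum_eq_single (e s ω)]
      · simp
      · intro d hd
        simp [hd]
    rw [h3, tsum_eq_sum (s := S s)]
    · have h4 : ∀ d ∈ S s, (q.map (e s)) d * ENNReal.ofReal (β * (W s - Z s d)) =
          ENNReal.ofReal (w d / W s * (β * (W s - Z s d))) := by
        intro d hd
        rw [hq s hs d hd, ← ENNReal.ofReal_mul (div_nonneg (hw s hs d hd) hWs.le)]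
      rw [Finset.sum_congr rfl h4, ← ENNReal.ofReal_sum_of_nonneg]
      · apply ENNReal.ofReal_le_ofReal
        have h5 := sum_mul_sum_ite_ge (S s) w (hw s hs) τ
        have h6 : ∑ d ∈ S s, w d / W s * (β * (W s - Z s d)) =
            β * ((W s * W s - ∑ d ∈ S s, w d * Z s d) / W s) := by
          have h7 : W s * W s = ∑ d ∈ S s, w d * W s := by rw [← Finset.sum_mul]
          rw [h7, ← Finset.sum_sub_distrib, Finset.sum_div, Finset.mul_sum]
          exact Finset.sum_congr rfl fun d _ => by ring
        rw [h6]
        refine mul_le_mul_of_nonneg_left ?_ hβ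
        rw [div_le_iff₀ hWs]
        have h8 : (∑ c ∈ S s, w c) = W s := rfl
        rw [h8] at h5
        linarith
      · intro d hd
        exact mul_nonneg (div_nonneg (hw s hs d hd) hWs.le) (mul_nonneg hβ (hZW s hs d))
    · intro d hd
      have : (q.map (e s)) d = 0 := by
        by_contra hne
        exact hd ((hq s hs).mem_of_ne_zero (hw s hs) hWs hne)
      rw [this, zero_mul]
  have h9 : ENNReal.ofReal (K - β * ∑ s ∈ subs, W s / 2) =
      ENNReal.ofReal (K - β * ∑ s ∈ subs, W s) + ∑ s ∈ subs, ENNReal.ofReal (β * (W s / 2)) := by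
    have h10 : ∀ s ∈ subs, 0 ≤ β * (W s / 2) := fun s hs =>
      mul_nonneg hβ (by have := hpos s hs; positivity)
    rw [← ENNReal.ofReal_sum_of_nonneg h10, ← ENNReal.ofReal_add (sub_nonneg.2 hK)
      (Finset.sum_nonneg h10)]
    congr 1
    rw [← Finset.mul_sum, ← Finset.sum_div]
    ring
  calc ∑' ω, q ω * ENNReal.ofReal (K - β * ∑ s ∈ subs, Z s (e s ω))
      = ∑' ω, (q ω * ENNReal.ofReal (K - β * ∑ s ∈ subs, W s) +
          ∑ s ∈ subs, q ω * ENNReal.ofReal (β * (W s - Z s (e s ω)))) := by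
        refine tsum_congr fun ω => ?_
        rw [h1, mul_add, Finset.mul_sum subs _ (q ω)]
    _ = ENNReal.ofReal (K - β * ∑ s ∈ subs, W s) +
          ∑ s ∈ subs, ∑' ω, q ω * ENNReal.ofReal (β * (W s - Z s (e s ω))) := by
        rw [ENNReal.tsum_add, ENNReal.tsum_mul_right, q.tsum_coe, one_mul,
          Summable.tsum_finsetSum fun _ _ => ENNReal.summable]
    _ ≤ _ := by
        rw [h9]
        gcongr with s hs
        exact h2 s hs

end

/-! ### Existence of algorithms that follow the procedure. -/

section

/-- A family of maximal cardinality works: a class with remaining weight at least `δ` would allow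
one more subclass. -/
theorem exists_isSubclassFamily (V : View) {δ : ℝ} (hδ : 0 < δ) :
    ∃ subs, V.IsSubclassFamily δ subs := by
  set P : Finset (Finset ℕ) → Prop := fun subs =>
    (∀ S ∈ subs, (∃ s, S ⊆ V.sizeClass s) ∧ δ ≤ V.totalWeight δ S ∧
      ∃ c ∈ S, V.totalWeight δ (S.erase c) < δ) ∧
    (∀ S ∈ subs, ∀ T ∈ subs, S ≠ T → Disjoint S T) with hP
  have hne : (V.colors.powerset.powerset.filter P).Nonempty :=
    ⟨∅, Finset.mem_filter.2 ⟨by simp, by simp [hP]⟩⟩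
  obtain ⟨subs, hsubs, hmax⟩ := Finset.exists_max_image _ Finset.card hne
  obtain ⟨hsub, h1, h2⟩ := Finset.mem_filter.1 hsubs
  refine ⟨subs, h1, h2, fun s => ?_⟩
  by_contra hlt
  push Not at hlt
  have hne' : ((V.sizeClass s \ subs.biUnion id).powerset.filter
      (fun S => δ ≤ V.totalWeight δ S)).Nonempty :=
    ⟨_, Finset.mem_filter.2 ⟨Finset.mem_powerset_self _, hlt⟩⟩
  -- By minimal cardinality, removing any colour brings the weight below `δ`.
  obtain ⟨S, hS, hmin⟩ := Finset.exists_min_image _ Finset.card hne'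
  obtain ⟨hS1, hS2⟩ := Finset.mem_filter.1 hS
  rw [Finset.mem_powerset] at hS1
  have hSne : S.Nonempty := by
    rw [Finset.nonempty_iff_ne_empty]
    rintro rfl
    have : V.totalWeight δ ∅ = 0 := Finset.sum_empty
    linarith
  have hdisj : ∀ T ∈ subs, Disjoint S T := by
    intro T hT
    refine Finset.disjoint_left.2 fun c hc hcT => ?_
    exact (Finset.mem_sdiff.1 (hS1 hc)).2 (Finset.mem_biUnion.2 ⟨T, hT, hcT⟩)
  have hSnot : S ∉ subs := fun h => by
    obtain ⟨c, hc⟩ := hSne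
    exact Finset.disjoint_left.1 (hdisj S h) hc hc
  have hS3 : ∃ c ∈ S, V.totalWeight δ (S.erase c) < δ := by
    obtain ⟨c, hc⟩ := hSne
    refine ⟨c, hc, ?_⟩
    by_contra hge
    have := hmin (S.erase c) (Finset.mem_filter.2
      ⟨Finset.mem_powerset.2 ((Finset.erase_subset _ _).trans hS1), not_lt.1 hge⟩)
    have := Finset.card_erase_lt_of_mem hc
    omega
  have hins : insert S subs ∈ V.colors.powerset.powerset.filter P := by
    refine Finset.mem_filter.2 ⟨?_, ?_, ?_⟩
    · rw [Finset.mem_powerset] at hsub ⊢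
      refine Finset.insert_subset ?_ hsub
      rw [Finset.mem_powerset]
      exact (hS1.trans Finset.sdiff_subset).trans (Finset.filter_subset _ _)
    · intro T hT
      rcases Finset.mem_insert.1 hT with rfl | hT
      · exact ⟨⟨s, hS1.trans Finset.sdiff_subset⟩, hS2, hS3⟩
      · exact h1 T hT
    · intro T hT T' hT' hne
      rcases Finset.mem_insert.1 hT with h3 | h3 <;> rcases Finset.mem_insert.1 hT' with h4 | h4
      · exact absurd (h3.trans h4.symm) hne
      · exact h3 ▸ hdisj T' h4
      · exact h4 ▸ (hdisj T h3).symm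
      · exact h2 T h3 T' h4 hne
  have := hmax _ hins
  rw [Finset.card_insert_of_notMem hSnot] at this
  omega

theorem exists_proportional (S : Finset ℕ) (w : ℕ → ℝ) (hw : ∀ c ∈ S, 0 ≤ w c)
    (hpos : 0 < ∑ c ∈ S, w c) : ∃ q : PMF ℕ, Proportional S w q := by
  refine ⟨PMF.ofFinset (fun c => if c ∈ S then ENNReal.ofReal (w c / ∑ d ∈ S, w d) else 0) S ?_ ?_,
    ?_⟩
  · rw [Finset.sum_congr rfl fun c hc => if_pos hc, ← ENNReal.ofReal_sum_of_nonneg fun c hc =>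
      div_nonneg (hw c hc) hpos.le, ← Finset.sum_div, div_self hpos.ne', ENNReal.ofReal_one]
  · exact fun c hc => if_neg hc
  · intro c hc
    rw [PMF.ofFinset_apply, if_pos hc]

/-- Given a law for each member of a finite family, there is a joint law with these marginals. -/
theorem exists_joint_law (subs : Finset (Finset ℕ)) (μ : Finset ℕ → PMF ℕ) :
    ∃ q : PMF (Finset ℕ → ℕ), ∀ S ∈ subs, q.map (fun f => f S) = μ S := by
  induction subs using Finset.induction_on with
  | empty => exact ⟨PMF.pure fun _ => 0, by simp⟩
  | insert S subs hS ih =>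
    obtain ⟨q, hq⟩ := ih
    refine ⟨q.bind fun f => (μ S).map fun c => Function.update f S c, fun T hT => ?_⟩
    rw [PMF.map_bind]
    simp_rw [PMF.map_comp]
    rcases eq_or_ne T S with rfl | hne
    · have : ∀ f : Finset ℕ → ℕ, ((fun f : Finset ℕ → ℕ => f T) ∘
          fun c => Function.update f T c) = id := by
        intro f; funext c; simp
      simp_rw [this, PMF.map_id]
      exact PMF.bind_const q (μ T)
    · have : ∀ f : Finset ℕ → ℕ, ((fun f : Finset ℕ → ℕ => f T) ∘
          fun c => Function.update f S c) = Function.const ℕ (f T) := by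
        intro f; funext c; simp [hne]
      simp_rw [this, PMF.map_const]
      rw [← hq T ((Finset.mem_insert.1 hT).resolve_left hne), PMF.map]
      rfl

theorem exists_isChoiceLaw (V : View) {δ : ℝ} (hδ : 0 < δ) (hV : IsProperView δ V)
    {subs : Finset (Finset ℕ)} (hs : V.IsSubclassFamily δ subs) :
    ∃ q, V.IsChoiceLaw δ subs q := by
  have hw : ∀ c, 0 ≤ V.weight δ c := fun c =>
    div_nonneg (Finset.sum_nonneg fun i hi => hV.2.2 i (Finset.mem_filter.1 hi).1)
      (Nat.cast_nonneg _)
  have h1 : ∀ S : Finset ℕ, ∃ q : PMF ℕ, S ∈ subs → Proportional S (V.weight δ) q := by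
    intro S
    by_cases hS : S ∈ subs
    · obtain ⟨q, hq⟩ := exists_proportional S (V.weight δ) (fun c _ => hw c)
        (hδ.trans_le (hs.1 S hS).2.1)
      exact ⟨q, fun _ => hq⟩
    · exact ⟨PMF.pure 0, fun h => absurd h hS⟩
  choose μ hμ using h1
  obtain ⟨q, hq⟩ := exists_joint_law subs μ
  refine ⟨q, fun S hS c hc => ?_⟩
  rw [hq S hS]
  exact hμ S hS c hc

theorem exists_isLargest (V : View) {T : Finset ℕ} (hT : T.Nonempty) : ∃ c, V.IsLargest T c := by
  obtain ⟨c, hc, hmax⟩ := Finset.exists_max_image T (fun c => (V.block c).card) hT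
  exact ⟨c, hc, hmax⟩

theorem exists_isPhaseLaw (V : View) {δ : ℝ} (hδ : 0 < δ) (hV : IsProperView δ V) :
    ∃ p, IsPhaseLaw δ V p := by
  obtain ⟨subs, hsubs⟩ := exists_isSubclassFamily V hδ
  obtain ⟨q, hq⟩ := exists_isChoiceLaw V hδ hV hsubs
  obtain ⟨c₁, hc₁⟩ := exists_isLargest V (T := V.colors) (hV.1.image V.color)
  by_cases h1 : V.Case1 δ
  · obtain ⟨i, hi, hr⟩ := h1
    exact ⟨_, fun _ => ⟨i, hi, hr, rfl⟩, fun h => absurd ⟨i, hi, hr⟩ h,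
      fun h => absurd ⟨i, hi, hr⟩ h, fun h => absurd ⟨i, hi, hr⟩ h⟩
  by_cases h2 : V.Case2 δ
  · have hpos : 0 < ∑ i ∈ V.buffer, V.frac i V.slot := by
      unfold View.Case2 at h2
      linarith
    obtain ⟨q, hq⟩ := exists_proportional V.buffer (fun i => V.frac i V.slot)
      (fun i _ => hV.2.1 i _) hpos
    exact ⟨_, fun h => absurd h h1, fun _ _ => ⟨q, hq, rfl⟩, fun _ h => absurd h2 h,
      fun _ h => absurd h2 h⟩
  by_cases h3 : V.Case3
  · exact ⟨_, fun h => absurd h h1, fun _ h => absurd h h2,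
      fun _ _ _ => ⟨subs, hsubs, q, hq, c₁, hc₁,
        fun f => (insert c₁ (subs.image f)).toList,
        fun f => ⟨Finset.nodup_toList _, Finset.toList_toFinset _⟩, rfl⟩,
      fun _ _ h => absurd h3 h⟩
  · have hsecond : ∃ second : List ℕ, (V.colors = {c₁} ∧ second = []) ∨
        ∃ c₂, V.IsLargest (V.colors.erase c₁) c₂ ∧ second = [c₂] := by
      rcases Finset.eq_empty_or_nonempty (V.colors.erase c₁) with he | hne
      · refine ⟨[], Or.inl ⟨?_, rfl⟩⟩
        rw [← Finset.insert_erase hc₁.1, he]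
        rfl
      · obtain ⟨c₂, hc₂⟩ := exists_isLargest V hne
        exact ⟨[c₂], Or.inr ⟨c₂, hc₂, rfl⟩⟩
    obtain ⟨second, hsecond⟩ := hsecond
    exact ⟨_, fun h => absurd h h1, fun _ h => absurd h h2, fun _ _ h => absurd h h3,
      fun _ _ _ => ⟨subs, hsubs, q, hq, c₁, hc₁, second, hsecond,
        fun f => (subs.image f \ (c₁ :: second).toFinset).toList,
        fun f => ⟨Finset.nodup_toList _, Finset.toList_toFinset _⟩, rfl⟩⟩

theorem exists_isRounding {δ : ℝ} (hδ : 0 < δ) : ∃ π, IsRounding δ π := by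
  have h : ∀ V, ∃ p, IsProperView δ V → IsPhaseLaw δ V p := by
    intro V
    by_cases hV : IsProperView δ V
    · obtain ⟨p, hp⟩ := exists_isPhaseLaw V hδ hV
      exact ⟨p, fun _ => hp⟩
    · exact ⟨PMF.pure ⟨[], [], []⟩, fun h => absurd h hV⟩
  choose π hπ using h
  exact ⟨π, hπ⟩

end

/-! ### The potential function and the change of `total` in each case. -/

section

variable {inp : Input} {x : Finset ℕ × ℕ → ℝ} {δ : ℝ}

/-- The total weight of the batches with an item that is not output yet. -/
def unsentWeight (inp : Input) (x : Finset ℕ × ℕ → ℝ) (st : State) : ℝ :=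
  ∑ b ∈ batches inp, if ∃ i ∈ b.1, i ∉ st.out then x b else 0

/-- The cost of a phase, apart from the blocks chosen in the subclasses. -/
def phaseConst (δ : ℝ) : ℝ := 2 + 2 / δ

/-- The credit that a state offers to the preceding phases. -/
def credit (inp : Input) (x : Finset ℕ × ℕ → ℝ) (δ : ℝ) (st : State) : ℝ :=
  if (view inp x st).Case1 δ ∨ (view inp x st).Case2 δ then 2 * phaseConst δ
  else if (view inp x st).Case3 then phaseConst δ else 0

/-- The potential of a state. -/
def pot (inp : Input) (x : Finset ℕ × ℕ → ℝ) (δ : ℝ) (st : State) : ℝ :=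
  3 * phaseConst δ / δ * unsentWeight inp x st +
  3 * phaseConst δ / δ * openWeight inp x (now inp st) +
  2 / δ * (freePot inp x δ st + futureWeight inp x (now inp st)) +
  (2 * phaseConst δ - credit inp x δ st)

/-- The cost so far together with the potential. -/
def total (inp : Input) (x : Finset ℕ × ℕ → ℝ) (δ : ℝ) (st : State) : ℝ :=
  cost inp st.out + pot inp x δ st

theorem phaseConst_pos (hδ : 0 < δ) : 0 < phaseConst δ := by
  unfold phaseConst; positivity

theorem credit_nonneg (hδ : 0 < δ) (st : State) : 0 ≤ credit inp x δ st := by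
  have := phaseConst_pos hδ
  unfold credit
  split_ifs <;> linarith

theorem credit_le (hδ : 0 < δ) (st : State) : credit inp x δ st ≤ 2 * phaseConst δ := by
  have := phaseConst_pos hδ
  unfold credit
  split_ifs <;> linarith

theorem unsentWeight_nonneg (hx : IsFeasible inp x) (st : State) : 0 ≤ unsentWeight inp x st :=
  Finset.sum_nonneg fun b hb => by have := hx.1 b hb; split_ifs <;> linarith

theorem openWeight_nonneg (hx : IsFeasible inp x) (t : ℕ) : 0 ≤ openWeight inp x t :=
  Finset.sum_nonneg fun b hb => by have := hx.1 b hb; split_ifs <;> linarith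

theorem futureWeight_nonneg (hx : IsFeasible inp x) (t : ℕ) : 0 ≤ futureWeight inp x t :=
  Finset.sum_nonneg fun b hb => by have := hx.1 b hb; split_ifs <;> linarith

theorem openWeight_anti (hx : IsFeasible inp x) {s t : ℕ} (h : s ≤ t) :
    openWeight inp x t ≤ openWeight inp x s :=
  Finset.sum_le_sum fun b hb => by have := hx.1 b hb; split_ifs <;> linarith

theorem unsentWeight_anti (hx : IsFeasible inp x) {st st' : State} {cs : List ℕ}
    (he : Evicted inp cs st st') : unsentWeight inp x st' ≤ unsentWeight inp x st := by
  refine Finset.sum_le_sum fun b hb => ?_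
  have h0 := hx.1 b hb
  by_cases h : ∃ i ∈ b.1, i ∉ st'.out
  · obtain ⟨i, hi, hi'⟩ := h
    rw [if_pos ⟨i, hi, hi'⟩, if_pos ⟨i, hi, fun h => hi' (he.sub h)⟩]
  · rw [if_neg h]
    split_ifs <;> linarith

variable {st st' : State}

/-- The part of the potential that does not depend on the case. -/
theorem total_le_of_evicted (hx : IsFeasible inp x) (hδ : 0 < δ) {cs : List ℕ}
    (h : LocksOk inp x δ st) (he : Evicted inp cs st st') :
    total inp x δ st' ≤ total inp x δ st + cs.length + 2 / δ
      - 3 * phaseConst δ / δ * (unsentWeight inp x st - unsentWeight inp x st')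
      - 3 * phaseConst δ / δ * (openWeight inp x (now inp st) - openWeight inp x (now inp st'))
      + credit inp x δ st - credit inp x δ st' := by
  have h1 := freePot_evicted_le hx h he
  have h2 : 2 / δ * (freePot inp x δ st' + futureWeight inp x (now inp st')) ≤
      2 / δ * (freePot inp x δ st + futureWeight inp x (now inp st) + 1) :=
    mul_le_mul_of_nonneg_left h1 (by positivity)
  have h3 : (cost inp st'.out : ℝ) ≤ cost inp st.out + cs.length := by
    exact_mod_cast he.cost_le
  unfold total pot
  nlinarith

/-- The omitted terms of `total` are nonnegative. This supplies the lower bound on `K` needed in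
`tsum_mul_ofReal_le`. -/
theorem freePot_add_openWeight_le_total (hx : IsFeasible inp x) (hδ : 0 < δ) :
    2 / δ * freePot inp x δ st + 3 * phaseConst δ / δ * openWeight inp x (now inp st) ≤
      total inp x δ st := by
  have h1 := credit_le (inp := inp) (x := x) hδ st
  have h2 := phaseConst_pos hδ
  have h3 := unsentWeight_nonneg hx st
  have h5 := futureWeight_nonneg hx (now inp st)
  have h6 : 0 ≤ 3 * phaseConst δ / δ * unsentWeight inp x st := by positivity
  have h8 : 0 ≤ 2 / δ * futureWeight inp x (now inp st) := by positivity
  have h9 : (0 : ℝ) ≤ cost inp st.out := Nat.cast_nonneg _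
  unfold total pot
  rw [mul_add]
  linarith

theorem Evicted.now_lt {cs : List ℕ} (he : Evicted inp cs st st') {c : ℕ} (hc : c ∈ cs)
    (hne : (available inp c st).Nonempty) : st.out.length < st'.out.length := by
  obtain ⟨i, hi⟩ := hne
  obtain ⟨h1, h2⟩ := mem_available.1 hi
  obtain ⟨h3, h4, h5⟩ := mem_buf.1 h1
  have h6 := he.gone i h3.1 h3.2 h4 (h2 ▸ hc)
  obtain ⟨l, hl, -⟩ := he.out
  rw [hl, List.mem_append] at h6
  have := List.length_pos_of_mem (h6.resolve_left h5)
  rw [hl, List.length_append]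
  omega

/-- The items up to `st.out.length + 1` have arrived because `0 < inp.k`, and they are too many to
be all output. -/
theorem buf_nonempty (hk : 0 < inp.k) (hlen : st.out.length < inp.n) :
    (buf inp st).Nonempty := by
  by_contra hne
  rw [Finset.not_nonempty_iff_eq_empty] at hne
  have hsub : Finset.Icc 1 (st.out.length + 1) ⊆ st.out.toFinset := by
    intro i hi
    rw [Finset.mem_Icc] at hi
    rw [List.mem_toFinset]
    by_contra hi'
    have : i ∈ buf inp st := mem_buf.2 ⟨⟨hi.1, by omega⟩, by unfold now; omega, hi'⟩
    simp [hne] at this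
  have h1 := Finset.card_le_card hsub
  have h2 := st.out.toFinset_card_le
  rw [Nat.card_Icc] at h1
  omega

theorem Inv.isProperView (hx : IsFeasible inp x) (hI : Inv inp x δ st)
    (hlen : st.out.length < inp.n) : IsProperView δ (view inp x st) := by
  refine ⟨?_, ?_, fun i _ => hI.unlocked_nonneg i⟩
  · rw [view_buffer]
    exact buf_nonempty (k_pos hx (by omega)) hlen
  · intro i s
    have : (view inp x st).frac i s = if s ≤ now inp st then rate inp x i s else 0 := rfl
    rw [this]
    split_ifs
    · exact rate_nonneg hx i s
    · exact le_rfl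

/-- The first case pays for itself. -/
theorem unsentWeight_evict_le (hx : IsFeasible inp x) (hI : Inv inp x δ st) {i : ℕ}
    (hi : i ∈ buf inp st) :
    rem inp x (now inp st) i ≤
      unsentWeight inp x st - unsentWeight inp x (evict inp (inp.color i) st) := by
  have he := evicted_evict (inp.color i) hI.good hI.last
  rw [rem_eq, unsentWeight, unsentWeight, ← Finset.sum_sub_distrib]
  refine Finset.sum_le_sum fun b hb => ?_
  have h0 := hx.1 b hb
  by_cases h : i ∈ b.1 ∧ slotOf b i < now inp st
  · have h1 := batch_end_le_now_evict hb hI.good h.1 hi h.2.le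
    rw [if_pos h, if_pos ⟨i, h.1, (mem_buf.1 hi).2.2⟩, if_neg, sub_zero]
    rintro ⟨a, ha, ha'⟩
    have h2 := mem_Icc_of_mem_batch hb ha
    have h3 := lt_slotOf hb ha
    have h4 := slotOf_lt_end ha
    exact ha' (mem_evict_out _ hI.good h2.1 h2.2 (by omega) (color_eq_of_mem_batch hb ha h.1))
  · rw [if_neg h]
    have h1 : (∃ a ∈ b.1, a ∉ (evict inp (inp.color i) st).out) → ∃ a ∈ b.1, a ∉ st.out :=
      fun ⟨a, ha, ha'⟩ => ⟨a, ha, fun h => ha' (he.sub h)⟩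
    split_ifs with h2 h3 h3
    · linarith
    · linarith
    · exact absurd (h1 h3) h2
    · linarith

theorem total_case1 (hx : IsFeasible inp x) (hδ : 0 < δ) (hI : Inv inp x δ st) {i : ℕ}
    (hi : i ∈ buf inp st) (hr : δ ≤ rem inp x (now inp st) i) :
    total inp x δ (evict inp (inp.color i) st) ≤ total inp x δ st := by
  have he := evicted_evict (inp.color i) hI.good hI.last
  have h1 := total_le_of_evicted hx hδ hI.locksOk he
  have h2 := unsentWeight_evict_le hx hI hi
  have h3 := openWeight_anti hx he.now_le
  have h4 := credit_le (inp := inp) (x := x) hδ st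
  have h5 := credit_nonneg (inp := inp) (x := x) hδ (evict inp (inp.color i) st)
  have hκ := phaseConst_pos hδ
  -- The gain of three times `phaseConst δ` covers the phase itself and a credit of up to twice
  -- `phaseConst δ`.
  have h6 : 3 * phaseConst δ / δ * δ ≤ 3 * phaseConst δ / δ *
      (unsentWeight inp x st - unsentWeight inp x (evict inp (inp.color i) st)) :=
    mul_le_mul_of_nonneg_left (hr.trans h2) (by positivity)
  have h7 : 0 ≤ 3 * phaseConst δ / δ * (openWeight inp x (now inp st) -
      openWeight inp x (now inp (evict inp (inp.color i) st))) :=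
    mul_nonneg (by positivity) (sub_nonneg.2 h3)
  rw [div_mul_cancel₀ _ hδ.ne'] at h6
  have h8 : phaseConst δ = 2 + 2 / δ := rfl
  simp only [List.length_singleton, Nat.cast_one] at h1
  linarith

/-- The weight of the items of the buffer that are scheduled now and whose blocks take at most as
long to evict as the one of the item `a`. -/
def endingWeight (inp : Input) (x : Finset ℕ × ℕ → ℝ) (st : State) (a : ℕ) : ℝ :=
  ∑ i ∈ buf inp st, if now inp (evict inp (inp.color i) st) ≤ now inp (evict inp (inp.color a) st)
    then rate inp x i (now inp st) else 0

/-- A batch now scheduling `i` would end by the end of the eviction of the colour of `i`, hence also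
by that of the longer eviction of the colour of `a`. The lengths are comparable as each eviction is
deterministic. -/
theorem endingWeight_le (hx : IsFeasible inp x) (hI : Inv inp x δ st) (a : ℕ) :
    endingWeight inp x st a ≤ openWeight inp x (now inp st) -
      openWeight inp x (now inp (evict inp (inp.color a) st)) := by
  have he := evicted_evict (inp.color a) hI.good hI.last
  have hle := he.now_le
  rw [endingWeight, ← Finset.sum_filter, sum_rate, openWeight, openWeight,
    ← Finset.sum_sub_distrib]
  refine Finset.sum_le_sum fun b hb => ?_
  have h0 := hx.1 b hb
  by_cases h : ∃ i ∈ (buf inp st).filter (fun i => now inp (evict inp (inp.color i) st) ≤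
      now inp (evict inp (inp.color a) st)), i ∈ b.1 ∧ slotOf b i = now inp st
  · rw [if_pos h]
    obtain ⟨i, hi, hib, his⟩ := h
    rw [Finset.mem_filter] at hi
    have h1 := batch_end_le_now_evict hb hI.good hib hi.1 his.le
    have h2 := slotOf_lt_end hib
    rw [if_pos (by omega), if_neg (by omega), sub_zero]
  · rw [if_neg h]
    split_ifs <;> linarith

theorem sum_rate_buf_le (hx : IsFeasible inp x) :
    ∑ i ∈ buf inp st, rate inp x i (now inp st) ≤ openWeight inp x (now inp st) := by
  rw [sum_rate, openWeight]
  refine Finset.sum_le_sum fun b hb => ?_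
  have h0 := hx.1 b hb
  by_cases h : ∃ i ∈ buf inp st, i ∈ b.1 ∧ slotOf b i = now inp st
  · rw [if_pos h]
    obtain ⟨i, -, hib, his⟩ := h
    have := slotOf_lt_end hib
    rw [if_pos (by omega)]
  · rw [if_neg h]
    split_ifs <;> linarith

theorem total_case2 (hx : IsFeasible inp x) (hδ : 0 < δ) (hI : Inv inp x δ st) (a : ℕ) :
    total inp x δ (evict inp (inp.color a) st) ≤ total inp x δ st + 3 * phaseConst δ -
      3 * phaseConst δ / δ * endingWeight inp x st a := by
  have he := evicted_evict (inp.color a) hI.good hI.last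
  have h1 := total_le_of_evicted hx hδ hI.locksOk he
  have h2 := endingWeight_le hx hI a
  have h3 := unsentWeight_anti hx he
  have h4 := credit_le (inp := inp) (x := x) hδ st
  have h5 := credit_nonneg (inp := inp) (x := x) hδ (evict inp (inp.color a) st)
  have hκ := phaseConst_pos hδ
  have h6 : 3 * phaseConst δ / δ * endingWeight inp x st a ≤ 3 * phaseConst δ / δ *
      (openWeight inp x (now inp st) - openWeight inp x (now inp (evict inp (inp.color a) st))) :=
    mul_le_mul_of_nonneg_left h2 (by positivity)
  have h7 : 0 ≤ 3 * phaseConst δ / δ * (unsentWeight inp x st -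
      unsentWeight inp x (evict inp (inp.color a) st)) :=
    mul_nonneg (by positivity) (sub_nonneg.2 h3)
  have h8 : phaseConst δ = 2 + 2 / δ := rfl
  simp only [List.length_singleton, Nat.cast_one] at h1
  linarith

/-- A phase with a selection is paid for, apart from the random choices. -/
theorem total_selected (hx : IsFeasible inp x) (hδ : 0 < δ) (hδ' : δ < 1 / 100)
    (hI : Inv inp x δ st) {subs : Finset (Finset ℕ)} {f : Finset ℕ → ℕ}
    (h : Selected inp x δ st subs f) {cs : List ℕ}
    (he : Evicted inp cs (withNew inp x δ st subs f) st') (hlen : cs.length ≤ subs.card + 2)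
    (hcredit : credit inp x δ st ≤ phaseConst δ)
    (hprog : ¬ (view inp x st').Case2 δ → (1 / 4 ≤ openWeight inp x (now inp st) -
      openWeight inp x (now inp st'))) :
    total inp x δ st' ≤ total inp x δ st + subs.card -
      2 / δ * ∑ S ∈ subs, doomed inp x δ st S (f S) := by
  have h1 := total_le_of_evicted hx hδ (h.locksOk hI) he
  have h2 : total inp x δ (withNew inp x δ st subs f) = total inp x δ st -
      2 / δ * ∑ S ∈ subs, doomed inp x δ st S (f S) := by
    have h3 : credit inp x δ (withNew inp x δ st subs f) = credit inp x δ st := rfl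
    have h4 : unsentWeight inp x (withNew inp x δ st subs f) = unsentWeight inp x st := rfl
    have h5 : now inp (withNew inp x δ st subs f) = now inp st := rfl
    have h6 : (withNew inp x δ st subs f).out = st.out := rfl
    unfold total pot
    rw [h.freePot_withNew hx hI, h3, h4, h5, h6]
    ring
  have h3 : credit inp x δ (withNew inp x δ st subs f) = credit inp x δ st := rfl
  have h5 : now inp (withNew inp x δ st subs f) = now inp st := rfl
  have hκ := phaseConst_pos hδ
  have h6 := unsentWeight_anti hx he
  have h7 : 0 ≤ 3 * phaseConst δ / δ * (unsentWeight inp x (withNew inp x δ st subs f) -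
      unsentWeight inp x st') := mul_nonneg (by positivity) (sub_nonneg.2 h6)
  have h8 : phaseConst δ = 2 + 2 / δ := rfl
  have h9 : (cs.length : ℝ) ≤ subs.card + 2 := by exact_mod_cast hlen
  have h10 := credit_nonneg (inp := inp) (x := x) hδ st'
  have h11 := openWeight_anti hx he.now_le
  rw [h5] at h11
  have h13 : 0 ≤ 3 * phaseConst δ / δ := by positivity
  rw [h2, h3, h5] at h1
  -- Either the next state hands over credit twice `phaseConst δ`, or the open weight that
  -- disappears yields as much.
  by_cases hc : (view inp x st').Case2 δ
  · have h12 : credit inp x δ st' = 2 * phaseConst δ := if_pos (Or.inr hc)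
    have h14 := mul_nonneg h13 (sub_nonneg.2 h11)
    linarith
  · have h14 := mul_le_mul_of_nonneg_left (hprog hc) h13
    have h15 : 2 * phaseConst δ ≤ 3 * phaseConst δ / δ * (1 / 4) := by
      rw [div_mul_eq_mul_div, le_div_iff₀ hδ]
      nlinarith
    linarith

/-- A phase that ends early is paid for by the next phase. -/
theorem total_early (hx : IsFeasible inp x) (hδ : 0 < δ) (hI : Inv inp x δ st) {cs : List ℕ}
    (he : Evicted inp cs st st') (hlen : cs.length ≤ 2) (hcredit : credit inp x δ st = 0)
    (hcase : (view inp x st').Case1 δ ∨ (view inp x st').Case2 δ ∨ (view inp x st').Case3) :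
    total inp x δ st' ≤ total inp x δ st := by
  have h1 := total_le_of_evicted hx hδ hI.locksOk he
  have h3 := openWeight_anti hx he.now_le
  have h4 := unsentWeight_anti hx he
  have hκ := phaseConst_pos hδ
  have h6 : 0 ≤ 3 * phaseConst δ / δ * (unsentWeight inp x st - unsentWeight inp x st') :=
    mul_nonneg (by positivity) (sub_nonneg.2 h4)
  have h7 : 0 ≤ 3 * phaseConst δ / δ * (openWeight inp x (now inp st) -
      openWeight inp x (now inp st')) := mul_nonneg (by positivity) (sub_nonneg.2 h3)
  -- The credit at the end of the phase pays exactly for two blocks and the growth of `freePot` plus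
  -- `futureWeight`.
  have h8 : phaseConst δ ≤ credit inp x δ st' := by
    unfold credit
    split_ifs with ha hb
    · linarith
    · exact le_rfl
    · tauto
  have h9 : phaseConst δ = 2 + 2 / δ := rfl
  have h10 : (cs.length : ℝ) ≤ 2 := by exact_mod_cast hlen
  linarith

theorem runLead_early (lead : List ℕ) (hst : Good inp st) (hl : LastGone inp st)
    (h : (runLead δ inp x lead st).2 = true) :
    ∃ pre, pre ≠ [] ∧ pre <+: lead ∧ Evicted inp pre st (runLead δ inp x lead st).1 ∧
      ((view inp x (runLead δ inp x lead st).1).Case1 δ ∨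
        (view inp x (runLead δ inp x lead st).1).Case2 δ ∨
        (view inp x (runLead δ inp x lead st).1).Case3) := by
  induction lead generalizing st with
  | nil => simp [runLead] at h
  | cons c cs ih =>
    have he := evicted_evict c hst hl
    rw [runLead] at h ⊢
    split_ifs at h ⊢ with hc
    · exact ⟨[c], by simp, by simp, he, hc⟩
    · obtain ⟨pre, -, h2, h3, h4⟩ := ih he.good he.last h
      exact ⟨c :: pre, by simp, by simpa using h2, he.trans h3, h4⟩

theorem runLead_late (lead : List ℕ) (h : (runLead δ inp x lead st).2 ≠ true) :
    (runLead δ inp x lead st).1 = lead.foldl (fun s c => evict inp c s) st := by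
  induction lead generalizing st with
  | nil => rfl
  | cons c cs ih =>
    rw [runLead] at h ⊢
    split_ifs at h ⊢ with hc
    · exact absurd rfl h
    · exact ih h

theorem not_case3_of_late {c : ℕ} {lead : List ℕ}
    (h : (runLead δ inp x (c :: lead) st).2 ≠ true) :
    ¬ (view inp x (evict inp c st)).Case3 := by
  rw [runLead] at h
  split_ifs at h with hc
  · exact absurd rfl h
  · exact fun h3 => hc (Or.inr (Or.inr h3))

theorem runPhase_early {P : Plan} (h : (runLead δ inp x P.lead st).2 = true) :
    runPhase δ inp x st P = (runLead δ inp x P.lead st).1 :=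
  if_pos h

theorem runPhase_late {P : Plan} (h : (runLead δ inp x P.lead st).2 ≠ true) :
    runPhase δ inp x st P =
      { out := ((P.lead ++ P.rest).foldl (fun s c => evict inp c s) st).out
        locks := st.locks ++ P.locks } := by
  rw [runPhase, if_neg h, runLead_late _ h, List.foldl_append]

end

/-! ### Expected change of `total` per phase, and the conclusion. -/

section

variable {inp : Input} {x : Finset ℕ × ℕ → ℝ} {δ : ℝ} {st : State}

theorem tsum_map_mul {α β : Type*} (q : PMF α) (F : α → β) (g : β → ENNReal) :
    ∑' b, (q.map F) b * g b = ∑' a, q a * g (F a) := by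
  simp_rw [PMF.map_apply, ← ENNReal.tsum_mul_right]
  rw [ENNReal.tsum_comm]
  refine tsum_congr fun a => ?_
  rw [tsum_eq_single (F a)]
  · simp
  · intro b hb
    simp [hb]

theorem tsum_bind_mul {α β : Type*} (q : PMF α) (F : α → PMF β) (g : β → ENNReal) :
    ∑' b, (q.bind F) b * g b = ∑' a, q a * ∑' b, F a b * g b := by
  simp_rw [PMF.bind_apply, ← ENNReal.tsum_mul_right, ← ENNReal.tsum_mul_left]
  rw [ENNReal.tsum_comm]
  simp_rw [mul_assoc]

theorem tsum_pure_mul {α : Type*} (a : α) (g : α → ENNReal) :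
    ∑' b, (PMF.pure a) b * g b = g a := by
  rw [tsum_eq_single a]
  · simp
  · intro b hb
    simp [hb]

theorem tsum_le_tsum_of_support {α : Type*} (q : PMF α) {g h : α → ENNReal}
    (hgh : ∀ a ∈ q.support, g a ≤ h a) : ∑' a, q a * g a ≤ ∑' a, q a * h a := by
  refine ENNReal.tsum_le_tsum fun a => ?_
  by_cases ha : q a = 0
  · simp [ha]
  · gcongr
    exact hgh a ((PMF.mem_support_iff _ _).2 ha)

/-- The law `p` of the state after a phase keeps the invariants, and the expected total of cost and
potential does not increase. -/
structure PhaseOk (inp : Input) (x : Finset ℕ × ℕ → ℝ) (δ : ℝ) (st : State) (p : PMF State) :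
    Prop where
  inv : ∀ st' ∈ p.support, Inv inp x δ st' ∧ st.out.length < st'.out.length
  le : ∑' st', p st' * ENNReal.ofReal (total inp x δ st') ≤ ENNReal.ofReal (total inp x δ st)

theorem runPhase_single (hst : Good inp st) (c : ℕ) :
    runPhase δ inp x st { lead := [], rest := [c], locks := [] } = evict inp c st := by
  obtain ⟨-, -, -, h, -⟩ := evict_spec c hst
  rw [runPhase_late (by simp [runLead])]
  simp only [List.nil_append, List.foldl_cons, List.foldl_nil, List.append_nil]
  rw [← h]

theorem evict_length_lt (hI : Inv inp x δ st) {i : ℕ} (hi : i ∈ buf inp st) :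
    st.out.length < (evict inp (inp.color i) st).out.length :=
  (evicted_evict (inp.color i) hI.good hI.last).now_lt (by simp)
    ⟨i, mem_available.2 ⟨hi, rfl⟩⟩

theorem phaseOk_case1 (hx : IsFeasible inp x) (hδ : 0 < δ) (hI : Inv inp x δ st) {i : ℕ}
    (hi : i ∈ buf inp st) (hr : δ ≤ rem inp x (now inp st) i) :
    PhaseOk inp x δ st (PMF.pure (evict inp (inp.color i) st)) := by
  refine ⟨?_, ?_⟩
  · intro st' hst'
    rw [PMF.mem_support_pure_iff] at hst'
    subst hst'
    exact ⟨hI.evicted hx (evicted_evict _ hI.good hI.last), evict_length_lt hI hi⟩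
  · rw [tsum_pure_mul]
    exact ENNReal.ofReal_le_ofReal (total_case1 hx hδ hI hi hr)

theorem phaseOk_case2 (hx : IsFeasible inp x) (hδ : 0 < δ) (hI : Inv inp x δ st)
    (h2 : (view inp x st).Case2 δ) {q : PMF ℕ}
    (hq : Proportional (buf inp st) (fun i => rate inp x i (now inp st)) q) :
    PhaseOk inp x δ st (q.map fun i => evict inp (inp.color i) st) := by
  rw [case2_iff] at h2
  have hw : ∀ i ∈ buf inp st, 0 ≤ rate inp x i (now inp st) := fun i _ => rate_nonneg hx i _
  have hpos : 0 < ∑ i ∈ buf inp st, rate inp x i (now inp st) := by linarith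
  have hκ := phaseConst_pos hδ
  have hβ : 0 ≤ 3 * phaseConst δ / δ := by positivity
  refine ⟨?_, ?_⟩
  · intro st' hst'
    obtain ⟨i, hi, rfl⟩ := (PMF.mem_support_map_iff _ _ _).1 hst'
    have hi' := hq.mem_of_ne_zero hw hpos ((PMF.mem_support_iff _ _).1 hi)
    exact ⟨hI.evicted hx (evicted_evict _ hI.good hI.last), evict_length_lt hI hi'⟩
  · rw [tsum_map_mul]
    refine (tsum_le_tsum_of_support q fun i _ =>
      ENNReal.ofReal_le_ofReal (total_case2 hx hδ hI i)).trans ?_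
    have hW := sum_rate_buf_le (st := st) hx
    have h1 := freePot_add_openWeight_le_total (st := st) hx hδ
    have h3 : 0 ≤ 2 / δ * freePot inp x δ st :=
      mul_nonneg (by positivity) (freePot_nonneg hx hI.locksOk)
    have h4 := mul_le_mul_of_nonneg_left hW hβ
    -- A family with a single member; the items are ordered by the length of their evictions.
    have h5 := tsum_mul_ofReal_le q {()} (fun _ => buf inp st) (fun _ i => i)
      (fun i => rate inp x i (now inp st)) (fun i => now inp (evict inp (inp.color i) st))
      (fun _ _ => hw) (fun _ _ => hpos) (fun _ _ => by
        have : q.map (fun i => i) = q := PMF.map_id q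
        rw [this]; exact hq)
      (K := total inp x δ st + 3 * phaseConst δ) hβ (by
        rw [Finset.sum_singleton]; linarith)
    simp only [Finset.sum_singleton] at h5
    refine h5.trans (ENNReal.ofReal_le_ofReal ?_)
    -- Case 2 provides weight at least `2 * δ`, and half of it is gained in expectation.
    have h6 : 3 * phaseConst δ / δ * δ ≤ 3 * phaseConst δ / δ *
        ((∑ i ∈ buf inp st, rate inp x i (now inp st)) / 2) :=
      mul_le_mul_of_nonneg_left (by linarith) hβ
    rw [div_mul_cancel₀ _ hδ.ne'] at h6
    linarith

/-- In expectation each subclass dooms weight at least `δ / 2`, which the factor `2 / δ` turns into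
the price 1 of its block. -/
theorem phaseOk_selected (hx : IsFeasible inp x) (hδ : 0 < δ) (hI : Inv inp x δ st)
    (h1 : ¬ (view inp x st).Case1 δ) {subs : Finset (Finset ℕ)}
    (hs : (view inp x st).IsSubclassFamily δ subs) {q : PMF (Finset ℕ → ℕ)}
    (hq : (view inp x st).IsChoiceLaw δ subs q) (F : (Finset ℕ → ℕ) → State)
    (hF : ∀ f, Selected inp x δ st subs f →
      Inv inp x δ (F f) ∧ st.out.length < (F f).out.length ∧
      total inp x δ (F f) ≤ total inp x δ st + subs.card -
        2 / δ * ∑ S ∈ subs, doomed inp x δ st S (f S)) :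
    PhaseOk inp x δ st (q.map F) := by
  have hw : ∀ S ∈ subs, ∀ c ∈ S, 0 ≤ (view inp x st).weight δ c := fun S _ c _ =>
    hI.weight_nonneg c
  have hW : ∀ S ∈ subs, δ ≤ ∑ c ∈ S, (view inp x st).weight δ c := fun S hS => (hs.1 S hS).2.1
  have hpos : ∀ S ∈ subs, 0 < ∑ c ∈ S, (view inp x st).weight δ c := fun S hS =>
    hδ.trans_le (hW S hS)
  have hprop : ∀ S ∈ subs, Proportional S ((view inp x st).weight δ)
      (q.map fun f => f S) := hq
  have hsel : ∀ f ∈ q.support, Selected inp x δ st subs f := by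
    refine fun f hf => ⟨h1, hs, fun S hS => ?_⟩
    refine (hprop S hS).mem_of_ne_zero (hw S hS) (hpos S hS) ((PMF.mem_support_iff _ _).1 ?_)
    exact (PMF.mem_support_map_iff _ _ _).2 ⟨f, hf, rfl⟩
  refine ⟨?_, ?_⟩
  · intro st' hst'
    obtain ⟨f, hf, rfl⟩ := (PMF.mem_support_map_iff _ _ _).1 hst'
    have := hF f (hsel f hf)
    exact ⟨this.1, this.2.1⟩
  · rw [tsum_map_mul]
    refine (tsum_le_tsum_of_support q fun f hf =>
      ENNReal.ofReal_le_ofReal (hF f (hsel f hf)).2.2).trans ?_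
    obtain ⟨f₀, hf₀⟩ := q.support_nonempty
    have h2 := (hsel f₀ hf₀).sum_totalWeight_le hx hI
    have h3 := freePot_add_openWeight_le_total (st := st) hx hδ
    have h4 : 0 ≤ 3 * phaseConst δ / δ * openWeight inp x (now inp st) :=
      mul_nonneg (by have := phaseConst_pos hδ; positivity) (openWeight_nonneg hx _)
    have h5 := mul_le_mul_of_nonneg_left h2 (show 0 ≤ 2 / δ by positivity)
    have h6 := tsum_mul_ofReal_le q subs id (fun S f => f S) ((view inp x st).weight δ)
      (fun c => releaseTime inp x δ (available inp c st)) hw hpos hprop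
      (K := total inp x δ st + subs.card) (show 0 ≤ 2 / δ by positivity) (by
        have : (0 : ℝ) ≤ subs.card := Nat.cast_nonneg _
        have h7 : ∑ S ∈ subs, ∑ c ∈ id S, (view inp x st).weight δ c =
          ∑ S ∈ subs, (view inp x st).totalWeight δ S := rfl
        rw [h7]
        linarith)
    refine h6.trans (ENNReal.ofReal_le_ofReal ?_)
    have h7 : (subs.card : ℝ) * (δ / 2) ≤
        ∑ S ∈ subs, (∑ c ∈ id S, (view inp x st).weight δ c) / 2 := by
      rw [← nsmul_eq_mul]
      refine Finset.card_nsmul_le_sum _ _ _ fun S hS => ?_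
      have := hW S hS
      simp only [id]
      linarith
    have h8 := mul_le_mul_of_nonneg_left h7 (show 0 ≤ 2 / δ by positivity)
    have h9 : 2 / δ * ((subs.card : ℝ) * (δ / 2)) = subs.card := by
      field_simp
    linarith

theorem card_available_le {c₁ : ℕ}
    (hc₁ : (view inp x st).IsLargest (view inp x st).colors c₁) (c : ℕ) :
    (available inp c st).card ≤ (available inp c₁ st).card := by
  by_cases hc : c ∈ (view inp x st).colors
  · have := hc₁.2 c hc
    rwa [view_block, view_block] at this
  · have : available inp c st = ∅ :=
      Finset.not_nonempty_iff_eq_empty.1 fun h => hc (mem_view_colors.2 h)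
    rw [this]
    simp

theorem phaseOk_case3 (hx : IsFeasible inp x) (hδ : 0 < δ) (hδ' : δ < 1 / 100)
    (hI : Inv inp x δ st) (h1 : ¬ (view inp x st).Case1 δ) (h2 : ¬ (view inp x st).Case2 δ)
    (h3 : (view inp x st).Case3) {subs : Finset (Finset ℕ)}
    (hs : (view inp x st).IsSubclassFamily δ subs) {q : PMF (Finset ℕ → ℕ)}
    (hq : (view inp x st).IsChoiceLaw δ subs q) {c₁ : ℕ}
    (hc₁ : (view inp x st).IsLargest (view inp x st).colors c₁)
    {order : (Finset ℕ → ℕ) → List ℕ}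
    (ho : ∀ f, (order f).Nodup ∧ (order f).toFinset = insert c₁ (subs.image f)) :
    PhaseOk inp x δ st (q.map fun f => runPhase δ inp x st
      { lead := [], rest := order f, locks := (view inp x st).newLocks δ subs f }) := by
  refine phaseOk_selected hx hδ hI h1 hs hq _ fun f h => ?_
  rw [runPhase_late (by simp [runLead])]
  simp only [List.nil_append]
  set st₀ := (order f).foldl (fun s c => evict inp c s) st with hst₀
  have he₀ : Evicted inp (order f) st st₀ := evicted_foldl _ hI.good hI.last
  have he := he₀.with_locks (st.locks ++ (view inp x st).newLocks δ subs f)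
  have hav := mem_view_colors.1 hc₁.1
  have hc₁o : c₁ ∈ order f := by
    rw [← List.mem_toFinset, (ho f).2]
    exact Finset.mem_insert_self _ _
  have hmem : ∀ S ∈ subs, f S ∈ order f := by
    intro S hS
    rw [← List.mem_toFinset, (ho f).2]
    exact Finset.mem_insert_of_mem (Finset.mem_image_of_mem f hS)
  refine ⟨h.inv hx hδ hI he hmem, he₀.now_lt hc₁o hav,
    total_selected hx hδ hδ' hI h he ?_ ?_ fun h2' => ?_⟩
  · rw [← List.toFinset_card_of_nodup (ho f).1, (ho f).2]
    have := Finset.card_insert_le c₁ (subs.image f)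
    have := Finset.card_image_le (s := subs) (f := f)
    omega
  · rw [credit, if_neg (by tauto), if_pos h3]
  · change 1 / 4 ≤ openWeight inp x (now inp st) - openWeight inp x (now inp st₀)
    replace h2' : ¬ (view inp x st₀).Case2 δ := fun h => h2' (case2_iff.2 (case2_iff.1 h))
    refine progress_of_case3 hx hδ' hI.good hI.last he₀ ?_ ?_ h3 h2'
    · exact Finset.sum_pos' (fun _ _ => Nat.zero_le _)
        ⟨c₁, List.mem_toFinset.2 hc₁o, hav.card_pos⟩
    · have := h.sum_rem_le hx hδ hδ' hI hc₁ (Ev := (order f).toFinset) (ho f).2.ge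
      unfold blocksSize
      push_cast
      exact this

theorem phaseOk_case4 (hx : IsFeasible inp x) (hδ : 0 < δ) (hδ' : δ < 1 / 100)
    (hI : Inv inp x δ st) (hlen : st.out.length < inp.n)
    (h1 : ¬ (view inp x st).Case1 δ) (h2 : ¬ (view inp x st).Case2 δ)
    (h3 : ¬ (view inp x st).Case3) {subs : Finset (Finset ℕ)}
    (hs : (view inp x st).IsSubclassFamily δ subs) {q : PMF (Finset ℕ → ℕ)}
    (hq : (view inp x st).IsChoiceLaw δ subs q) {c₁ : ℕ}
    (hc₁ : (view inp x st).IsLargest (view inp x st).colors c₁)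
    {second : List ℕ} (hsecond : second.length ≤ 1)
    {order : (Finset ℕ → ℕ) → List ℕ}
    (ho : ∀ f, (order f).Nodup ∧
      (order f).toFinset = subs.image f \ (c₁ :: second).toFinset) :
    PhaseOk inp x δ st (q.map fun f => runPhase δ inp x st
      { lead := c₁ :: second, rest := order f
        locks := (view inp x st).newLocks δ subs f }) := by
  have hav := mem_view_colors.1 hc₁.1
  have hcredit : credit inp x δ st = 0 := by
    rw [credit, if_neg (by tauto), if_neg h3]
  by_cases hearly : (runLead δ inp x (c₁ :: second) st).2 = true
  · obtain ⟨pre, hne, hpre, he, hcase⟩ := runLead_early _ hI.good hI.last hearly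
    -- The leading blocks do not depend on the random choice, so an early end is deterministic and
    -- no lock is kept.
    have hconst : (fun f => runPhase δ inp x st
        { lead := c₁ :: second, rest := order f
          locks := (view inp x st).newLocks δ subs f }) =
        Function.const _ (runLead δ inp x (c₁ :: second) st).1 :=
      funext fun f => runPhase_early hearly
    rw [hconst, PMF.map_const]
    refine ⟨?_, ?_⟩
    · intro st' hst'
      rw [PMF.mem_support_pure_iff] at hst'
      subst hst'
      refine ⟨hI.evicted hx he, he.now_lt (c := c₁) ?_ hav⟩
      obtain ⟨t, ht⟩ := hpre
      cases pre with
      | nil => exact absurd rfl hne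
      | cons d pre =>
        rw [List.cons_append, List.cons.injEq] at ht
        simp [ht.1]
    · rw [tsum_pure_mul]
      refine ENNReal.ofReal_le_ofReal (total_early hx hδ hI he ?_ hcredit hcase)
      have := hpre.length_le
      rw [List.length_cons] at this
      omega
  · refine phaseOk_selected hx hδ hI h1 hs hq _ fun f h => ?_
    rw [runPhase_late hearly]
    dsimp only
    set cs := c₁ :: second ++ order f with hcs
    set st₀ := cs.foldl (fun s c => evict inp c s) st with hst₀
    have he₀ : Evicted inp cs st st₀ := evicted_foldl _ hI.good hI.last
    have he := he₀.with_locks (st.locks ++ (view inp x st).newLocks δ subs f)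
    have hc₁o : c₁ ∈ cs := by simp [hcs]
    have hmem : ∀ S ∈ subs, f S ∈ cs := by
      intro S hS
      by_cases hlead : f S ∈ c₁ :: second
      · exact List.mem_append_left _ hlead
      · refine List.mem_append_right _ ?_
        rw [← List.mem_toFinset, (ho f).2, Finset.mem_sdiff, List.mem_toFinset]
        exact ⟨Finset.mem_image_of_mem f hS, hlead⟩
    refine ⟨h.inv hx hδ hI he hmem, he₀.now_lt hc₁o hav,
      total_selected hx hδ hδ' hI h he ?_ ?_ fun h2' => ?_⟩
    · have h4 : (order f).length ≤ subs.card := by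
        rw [← List.toFinset_card_of_nodup (ho f).1, (ho f).2]
        exact (Finset.card_le_card Finset.sdiff_subset).trans Finset.card_image_le
      rw [hcs, List.length_append, List.length_cons]
      omega
    · rw [hcredit]
      exact (phaseConst_pos hδ).le
    · have he₁ := evicted_evict c₁ hI.good hI.last
      change 1 / 4 ≤ openWeight inp x (now inp st) - openWeight inp x (now inp st₀)
      replace h2' : ¬ (view inp x st₀).Case2 δ := fun h => h2' (case2_iff.2 (case2_iff.1 h))
      refine progress_of_case4 (cs := second ++ order f) hx hδ' hI.good hlen he₀
        (evicted_foldl _ he₁.good he₁.last) hav (card_available_le hc₁) ?_ h2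
        (not_case3_of_late hearly) h2'
      have := h.sum_rem_le hx hδ hδ' hI hc₁ (Ev := cs.toFinset) (by
        intro c hc
        rw [List.mem_toFinset]
        rcases Finset.mem_insert.1 hc with rfl | hc
        · exact hc₁o
        · obtain ⟨S, hS, rfl⟩ := Finset.mem_image.1 hc
          exact hmem S hS)
      unfold blocksSize
      push_cast
      exact this

theorem phaseOk_step (hx : IsFeasible inp x) (hδ : 0 < δ) (hδ' : δ < 1 / 100)
    {π : View → PMF Plan} (hπ : IsRounding δ π) (hI : Inv inp x δ st)
    (hlen : st.out.length < inp.n) : PhaseOk inp x δ st (step δ inp x π st) := by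
  obtain ⟨hp1, hp2, hp3, hp4⟩ := hπ _ (hI.isProperView hx hlen)
  rw [step, if_neg hlen.ne]
  by_cases h1 : (view inp x st).Case1 δ
  · obtain ⟨i, hi, hr, hp⟩ := hp1 h1
    rw [view_buffer] at hi
    rw [view_removed] at hr
    rw [hp, PMF.pure_map, view_color_of_mem_buf hi, runPhase_single hI.good]
    exact phaseOk_case1 hx hδ hI hi hr
  by_cases h2 : (view inp x st).Case2 δ
  · obtain ⟨q, hq, hp⟩ := hp2 h1 h2
    have hq' : Proportional (buf inp st) (fun i => rate inp x i (now inp st)) q := by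
      intro i hi
      have hslot : (view inp x st).slot = now inp st := rfl
      rw [hq i (by rwa [view_buffer]), view_buffer, hslot, view_frac le_rfl,
        Finset.sum_congr rfl fun a _ => view_frac le_rfl]
    have hok := phaseOk_case2 hx hδ hI h2 hq'
    have hpos : 0 < ∑ i ∈ buf inp st, rate inp x i (now inp st) := by
      have := case2_iff.1 h2
      linarith
    have hmap : (π (view inp x st)).map (runPhase δ inp x st) =
        q.map fun i => evict inp (inp.color i) st := by
      rw [hp, PMF.map_comp, PMF.map, PMF.map]
      ext st'
      rw [PMF.bind_apply, PMF.bind_apply]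
      refine tsum_congr fun i => ?_
      by_cases hqi : q i = 0
      · rw [hqi, zero_mul, zero_mul]
      · have hi := hq'.mem_of_ne_zero (fun i _ => rate_nonneg hx i _) hpos hqi
        simp only [Function.comp_apply]
        rw [view_color_of_mem_buf hi, runPhase_single hI.good]
    rw [hmap]
    exact hok
  by_cases h3 : (view inp x st).Case3
  · obtain ⟨subs, hs, q, hq, c₁, hc₁, order, ho, hp⟩ := hp3 h1 h2 h3
    rw [hp, PMF.map_comp]
    exact phaseOk_case3 hx hδ hδ' hI h1 h2 h3 hs hq hc₁ ho
  · obtain ⟨subs, hs, q, hq, c₁, hc₁, second, hsec, order, ho, hp⟩ := hp4 h1 h2 h3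
    rw [hp, PMF.map_comp]
    refine phaseOk_case4 hx hδ hδ' hI hlen h1 h2 h3 hs hq hc₁ ?_ ho
    rcases hsec with ⟨-, rfl⟩ | ⟨c₂, -, rfl⟩ <;> simp

/-- The initial state. -/
def start : State := { out := [], locks := [] }

theorem inv_start (hx : IsFeasible inp x) : Inv inp x δ start where
  good := ⟨by simp [start], by simp [start], by simp [start], by simp [start], by simp [start]⟩
  last := by simp [LastGone, start]
  amount_nonneg := by simp [start]
  block_sub := by simp [start]
  disj := by simp [start]
  amount_le := by simp [start]
  locked_le := fun i => by simpa [start, lockedAt] using rem_nonneg hx _ i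

/-- Every phase outputs at least one item, so after `inp.n` phases all items are output. -/
theorem run_spec (hx : IsFeasible inp x) (hδ : 0 < δ) (hδ' : δ < 1 / 100)
    {π : View → PMF Plan} (hπ : IsRounding δ π) (m : ℕ) :
    (∀ st ∈ (run δ inp x π m).support, Inv inp x δ st ∧ min m inp.n ≤ st.out.length) ∧
      ∑' st, run δ inp x π m st * ENNReal.ofReal (total inp x δ st) ≤
        ENNReal.ofReal (total inp x δ start) := by
  induction m with
  | zero =>
    refine ⟨?_, ?_⟩
    · intro st hst
      rw [run, PMF.mem_support_pure_iff] at hst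
      subst hst
      exact ⟨inv_start hx, by simp⟩
    · rw [run, tsum_pure_mul]
      exact le_rfl
  | succ m ih =>
    refine ⟨?_, ?_⟩
    · intro st' hst'
      rw [run] at hst'
      obtain ⟨st, hst, hst'⟩ := (PMF.mem_support_bind_iff _ _ _).1 hst'
      obtain ⟨hI, hm⟩ := ih.1 st hst
      by_cases hlen : st.out.length = inp.n
      · rw [step, if_pos hlen, PMF.mem_support_pure_iff] at hst'
        subst hst'
        exact ⟨hI, by omega⟩
      · have hle := hI.good.length_le
        have := (phaseOk_step hx hδ hδ' hπ hI (by omega)).inv st' hst'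
        exact ⟨this.1, by omega⟩
    · rw [run, tsum_bind_mul]
      refine (tsum_le_tsum_of_support _ fun st hst => ?_).trans ih.2
      obtain ⟨hI, -⟩ := ih.1 st hst
      by_cases hlen : st.out.length = inp.n
      · rw [step, if_pos hlen, tsum_pure_mul]
      · have hle := hI.good.length_le
        exact (phaseOk_step hx hδ hδ' hπ hI (by omega)).le

theorem cost_le_total (hx : IsFeasible inp x) (hδ : 0 < δ) (hI : Inv inp x δ st) :
    (cost inp st.out : ℝ) ≤ total inp x δ st := by
  have hκ := phaseConst_pos hδ
  have h1 := credit_le (inp := inp) (x := x) hδ st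
  have h2 := unsentWeight_nonneg hx st
  have h3 := openWeight_nonneg hx (now inp st)
  have h4 := freePot_nonneg hx hI.locksOk
  have h5 := futureWeight_nonneg hx (now inp st)
  have h6 : 0 ≤ 3 * phaseConst δ / δ * unsentWeight inp x st := by positivity
  have h7 : 0 ≤ 3 * phaseConst δ / δ * openWeight inp x (now inp st) := by positivity
  have h8 : 0 ≤ 2 / δ * (freePot inp x δ st + futureWeight inp x (now inp st)) := by positivity
  unfold total pot
  linarith

theorem freePot_start : freePot inp x δ start = 0 := by
  refine Finset.sum_eq_zero fun c _ => ?_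
  unfold avgFree
  split_ifs
  · rw [Finset.sum_eq_zero, zero_div]
    intro i _
    rw [freeVol, rem_eq]
    simp only [start, List.map_nil, List.sum_nil, sub_zero]
    refine Finset.sum_eq_zero fun b hb => if_neg ?_
    rintro ⟨-, h⟩
    have h1 := le_start_of_mem_batches hb
    have h2 := start_le_slotOf b i
    simp only [now, List.length_nil] at h
    omega
  · rfl

/-- Each of the three batch weights is at most `value`. The additive term `2 * phaseConst δ` is
absorbed since `value` is at least 1 for a nonempty input. -/
theorem total_start_le (hx : IsFeasible inp x) (hδ : 0 < δ) (hn : 0 < inp.n) :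
    total inp x δ start ≤
      (6 * phaseConst δ / δ + 2 / δ + 2 * phaseConst δ) * value inp x := by
  have hκ := phaseConst_pos hδ
  have hv := one_le_value hx hn
  have h1 : unsentWeight inp x start ≤ value inp x :=
    Finset.sum_le_sum fun b hb => by have := hx.1 b hb; split_ifs <;> linarith
  have h2 : openWeight inp x (now inp start) ≤ value inp x :=
    Finset.sum_le_sum fun b hb => by have := hx.1 b hb; split_ifs <;> linarith
  have h3 : futureWeight inp x (now inp start) ≤ value inp x :=
    Finset.sum_le_sum fun b hb => by have := hx.1 b hb; split_ifs <;> linarith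
  have h4 := credit_nonneg (inp := inp) (x := x) hδ start
  have h5 : cost inp start.out = 0 := by simp [cost, start]
  have hc : 0 ≤ 3 * phaseConst δ / δ := by positivity
  have h6 := mul_le_mul_of_nonneg_left h1 hc
  have h7 := mul_le_mul_of_nonneg_left h2 hc
  have h8 := mul_le_mul_of_nonneg_left h3 (show 0 ≤ 2 / δ by positivity)
  have h9 : 2 * phaseConst δ * 1 ≤ 2 * phaseConst δ * value inp x :=
    mul_le_mul_of_nonneg_left hv (by positivity)
  have h10 : 6 * phaseConst δ / δ * value inp x =
      3 * phaseConst δ / δ * value inp x + 3 * phaseConst δ / δ * value inp x := by ring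
  unfold total pot
  rw [h5, freePot_start, zero_add, Nat.cast_zero, add_mul, add_mul, h10]
  linarith

theorem isSchedule_of_mem_support (hx : IsFeasible inp x) (hδ : 0 < δ) (hδ' : δ < 1 / 100)
    {π : View → PMF Plan} (hπ : IsRounding δ π) {out : List ℕ}
    (h : out ∈ (outputLaw δ inp x π).support) : IsSchedule inp out := by
  obtain ⟨st, hst, rfl⟩ := (PMF.mem_support_map_iff _ _ _).1 h
  obtain ⟨hI, hlen⟩ := (run_spec hx hδ hδ' hπ inp.n).1 st hst
  have := hI.good.length_le
  exact hI.good.isSchedule (by omega)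

theorem expectedCost_le (hx : IsFeasible inp x) (hδ : 0 < δ) (hδ' : δ < 1 / 100)
    {π : View → PMF Plan} (hπ : IsRounding δ π) :
    expectedCost δ inp x π ≤ ENNReal.ofReal
      ((6 * phaseConst δ / δ + 2 / δ + 2 * phaseConst δ) * value inp x) := by
  rw [expectedCost, outputLaw, tsum_map_mul]
  -- Without items `value` need not reach 1, but then the cost is 0.
  rcases Nat.eq_zero_or_pos inp.n with hn | hn
  · rw [hn, run, tsum_pure_mul]
    simp [cost]
  · have h := run_spec hx hδ hδ' hπ inp.n
    refine (tsum_le_tsum_of_support _ fun st hst => ?_).trans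
      (h.2.trans (ENNReal.ofReal_le_ofReal (total_start_le hx hδ hn)))
    rw [← ENNReal.ofReal_natCast]
    exact ENNReal.ofReal_le_ofReal (cost_le_total hx hδ (h.1 st hst).1)

end

end RBM
end

theorem mainTheorem3 :
    ∃ δ₀ : ℝ, 0 < δ₀ ∧ ∀ δ : ℝ, 0 < δ → δ < δ₀ →
      (∃ π : RBM.View → PMF RBM.Plan, RBM.IsRounding δ π) ∧
      ∃ C : ℝ, 0 < C ∧
        ∀ π : RBM.View → PMF RBM.Plan, RBM.IsRounding δ π →
          ∀ (inp : RBM.Input) (x : Finset ℕ × ℕ → ℝ), RBM.IsFeasible inp x →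
            (∀ out ∈ (RBM.outputLaw δ inp x π).support, RBM.IsSchedule inp out) ∧
            RBM.expectedCost δ inp x π ≤ ENNReal.ofReal (C * RBM.value inp x) := by
  refine ⟨1 / 100, by norm_num, fun δ hδ hδ' => ⟨RBM.exists_isRounding hδ,
    6 * RBM.phaseConst δ / δ + 2 / δ + 2 * RBM.phaseConst δ, ?_, fun π hπ inp x hx =>
    ⟨fun out hout => RBM.isSchedule_of_mem_support hx hδ hδ' hπ hout,
      RBM.expectedCost_le hx hδ hδ' hπ⟩⟩⟩
  have := RBM.phaseConst_pos hδ
  positivity
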